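/- Let $S=\{\lambda_n\}_{n\ge1}$ be a sequence of nonzero complex numbers with $|\lambda_1|\le|\lambda_2|\le\dots$, $|\lambda_n|\to\infty$, with finite exponent of convergence $\mathsf e=\limsup_{n\to\infty}\frac{\log n}{\log|\lambda_n|}<\infty$, and let $\mathsf g=[\mathsf e]$ be its genus. Let $\log\Gamma(-\lambda,S)=-\sum_{n\ge1}\Big(\log\big(1-\tfrac{\lambda}{\lambda_n}\big)+\sum_{j=1}^{\mathsf g}\tfrac{(-1)^j}{j}\tfrac{(-\lambda)^j}{\lambda_n^j}\Big)$, the logarithm of the reciprocal of the canonical product of $S$ normalized to vanish at $\lambda=0$. Suppose that $S$ is a totally regular sequence of spectral type, that is: there are $c>0$ and $0<\theta<\pi$ such that $S$ lies in the interior of the sector $\Sigma_{\theta,c}=\{z:|\arg(z-c)|\le\theta/2\}$, and there are real numbers $\alpha_0>\alpha_1>\dots$, either finitely many, with last one $\alpha_N$, or infinitely many tending to $-\infty$ (in which case we put $N=\infty$, $\alpha_N=-\infty$), and complex coefficients $a_{\alpha_j,k}$ (finitely many nonzero for each $j$) such that, for every $M\in\mathbb N$ with $M\le N$, $$\log\Gamma(-\lambda,S)=\sum_{j=0}^{M}\sum_{k}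 a_{\alpha_j,k}(-\lambda)^{\alpha_j}\log^k(-\lambda)+o\big((-\lambda)^{\alpha_M}\big)\qquad(\lambda\to\infty,\ \lambda\in\mathbb C\setminus\Sigma_{\theta,c}),$$ where $a_{\alpha_j,k}=0$ for all $k\ne0,1$, and $a_{\alpha_j,1}=0$ unless $\alpha_j$ is a non-negative integer. The number $\alpha_N$ is called the order. Then the following hold. (1) There are coefficients $c_{\alpha_j,0}$ (the heat coefficients) such that for every $M\in\mathbb N$ with $M\le N$, as $t\to0^+$, $\sum_{n}e^{-t\lambda_n}=\sum_{j=0}^{M}c_{\alpha_j,0}t^{-\alpha_j}+o(t^{-\alpha_M})$. The function $\zeta(s,S)=\sum_n\lambda_n^{-s}$ ($\Re s>\mathsf e$) has a meromorphic continuation to the half-plane $\Re s>\alpha_N$. (2) If $\alpha_j>\mathsf e$, then $a_{\alpha_j,0}=a_{\alpha_j,1}=0$. In particular an integer $\alpha_j$ with a nonzero coefficient satisfies $\alpha_j\le\mathsf g$. (3) For every $j$, with $c_{\alpha_j,0}$ any coefficients as in (1), $$a_{\alpha_j,0}=\begin{cases}\Gamma(-\alpha_j)\,c_{\alpha_j,0}&\alpha_j\notin\mathbb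 Z\text{ or }\alpha_j\in\mathbb Z,\ \alpha_j\le-1,\\[2pt] \dfrac{(-1)^{\alpha_j}}{\alpha_j}\Big(\dfrac{1}{\alpha_j!}c_{\alpha_j,0}-\operatorname{FP}_{s=\alpha_j}\zeta(s,S)\Big)&\alpha_j\in\mathbb Z,\ 0<\alpha_j\le\mathsf g,\\[2pt] -\zeta'(0,S)&\alpha_j=0,\end{cases}$$ $$a_{\alpha_j,1}=\begin{cases}0&\alpha_j\notin\mathbb Z\text{ or }\alpha_j\in\mathbb Z,\ \alpha_j\le-1,\\[2pt] \dfrac{(-1)^{\alpha_j+1}}{\alpha_j!}c_{\alpha_j,0}&\alpha_j\in\mathbb Z,\ 0<\alpha_j\le\mathsf g,\\[2pt] -\zeta(0,S)=-c_{0,0}&\alpha_j=0.\end{cases}$$ Here $\operatorname{FP}_{s=\alpha_j}$ denotes the finite part, i.e. the constant term of the Laurent expansion at $s=\alpha_j$; in the case $\alpha_j=0$ the assertion includes that $\zeta(s,S)$ is regular at $s=0$. This holds whenever $\alpha_j>\alpha_N$, and also when $\alpha_j=\alpha_N$ if $\zeta(s,S)$ continues meromorphically to a neighbourhood of $\alpha_N$.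 In every case, in particular if $\alpha_j=\alpha_N$ and no such continuation exists, the formulas hold with the quantities taken as limits from the right: for $0<\alpha_j\le\mathsf g$ an integer, the finite part is the constant term of the expansion of $\zeta(s,S)$ in negative powers of $s-\alpha_j$, a constant, and $o(1)$, as $s\to\alpha_j$ through real $s>\alpha_j$; and for $\alpha_j=0$, $\zeta(0,S)$ and $\zeta'(0,S)$ are the limits of $\zeta(s,S)$ and $\zeta'(s,S)$ as $s\to0$ through real $s>0$. -/

import Mathlib

open Filter Topology Asymptotics

noncomputable section

namespace SpectralSeq

/-- Exponent of convergence `limsup log n / log |lam_n|` (the entry `S n` is `lam_{n+1}`). -/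
def exponent (S : ℕ → ℂ) : EReal :=
  limsup (fun n : ℕ => ((Real.log ((n : ℝ) + 1) / Real.log ‖S n‖ : ℝ) : EReal)) atTop

/-- Genus: the integer part of the exponent of convergence. -/
def genus (S : ℕ → ℂ) : ℕ := ⌊(exponent S).toReal⌋₊

/-- The polynomial in the exponential factor of the canonical product, evaluated at `w = z / lam_n`. -/
def expPoly (g : ℕ) (w : ℂ) : ℂ := ∑ j ∈ Finset.Icc 1 g, (-1 : ℂ) ^ j / (j : ℂ) * w ^ j

/-- The Gamma function of the sequence, the reciprocal of the canonical product. -/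
def Gamma (S : ℕ → ℂ) (z : ℂ) : ℂ :=
  (∏' n, (1 + z / S n) * Complex.exp (expPoly (genus S) (z / S n)))⁻¹

/-- The logarithm of the Gamma function, normalized by `logGamma S 0 = 0`. For a sequence in the
interior of a sector with positive vertex, the cuts of the logarithms of `1 + (-lam) / lam_n`
(as functions of `lam`) are rays inside that sector, so that `lam ↦ logGamma S (-lam)` is the
holomorphic branch of the logarithm on the complement of the sector; see `exp_logGamma`. -/
def logGamma (S : ℕ → ℂ) (z : ℂ) : ℂ :=
  -∑' n, (Complex.log (1 + z / S n) + expPoly (genus S) (z / S n))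

/-- The closed sector with vertex `c` and opening angle `θ`. -/
def sector (θ c : ℝ) : Set ℂ := {z | |Complex.arg (z - (c : ℂ))| ≤ θ / 2}

/-- The asymptotic domain, the complement of the sector. -/
def asymptoticDomain (θ c : ℝ) : Set ℂ := (sector θ c)ᶜ

/-- `log Γ(-lam, S) ~ ∑_j ∑_k a_{j,k} (-lam)^(α_j) log^k (-lam)` for large `lam` in `D`, where
`j` runs over `0, ..., N` (over all natural numbers if `N = ⊤`), the exponents are strictly
decreasing (to `-∞` if `N = ⊤`), and each `a j` has finitely many nonzero entries `a j k`. -/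
structure HasLogGammaExpansion (S : ℕ → ℂ) (D : Set ℂ) (N : ℕ∞) (α : ℕ → ℝ)
    (a : ℕ → ℕ →₀ ℂ) : Prop where
  strictAnti : ∀ i j : ℕ, i < j → (j : ℕ∞) ≤ N → α j < α i
  tendsto_atBot : N = ⊤ → Tendsto α atTop atBot
  isLittleO : ∀ M : ℕ, (M : ℕ∞) ≤ N →
    (fun lam : ℂ => logGamma S (-lam) - ∑ j ∈ Finset.range (M + 1),
        (a j).sum fun k x => x * (-lam) ^ (α j : ℂ) * Complex.log (-lam) ^ k)
      =o[Bornology.cobounded ℂ ⊓ 𝓟 D] fun lam : ℂ => (-lam) ^ (α M : ℂ)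

/-- The order of such an expansion: `α_N`, or `-∞` if `N = ⊤`. -/
def order (N : ℕ∞) (α : ℕ → ℝ) : EReal := if N = ⊤ then ⊥ else (α N.toNat : EReal)

/-- `S` is of spectral type, with `log Γ(-lam, S)` expanded as described by `N`, `α`, `a`. -/
structure IsSpectralType (S : ℕ → ℂ) (N : ℕ∞) (α : ℕ → ℝ) (a : ℕ → ℕ →₀ ℂ) : Prop where
  ne_zero : ∀ n, S n ≠ 0
  ordered : Monotone fun n => ‖S n‖
  tendsto_infty : Tendsto (fun n => ‖S n‖) atTop atTop
  exponent_lt_top : exponent S < ⊤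
  expansion : ∃ c θ : ℝ, 0 < c ∧ 0 < θ ∧ θ < Real.pi ∧ (∀ n, S n ∈ interior (sector θ c)) ∧
    HasLogGammaExpansion S (asymptoticDomain θ c) N α a

/-- Regular: the only powers of `log (-lam)` that occur are `0` and `1`. -/
structure IsRegular (S : ℕ → ℂ) (N : ℕ∞) (α : ℕ → ℝ) (a : ℕ → ℕ →₀ ℂ) : Prop
    extends IsSpectralType S N α a where
  coeff_eq_zero : ∀ j k : ℕ, (j : ℕ∞) ≤ N → 2 ≤ k → a j k = 0

/-- Totally regular: the only logarithmic terms are `(-lam)^m log (-lam)`, `m` an integer, `m ≥ 0`. -/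
structure IsTotallyRegular (S : ℕ → ℂ) (N : ℕ∞) (α : ℕ → ℝ) (a : ℕ → ℕ →₀ ℂ) : Prop
    extends IsRegular S N α a where
  log_terms : ∀ j : ℕ, (j : ℕ∞) ≤ N → a j 1 ≠ 0 → ∃ m : ℕ, α j = (m : ℝ)

/-- The heat function. -/
def heat (S : ℕ → ℂ) (t : ℝ) : ℂ := 1 + ∑' n, Complex.exp (-(t : ℂ) * S n)

/-- `f(t, S) - 1 ~ ∑_j c_j t^(-α_j)` for `t → 0+`, with `j` running over `0, ..., N`. -/
def HasHeatExpansion (S : ℕ → ℂ) (N : ℕ∞) (α : ℕ → ℝ) (c : ℕ → ℂ) : Prop :=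
  ∀ M : ℕ, (M : ℕ∞) ≤ N →
    (fun t : ℝ => heat S t - 1 - ∑ j ∈ Finset.range (M + 1), c j * ((t ^ (-α j) : ℝ) : ℂ))
      =o[𝓝[>] 0] fun t : ℝ => t ^ (-α M)

/-- `Z` is the zeta function `∑ lam_n^(-s)` continued meromorphically to `Ω` (in normal form: at
every removable singularity `Z` takes the limit value). -/
structure IsZetaContinuation (S : ℕ → ℂ) (Ω : Set ℂ) (Z : ℂ → ℂ) : Prop where
  meromorphic : MeromorphicNFOn Z Ω
  eq_series : ∀ s ∈ Ω, exponent S < (s.re : EReal) → Z s = ∑' n, S n ^ (-s)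

/-- `v` is the finite part (the constant Laurent coefficient) of `F` at `s₀`, where `s` tends to
`s₀` along `l`: `F s = ∑_{i < m} b_i (s - s₀)^(-i-1) + v + o(1)`. -/
def IsFinitePart (F : ℂ → ℂ) (l : Filter ℂ) (s₀ v : ℂ) : Prop :=
  ∃ (m : ℕ) (b : ℕ → ℂ),
    Tendsto (fun s => F s - ∑ i ∈ Finset.range m, b i / (s - s₀) ^ (i + 1)) l (𝓝 v)

/-- `s → x` through real `s > x`. -/
def rightOf (x : ℝ) : Filter ℂ := map (fun t : ℝ => (t : ℂ)) (𝓝[>] x)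

lemma logTaylor_eq (g : ℕ) (w : ℂ) : Complex.logTaylor (g + 1) w = -expPoly g w := by
  induction g with
  | zero => simp [Complex.logTaylor, expPoly]
  | succ g ih =>
    rw [Complex.logTaylor_succ, Pi.add_apply, ih, expPoly, expPoly, Finset.sum_Icc_succ_top (by omega)]
    push_cast
    ring

/-- `logGamma` is a logarithm of `Gamma`, as soon as `∑ |lam_n|^(-genus-1)` converges. -/
lemma exp_logGamma (S : ℕ → ℂ) (h0 : ∀ n, S n ≠ 0)
    (hs : Summable fun n => (‖S n‖⁻¹) ^ (genus S + 1))
    (z : ℂ) (hz : ∀ n, z ≠ -S n) : Complex.exp (logGamma S z) = Gamma S z := by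
  have hne : ∀ n, 1 + z / S n ≠ 0 := by
    intro n h
    have h1 := h0 n
    field_simp at h
    exact hz n (by linear_combination h)
  have hsum : Summable fun n => Complex.log (1 + z / S n) + expPoly (genus S) (z / S n) := by
    have h1 : Tendsto (fun n => ‖z / S n‖ ^ (genus S + 1)) atTop (𝓝 0) := by
      have := (hs.tendsto_atTop_zero).const_mul (‖z‖ ^ (genus S + 1))
      simpa [div_eq_mul_inv, mul_pow] using this
    have h2 : ∀ᶠ n in atTop, ‖z / S n‖ ^ (genus S + 1) < (1 / 2 : ℝ) ^ (genus S + 1) :=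
      h1.eventually (gt_mem_nhds (by positivity))
    refine Summable.of_norm_bounded_eventually_nat
      (g := fun n => 2 * ‖z‖ ^ (genus S + 1) * (‖S n‖⁻¹) ^ (genus S + 1)) (hs.mul_left _) ?_
    filter_upwards [h2] with n hn
    have h3 : ‖z / S n‖ < 1 / 2 := lt_of_pow_lt_pow_left₀ _ (by norm_num) hn
    have h4 := Complex.norm_log_sub_logTaylor_le (genus S) (z := z / S n) (by linarith)
    rw [logTaylor_eq, sub_neg_eq_add] at h4
    refine h4.trans ?_
    have h5 : (1 - ‖z / S n‖)⁻¹ ≤ 2 := by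
      rw [inv_le_comm₀ (by linarith) (by norm_num)]
      linarith
    have h6 : ‖z / S n‖ ^ (genus S + 1) = ‖z‖ ^ (genus S + 1) * (‖S n‖⁻¹) ^ (genus S + 1) := by
      rw [norm_div, div_eq_mul_inv, mul_pow]
    have h7 : (1 : ℝ) ≤ (genus S : ℝ) + 1 := by
      have : (0 : ℝ) ≤ (genus S : ℝ) := Nat.cast_nonneg _
      linarith
    calc ‖z / S n‖ ^ (genus S + 1) * (1 - ‖z / S n‖)⁻¹ / ((genus S : ℝ) + 1)
        ≤ ‖z / S n‖ ^ (genus S + 1) * (1 - ‖z / S n‖)⁻¹ :=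
          div_le_self (mul_nonneg (by positivity) (inv_nonneg.2 (by linarith))) h7
      _ ≤ ‖z / S n‖ ^ (genus S + 1) * 2 := by gcongr
      _ = _ := by rw [h6]; ring
  have hp := hsum.hasSum.cexp
  rw [logGamma, Complex.exp_neg, Gamma, ← hp.tprod_eq]
  congr 1
  refine tprod_congr fun n => ?_
  simp [Function.comp, Complex.exp_add, Complex.exp_log (hne n)]

end SpectralSeq

end

/-!
The proof compares three functions of the sequence: `logGamma` near infinity, the zeta function and
the heat sum.

*Reduction.* Since the vertex of the sector is positive, the sequence lies in a cone `κ |z| ≤ Re z`,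
and the expansion of `logGamma S q`, with `q = -lam`, holds in the complement of the reflected cone,
which contains the right half-plane (`IsRegular.exists_cone`).

*Zeta function.* For `exponent < Re s < genus + 1`, integration by parts and a Stieltjes integral
show that the Mellin transform at `-s` of `logGamma` on the positive half-line is
`-π / (s sin (π s)) ∑ lam_n ^ (-s)` (`mellin_logGamma`). The Mellin integral is split at `1`. The
part over `(0, 1]` is holomorphic for `Re s < genus + 1`. Beyond `1` the terms of the expansion
integrate to `a_{j,0} / (s - α_j) + a_{j,1} / (s - α_j) ^ 2`, and the remainder after the term `M`
gives a function that is holomorphic for `Re s > α_M`. This formula (`zetaFormula`) continues the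
zeta function meromorphically (`exists_isZetaContinuation`). At an integer `α_j = k` the factor
`s sin (π s)` vanishes, so the formula can be expanded at `k`. The remainder integral need not
continue across `Re s = α_j`, but it is `o(1 / (s - α_j))` as `s` decreases to `α_j`
(`tailMellin_tendsto`), and the zero of the factor removes it; this gives the one-sided limits
(`zetaFormula_tendsto_right`, `deriv_zetaFormula_tendsto_right`). A meromorphic function with a
limit from the right has the same limit in a punctured neighbourhood, so the two-sided assertions
follow whenever the continuation reaches `α_j`. For `α_j > exponent` the coefficients vanish because
`logGamma` is `O(x ^ σ)` on the half-line for every `σ > exponent` up to `genus + 1`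
(`HasConeExpansion.coeff_eq_zero`).

*Heat sum.* If `m > genus + 1`, the `m`-th derivative of `logGamma`, multiplied by `(-1) ^ m`, and
the Laplace transform of `t ^ (m - 1) ∑ exp (-t lam_n)` are both `(m - 1)! ∑ (lam_n + p) ^ (-m)`.
Differentiating the terms of the expansion `m` times gives pure powers of `p`, since every logarithm
comes with an integer power, and these powers are the Laplace transforms of the terms of the heat
expansion, with the coefficients `heatCoeff` (`laplace_heatRemainder`). Cauchy's estimates on discs
of radius proportional to `|p|` bound the `m`-th derivative of the remainder by `o(|p| ^ (α_M - m))`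
in the right half-plane (`HasConeExpansion.norm_iteratedDeriv_remainder_le`). Fourier inversion on
the line `Re p = 1 / t` turns this into the bound `o(t ^ (-α_M))` for the remainder of the heat
expansion (`norm_le_of_norm_laplace_le`, `HasConeExpansion.hasHeatExpansion`). Heat coefficients are
unique, so the formulas hold for any choice of them.
-/

namespace SpectralSeq

/-! ### Sequences in a cone and their exponent of convergence -/

/-- The sequence consists of nonzero points of the closed cone `κ |z| ≤ Re z`, where `0 < κ ≤ 1`.
This is what remains of the sector condition: a sector with positive vertex and opening angle
`θ < π` lies in the cone with `κ = cos (θ / 2)`. -/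
structure InCone (S : ℕ → ℂ) (κ : ℝ) : Prop where
  pos : 0 < κ
  le_one : κ ≤ 1
  ne_zero : ∀ n, S n ≠ 0
  le_re : ∀ n, κ * ‖S n‖ ≤ (S n).re

/-- The complement of the reflected cone `κ |q| ≤ -Re q`. Its points are the values `q = -lam` for
which the expansion of `logGamma S q` is used. -/
def coneCompl (κ : ℝ) : Set ℂ := {q | -q.re < κ * ‖q‖}

lemma isOpen_coneCompl (κ : ℝ) : IsOpen (coneCompl κ) :=
  isOpen_lt (by fun_prop) (by fun_prop)

lemma InCone.re_pos {S : ℕ → ℂ} {κ : ℝ} (h : InCone S κ) (n : ℕ) : 0 < (S n).re :=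
  lt_of_lt_of_le (mul_pos h.pos (norm_pos_iff.2 (h.ne_zero n))) (h.le_re n)

lemma InCone.norm_pos {S : ℕ → ℂ} {κ : ℝ} (h : InCone S κ) (n : ℕ) : 0 < ‖S n‖ :=
  norm_pos_iff.2 (h.ne_zero n)

lemma coneCompl_subset_slitPlane {κ : ℝ} (hκ : κ ≤ 1) : coneCompl κ ⊆ Complex.slitPlane := by
  intro q hq
  rw [Complex.mem_slitPlane_iff]
  by_contra! h
  have h1 : ‖q‖ = -q.re := by
    have : q = (q.re : ℂ) := by apply Complex.ext <;> simp [h.2]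
    rw [this, Complex.norm_real, Real.norm_of_nonpos h.1]; simp
  have h2 : -q.re < κ * ‖q‖ := hq
  nlinarith [norm_nonneg q]

lemma mem_coneCompl_of_re_pos {κ : ℝ} (hκ : 0 < κ) {q : ℂ} (hq : 0 < q.re) : q ∈ coneCompl κ := by
  have : 0 ≤ κ * ‖q‖ := by positivity
  show -q.re < κ * ‖q‖
  linarith

lemma ofReal_mem_coneCompl {κ : ℝ} (hκ : 0 < κ) {x : ℝ} (hx : 0 < x) :
    (x : ℂ) ∈ coneCompl κ := mem_coneCompl_of_re_pos hκ (by simpa using hx)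

/-- A sector with vertex `c > 0` lies in the cone with vertex `0` and the same opening angle. -/
lemma le_re_of_mem_sector {θ c : ℝ} (hc : 0 < c) (hθ : 0 < θ) (hθ' : θ < Real.pi) {z : ℂ}
    (hz : z ∈ sector θ c) : Real.cos (θ / 2) * ‖z‖ ≤ z.re := by
  have hz' : |Complex.arg (z - (c : ℂ))| ≤ θ / 2 := hz
  set κ := Real.cos (θ / 2)
  have hκ0 : 0 < κ := Real.cos_pos_of_mem_Ioo ⟨by linarith, by linarith⟩
  have hκ1 : κ ≤ 1 := Real.cos_le_one _
  have h1 : κ ≤ Real.cos (Complex.arg (z - c)) := by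
    rw [← Real.cos_abs (Complex.arg (z - c))]
    exact Real.cos_le_cos_of_nonneg_of_le_pi (abs_nonneg _) (by linarith) hz'
  have h2 : κ * ‖z - c‖ ≤ z.re - c := by
    have := Complex.norm_mul_cos_arg (z - c)
    simp only [Complex.sub_re, Complex.ofReal_re] at this
    rw [← this, mul_comm]
    gcongr
  have h3 : ‖z‖ ≤ ‖z - c‖ + c := by
    have := norm_add_le (z - c) (c : ℂ)
    simpa [abs_of_pos hc] using this
  nlinarith

lemma neg_mem_asymptoticDomain {θ c : ℝ} (hc : 0 < c) (hθ : 0 < θ) (hθ' : θ < Real.pi) {q : ℂ}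
    (hq : q ∈ coneCompl (Real.cos (θ / 2))) : -q ∈ asymptoticDomain θ c := by
  intro h
  have := le_re_of_mem_sector hc hθ hθ' h
  have h2 : -q.re < Real.cos (θ / 2) * ‖q‖ := hq
  simp only [norm_neg, Complex.neg_re] at this
  linarith

lemma exponent_nonneg {S : ℕ → ℂ} (hS : Tendsto (fun n => ‖S n‖) atTop atTop) :
    0 ≤ exponent S := by
  refine le_limsup_of_frequently_le (Eventually.frequently ?_)
  filter_upwards [hS.eventually_ge_atTop 1] with n hn
  have : 0 ≤ Real.log ((n : ℝ) + 1) / Real.log ‖S n‖ :=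
    div_nonneg (Real.log_nonneg (by linarith [n.cast_nonneg (α := ℝ)])) (Real.log_nonneg hn)
  exact_mod_cast this

lemma coe_toReal_exponent {S : ℕ → ℂ} (hS : Tendsto (fun n => ‖S n‖) atTop atTop)
    (he : exponent S < ⊤) : ((exponent S).toReal : EReal) = exponent S :=
  EReal.coe_toReal he.ne (ne_of_gt (lt_of_lt_of_le EReal.bot_lt_zero (exponent_nonneg hS)))

lemma summable_rpow_of_exponent_lt {S : ℕ → ℂ} (hS : Tendsto (fun n => ‖S n‖) atTop atTop)
    {σ : ℝ} (hσ : exponent S < σ) : Summable fun n => ‖S n‖ ^ (-σ) := by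
  obtain ⟨τ, h1, h2⟩ := EReal.lt_iff_exists_real_btwn.1 hσ
  have hτ : 0 < τ := by exact_mod_cast (exponent_nonneg hS).trans_lt h1
  have h2' : τ < σ := by exact_mod_cast h2
  have h3 := eventually_lt_of_limsup_lt (show limsup _ atTop < (τ : EReal) from h1)
  have hsum : Summable fun n : ℕ => ((n : ℝ) + 1) ^ (-(σ / τ)) := by
    have := (Real.summable_nat_rpow (p := -(σ / τ))).2
      (by rw [neg_lt_neg_iff, one_lt_div hτ]; exact h2')
    simpa using (summable_nat_add_iff 1).2 this
  refine hsum.of_norm_bounded_eventually_nat ?_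
  filter_upwards [h3, hS.eventually_gt_atTop 1] with n hn hn1
  have hlog : 0 < Real.log ‖S n‖ := Real.log_pos hn1
  have h4 : Real.log ((n : ℝ) + 1) < τ * Real.log ‖S n‖ := by
    have : Real.log ((n : ℝ) + 1) / Real.log ‖S n‖ < τ := by exact_mod_cast hn
    rwa [div_lt_iff₀ hlog] at this
  have hn0 : (0 : ℝ) < (n : ℝ) + 1 := by positivity
  have hS0 : 0 < ‖S n‖ := by linarith
  rw [Real.norm_of_nonneg (by positivity), Real.rpow_def_of_pos hS0, Real.rpow_def_of_pos hn0]
  apply Real.exp_le_exp.2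
  have h5 : σ / τ * Real.log ((n : ℝ) + 1) ≤ σ / τ * (τ * Real.log ‖S n‖) := by
    have : 0 ≤ σ / τ := by have := hτ.trans h2'; positivity
    gcongr
  have h6 : σ / τ * (τ * Real.log ‖S n‖) = σ * Real.log ‖S n‖ := by field_simp
  nlinarith

lemma genus_le_toReal_exponent {S : ℕ → ℂ} (hS : Tendsto (fun n => ‖S n‖) atTop atTop) :
    (genus S : ℝ) ≤ (exponent S).toReal :=
  Nat.floor_le (EReal.toReal_nonneg (exponent_nonneg hS))

lemma toReal_exponent_lt_genus_add_one (S : ℕ → ℂ) :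
    (exponent S).toReal < (genus S : ℝ) + 1 := Nat.lt_floor_add_one _

/-! ### Laplace transforms of powers and a Stieltjes integral -/

open MeasureTheory Set in
lemma integrableOn_rpow_mul_exp_neg_mul {a r : ℝ} (ha : 0 < a) (hr : 0 < r) :
    IntegrableOn (fun t : ℝ => t ^ (a - 1) * Real.exp (-(r * t))) (Ioi 0) := by
  have := integrableOn_rpow_mul_exp_neg_mul_rpow (p := 1) (s := a - 1) (b := r) (by linarith) one_pos hr
  simpa using this

open MeasureTheory Set in
lemma norm_cpow_mul_cexp {t : ℝ} (ht : 0 < t) (a p : ℂ) :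
    ‖(t : ℂ) ^ (a - 1) * Complex.exp (-(p * t))‖ = t ^ (a.re - 1) * Real.exp (-(p.re * t)) := by
  rw [norm_mul, Complex.norm_cpow_eq_rpow_re_of_pos ht, Complex.norm_exp]
  simp

open MeasureTheory Set in
lemma aestronglyMeasurable_cpow_mul_cexp (a p : ℂ) :
    AEStronglyMeasurable (fun t : ℝ => (t : ℂ) ^ (a - 1) * Complex.exp (-(p * t)))
      (volume.restrict (Ioi 0)) := by
  refine ContinuousOn.aestronglyMeasurable (fun t ht => ContinuousAt.continuousWithinAt ?_)
    measurableSet_Ioi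
  have := Complex.continuousAt_ofReal_cpow_const t (a - 1) (Or.inr (ne_of_gt ht))
  fun_prop

open MeasureTheory Set in
lemma integrableOn_cpow_mul_cexp {a p : ℂ} (ha : 0 < a.re) (hp : 0 < p.re) :
    IntegrableOn (fun t : ℝ => (t : ℂ) ^ (a - 1) * Complex.exp (-(p * t))) (Ioi 0) := by
  refine (integrableOn_rpow_mul_exp_neg_mul ha hp).mono'
    (aestronglyMeasurable_cpow_mul_cexp a p) ?_
  filter_upwards [ae_restrict_mem measurableSet_Ioi] with t ht
  exact (norm_cpow_mul_cexp ht a p).le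

open MeasureTheory Set in
/-- Euler's integral with a complex parameter `p`, continued from real `p` by the identity
theorem. -/
lemma integral_cpow_mul_cexp {a p : ℂ} (ha : 0 < a.re) (hp : 0 < p.re) :
    ∫ t : ℝ in Ioi 0, (t : ℂ) ^ (a - 1) * Complex.exp (-(p * t)) =
      Complex.Gamma a * p ^ (-a) := by
  set U : Set ℂ := {z | 0 < z.re} with hU
  have hUo : IsOpen U := isOpen_lt continuous_const Complex.continuous_re
  have hd1 : DifferentiableOn ℂ
      (fun z : ℂ => ∫ t : ℝ in Ioi 0, (t : ℂ) ^ (a - 1) * Complex.exp (-(z * t))) U := by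
    intro z hz
    have hz : 0 < z.re := hz
    have hs : {w : ℂ | z.re / 2 < w.re} ∈ 𝓝 z :=
      (isOpen_lt continuous_const Complex.continuous_re).mem_nhds
        (show z.re / 2 < z.re by linarith)
    have key := hasDerivAt_integral_of_dominated_loc_of_deriv_le (μ := volume.restrict (Ioi 0))
      (F := fun (z : ℂ) (t : ℝ) => (t : ℂ) ^ (a - 1) * Complex.exp (-(z * t)))
      (F' := fun (z : ℂ) (t : ℝ) => (t : ℂ) ^ (a - 1) * (Complex.exp (-(z * t)) * (-t)))
      (bound := fun t : ℝ => t ^ (a.re + 1 - 1) * Real.exp (-(z.re / 2 * t))) hs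
      (Eventually.of_forall fun w => aestronglyMeasurable_cpow_mul_cexp a w)
      (integrableOn_cpow_mul_cexp ha hz) ?_ ?_
      (integrableOn_rpow_mul_exp_neg_mul (by linarith) (by linarith)) ?_
    · exact key.2.differentiableAt.differentiableWithinAt
    · have := (aestronglyMeasurable_cpow_mul_cexp a z).mul
        (Complex.continuous_ofReal.neg.aestronglyMeasurable (μ := volume.restrict (Ioi 0)))
      refine this.congr (Eventually.of_forall fun t => ?_)
      simp only [Pi.mul_apply, Pi.neg_apply]
      ring
    · filter_upwards [ae_restrict_mem measurableSet_Ioi] with t ht w hw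
      have ht : 0 < t := ht
      have hw : z.re / 2 < w.re := hw
      rw [← mul_assoc, norm_mul, norm_cpow_mul_cexp ht, norm_neg, Complex.norm_real,
        Real.norm_of_nonneg ht.le, mul_right_comm]
      have : t ^ (a.re - 1) * t = t ^ (a.re + 1 - 1) := by
        rw [← Real.rpow_add_one ht.ne']; ring_nf
      rw [this]
      gcongr
    · refine Eventually.of_forall fun t w _ => ?_
      have h1 : HasDerivAt (fun w : ℂ => -(w * (t : ℂ))) (-(t : ℂ)) w := by
        simpa using ((hasDerivAt_id w).mul_const (t : ℂ)).fun_neg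
      exact (h1.cexp).const_mul _
  have hd2 : DifferentiableOn ℂ (fun z : ℂ => Complex.Gamma a * z ^ (-a)) U := by
    intro z hz
    have hz : 0 < z.re := hz
    have : DifferentiableAt ℂ (fun z : ℂ => z ^ (-a)) z :=
      (differentiableAt_id).cpow_const (Or.inl hz)
    exact (this.const_mul _).differentiableWithinAt
  have hpre : IsPreconnected U :=
    (convex_halfSpace_re_gt 0).isPreconnected
  have h1U : (1 : ℂ) ∈ U := by simp [hU]
  have hfreq : ∃ᶠ z in 𝓝[≠] (1 : ℂ),
      (∫ t : ℝ in Ioi 0, (t : ℂ) ^ (a - 1) * Complex.exp (-(z * t))) =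
        Complex.Gamma a * z ^ (-a) := by
    have ht : Tendsto (fun x : ℝ => (x : ℂ)) (𝓝[>] 1) (𝓝[≠] (1 : ℂ)) := by
      refine tendsto_nhdsWithin_iff.2 ⟨?_, ?_⟩
      · exact_mod_cast (Complex.continuous_ofReal.tendsto 1).mono_left nhdsWithin_le_nhds
      · filter_upwards [self_mem_nhdsWithin] with x hx
        simpa using ne_of_gt (show (1 : ℝ) < x from hx)
    refine ht.frequently (Eventually.frequently ?_)
    filter_upwards [self_mem_nhdsWithin] with x hx
    have hx0 : 0 < x := lt_trans one_pos hx
    rw [Complex.integral_cpow_mul_exp_neg_mul_Ioi ha hx0, mul_comm, Complex.cpow_neg, one_div,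
      Complex.inv_cpow]
    rw [Complex.arg_ofReal_of_nonneg hx0.le]
    exact Real.pi_pos.ne
  exact (hd1.analyticOnNhd hUo).eqOn_of_preconnected_of_frequently_eq (hd2.analyticOnNhd hUo)
    hpre h1U hfreq hp

open MeasureTheory Set in
/-- Write `1 / (x + l)` as a Laplace integral and interchange the integrations. -/
lemma integral_cpow_div_add {u l : ℂ} (hu0 : 0 < u.re) (hu1 : u.re < 1) (hl : 0 < l.re) :
    ∫ x : ℝ in Ioi 0, (x : ℂ) ^ (u - 1) / (x + l) =
      Complex.Gamma u * Complex.Gamma (1 - u) * l ^ (u - 1) := by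
  set F : ℝ → ℝ → ℂ := fun x t => (x : ℂ) ^ (u - 1) * Complex.exp (-((x + l) * t)) with hF
  have hlap : ∀ x : ℝ, 0 < x → ∫ t : ℝ in Ioi 0, F x t = (x : ℂ) ^ (u - 1) / (x + l) := by
    intro x hx
    have h := integral_cpow_mul_cexp (a := 1) (p := x + l) (by simp) (by simp; linarith)
    simp only [sub_self, Complex.cpow_zero, one_mul, Complex.Gamma_one, Complex.cpow_neg_one] at h
    rw [hF]
    simp only
    rw [integral_const_mul, h]
    rfl
  have hlap2 : ∀ t : ℝ, 0 < t → ∫ x : ℝ in Ioi 0, F x t =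
      Complex.Gamma u * ((t : ℂ) ^ ((1 - u) - 1) * Complex.exp (-(l * t))) := by
    intro t ht
    have h := integral_cpow_mul_cexp (a := u) (p := t) hu0 (by simpa using ht)
    have : ∀ x : ℝ, F x t =
        ((x : ℂ) ^ (u - 1) * Complex.exp (-((t : ℂ) * x))) * Complex.exp (-(l * t)) := by
      intro x
      rw [hF]
      simp only
      rw [mul_assoc, ← Complex.exp_add]
      congr 2
      ring
    simp_rw [this]
    rw [integral_mul_const, h]
    have : (1 - u) - 1 = -u := by ring
    rw [this]
    ring
  have hint : Integrable (Function.uncurry F)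
      ((volume.restrict (Ioi 0)).prod (volume.restrict (Ioi 0))) := by
    have hmeas : AEStronglyMeasurable (Function.uncurry F)
        ((volume.restrict (Ioi 0)).prod (volume.restrict (Ioi 0))) := by
      have : Measurable (Function.uncurry F) := by
        rw [hF]
        unfold Function.uncurry
        fun_prop
      exact this.aestronglyMeasurable
    have hnorm : ∀ t : ℝ, 0 < t → ∀ x : ℝ, 0 < x →
        ‖F x t‖ = x ^ (u.re - 1) * Real.exp (-(t * x)) * Real.exp (-(l.re * t)) := by
      intro t ht x hx
      rw [hF]
      simp only
      rw [norm_mul, Complex.norm_cpow_eq_rpow_re_of_pos hx, Complex.norm_exp, mul_assoc,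
        ← Real.exp_add]
      congr 2
      simp
      ring
    rw [integrable_prod_iff' hmeas]
    constructor
    · filter_upwards [ae_restrict_mem measurableSet_Ioi] with t ht
      have h := (integrableOn_cpow_mul_cexp (a := u) (p := t) hu0
        (by simpa using ht)).mul_const (Complex.exp (-(l * t)))
      refine h.congr (Eventually.of_forall fun x => ?_)
      simp only [Function.uncurry, hF]
      rw [mul_assoc, ← Complex.exp_add]
      congr 2
      ring
    · have h := (integrableOn_rpow_mul_exp_neg_mul (a := 1 - u.re) (r := l.re) (by linarith)
        hl).const_mul (Real.Gamma u.re)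
      refine h.congr ?_
      filter_upwards [ae_restrict_mem measurableSet_Ioi] with t ht
      have ht : 0 < t := ht
      have : ∫ x : ℝ in Ioi 0, ‖F x t‖ = ∫ x : ℝ in Ioi 0,
          x ^ (u.re - 1) * Real.exp (-(t * x)) * Real.exp (-(l.re * t)) :=
        setIntegral_congr_fun measurableSet_Ioi fun x hx => hnorm t ht x hx
      simp only [Function.uncurry]
      rw [this, integral_mul_const, Real.integral_rpow_mul_exp_neg_mul_Ioi hu0 ht]
      have : t ^ (1 - u.re - 1) = (1 / t) ^ u.re := by
        rw [one_div, Real.inv_rpow ht.le, ← Real.rpow_neg ht.le]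
        ring_nf
      rw [this]
      ring
  have hswap := integral_integral_swap hint
  have e1 : ∫ x : ℝ in Ioi 0, ∫ t : ℝ in Ioi 0, F x t =
      ∫ x : ℝ in Ioi 0, (x : ℂ) ^ (u - 1) / (x + l) :=
    setIntegral_congr_fun measurableSet_Ioi fun x hx => hlap x hx
  have e2 : ∫ t : ℝ in Ioi 0, ∫ x : ℝ in Ioi 0, F x t =
      ∫ t : ℝ in Ioi 0,
        Complex.Gamma u * ((t : ℂ) ^ ((1 - u) - 1) * Complex.exp (-(l * t))) :=
    setIntegral_congr_fun measurableSet_Ioi fun t ht => hlap2 t ht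
  rw [← e1, hswap, e2, integral_const_mul, integral_cpow_mul_cexp (by simpa using hu1) hl]
  have : -(1 - u) = u - 1 := by ring
  rw [this]
  ring

/-! ### The terms of the logarithm of the canonical product -/

/-- One summand of `-logGamma S q`, for the point `l` of the sequence and genus `g`. -/
noncomputable def logTerm (g : ℕ) (l q : ℂ) : ℂ := Complex.log (1 + q / l) + expPoly g (q / l)

lemma logGamma_eq_tsum_logTerm (S : ℕ → ℂ) (q : ℂ) :
    logGamma S q = -∑' n, logTerm (genus S) (S n) q := rfl

lemma logTerm_succ (g : ℕ) (l q : ℂ) :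
    logTerm (g + 1) l q = logTerm g l q + (-1) ^ (g + 1) / ((g : ℂ) + 1) * (q / l) ^ (g + 1) := by
  rw [logTerm, logTerm, expPoly, expPoly, Finset.sum_Icc_succ_top (by omega)]
  push_cast
  ring

@[simp] lemma logTerm_zero_right (g : ℕ) (l : ℂ) : logTerm g l 0 = 0 := by
  have : expPoly g 0 = 0 := by
    rw [expPoly]
    refine Finset.sum_eq_zero fun j hj => ?_
    rw [zero_pow (by have := (Finset.mem_Icc.1 hj).1; omega), mul_zero]
  simp [logTerm, this]

lemma hasDerivAt_logTerm (g : ℕ) {l q : ℂ} (hl : l ≠ 0) (hq : 1 + q / l ∈ Complex.slitPlane) :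
    HasDerivAt (logTerm g l) ((-q / l) ^ g / (l + q)) q := by
  have hne : l + q ≠ 0 := by
    have := Complex.slitPlane_ne_zero hq
    intro h
    apply this
    field_simp
    rw [h, mul_zero]
  have hdiv : HasDerivAt (fun q : ℂ => q / l) (1 / l) q := (hasDerivAt_id q).div_const l
  induction g with
  | zero =>
    have h1 : HasDerivAt (fun q : ℂ => Complex.log (1 + q / l)) (1 / l / (1 + q / l)) q :=
      (hdiv.const_add 1).clog hq
    have h2 : logTerm 0 l = fun q => Complex.log (1 + q / l) := by
      funext q; simp [logTerm, expPoly]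
    rw [h2]
    convert h1 using 1
    field_simp
  | succ g ih =>
    have h1 := ih.add ((hdiv.fun_pow (g + 1)).const_mul ((-1) ^ (g + 1) / ((g : ℂ) + 1)))
    have h2 : logTerm (g + 1) l = logTerm g l + fun q =>
        (-1) ^ (g + 1) / ((g : ℂ) + 1) * (q / l) ^ (g + 1) := by
      funext q; exact logTerm_succ g l q
    rw [h2]
    refine h1.congr_deriv ?_
    have hg : (g : ℂ) + 1 ≠ 0 := by exact_mod_cast g.succ_ne_zero
    obtain ⟨w, rfl⟩ : ∃ w, q = w * l := ⟨q / l, by field_simp⟩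
    have e1 : w * l / l = w := by field_simp
    have e2 : -(w * l) / l = (-1) * w := by field_simp
    have hw : 1 + w ≠ 0 := by simpa [e1] using Complex.slitPlane_ne_zero hq
    have e3 : l + w * l = (1 + w) * l := by ring
    rw [e1, e2, e3, mul_pow, mul_pow, Nat.add_sub_cancel]
    push_cast
    field_simp
    ring

lemma one_add_div_mem_slitPlane {l : ℂ} (hl : 0 < l.re) {x : ℝ} (hx : 0 ≤ x) :
    1 + (x : ℂ) / l ∈ Complex.slitPlane := by
  left
  have : ((x : ℂ) / l).re = x * l.re / Complex.normSq l := by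
    simp [Complex.div_re]
  rw [Complex.add_re, this]
  have := Complex.normSq_nonneg l
  simp only [Complex.one_re]
  positivity

lemma hasDerivAt_logTerm_ofReal (g : ℕ) {l : ℂ} (hl : 0 < l.re) {x : ℝ} (hx : 0 ≤ x) :
    HasDerivAt (fun y : ℝ => logTerm g l y) ((-(x : ℂ) / l) ^ g / (l + x)) x := by
  refine HasDerivAt.comp_ofReal (e := logTerm g l) (hasDerivAt_logTerm g ?_
    (one_add_div_mem_slitPlane hl hx))
  rintro rfl
  simp at hl

lemma continuousOn_logTerm_ofReal (g : ℕ) {l : ℂ} (hl : 0 < l.re) :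
    ContinuousOn (fun y : ℝ => logTerm g l y) (Set.Ici 0) :=
  fun _ hx => (hasDerivAt_logTerm_ofReal g hl hx).continuousAt.continuousWithinAt

/-- The derivative of `logTerm g l` on the positive half-line, dominated by each power between
`x ^ (g - 1)` and `x ^ g`. -/
lemma norm_deriv_logTerm_le {g : ℕ} {l : ℂ} (hl : 0 < l.re) {σ x : ℝ} (hx : 0 < x)
    (h1 : g ≤ σ) (h2 : σ ≤ g + 1) :
    ‖(-(x : ℂ) / l) ^ g / (l + x)‖ ≤ ‖l‖ ^ (-σ) * x ^ (σ - 1) := by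
  have hl0 : 0 < ‖l‖ := norm_pos_iff.2 (by rintro rfl; simp at hl)
  have hm1 : ‖l‖ ≤ ‖l + x‖ := by
    rw [← sq_le_sq₀ (norm_nonneg _) (norm_nonneg _), Complex.sq_norm, Complex.sq_norm,
      Complex.normSq_apply, Complex.normSq_apply]
    simp only [Complex.add_re, Complex.ofReal_re, Complex.add_im, Complex.ofReal_im, add_zero]
    nlinarith
  have hm2 : x ≤ ‖l + x‖ := by
    refine le_trans ?_ (Complex.re_le_norm _)
    simp; linarith
  have hlx : 0 < ‖l + x‖ := hx.trans_le hm2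
  have h3 : ‖l‖ ^ (σ - g) * x ^ (g + 1 - σ) ≤ ‖l + x‖ := by
    calc ‖l‖ ^ (σ - g) * x ^ (g + 1 - σ) ≤ ‖l + x‖ ^ (σ - g) * ‖l + x‖ ^ (g + 1 - σ) := by
          gcongr
      _ = ‖l + x‖ := by
          rw [← Real.rpow_add hlx]
          simp
  rw [norm_div, norm_pow, norm_div, norm_neg, Complex.norm_real, Real.norm_of_nonneg hx.le,
    div_le_iff₀ hlx]
  calc (x / ‖l‖) ^ g = ‖l‖ ^ (-σ) * x ^ (σ - 1) * (‖l‖ ^ (σ - g) * x ^ (g + 1 - σ)) := by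
        have e1 : ‖l‖ ^ (-σ) * ‖l‖ ^ (σ - g) = (‖l‖ ^ g)⁻¹ := by
          rw [← Real.rpow_add hl0, ← Real.rpow_natCast, ← Real.rpow_neg hl0.le]
          ring_nf
        have e2 : x ^ (σ - 1) * x ^ (g + 1 - σ) = x ^ g := by
          rw [← Real.rpow_add hx, ← Real.rpow_natCast]
          ring_nf
        rw [mul_mul_mul_comm, e1, e2, div_pow]
        ring
    _ ≤ _ := by gcongr

/-- Integrating the bound for the derivative: the term is at most `C |l| ^ (-σ) x ^ σ` for every
`σ ∈ (g, g + 1]`. -/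
lemma norm_logTerm_le {g : ℕ} {l : ℂ} (hl : 0 < l.re) {σ x : ℝ} (hx : 0 < x)
    (h1 : g < σ) (h2 : σ ≤ g + 1) :
    ‖logTerm g l x‖ ≤ ‖l‖ ^ (-σ) / σ * x ^ σ := by
  have hσ : 0 < σ := lt_of_le_of_lt g.cast_nonneg h1
  have hmem : ∀ y ∈ Set.uIcc 0 x, 0 ≤ y := fun y hy => by
    rw [Set.uIcc_of_le hx.le] at hy; exact hy.1
  have hne : ∀ y : ℝ, 0 ≤ y → l + (y : ℂ) ≠ 0 := fun y hy h => by
    have := congrArg Complex.re h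
    simp at this; linarith
  have hftc := intervalIntegral.integral_eq_sub_of_hasDerivAt (a := 0) (b := x)
    (f := fun y : ℝ => logTerm g l y) (f' := fun y : ℝ => (-(y : ℂ) / l) ^ g / (l + y))
    (fun y hy => hasDerivAt_logTerm_ofReal g hl (hmem y hy))
    (by
      refine ContinuousOn.intervalIntegrable ?_
      refine ContinuousOn.div (by fun_prop) (by fun_prop) fun y hy => hne y (hmem y hy))
  simp only [Complex.ofReal_zero, logTerm_zero_right, sub_zero] at hftc
  rw [← hftc]
  have hbi : IntervalIntegrable (fun y : ℝ => ‖l‖ ^ (-σ) * y ^ (σ - 1)) MeasureTheory.volume 0 x :=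
    (intervalIntegral.intervalIntegrable_rpow' (by linarith)).const_mul _
  refine (intervalIntegral.norm_integral_le_of_norm_le hx.le
    (MeasureTheory.ae_of_all _ fun y hy => ?_) hbi).trans (le_of_eq ?_)
  · exact norm_deriv_logTerm_le hl hy.1 h1.le h2
  · rw [intervalIntegral.integral_const_mul, integral_rpow (Or.inl (by linarith))]
    simp only [sub_add_cancel, Real.zero_rpow hσ.ne', sub_zero]
    ring

/-! ### Growth of `logGamma` on the positive half-line -/

section
variable {S : ℕ → ℂ} {κ : ℝ}

lemma exponent_lt_iff (hS : Tendsto (fun n => ‖S n‖) atTop atTop) (he : exponent S < ⊤) {σ : ℝ} :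
    exponent S < σ ↔ (exponent S).toReal < σ := by
  rw [← coe_toReal_exponent hS he, EReal.coe_lt_coe_iff]
  simp

lemma genus_lt_of_exponent_lt (hS : Tendsto (fun n => ‖S n‖) atTop atTop) (he : exponent S < ⊤)
    {σ : ℝ} (hσ : exponent S < σ) : (genus S : ℝ) < σ :=
  (genus_le_toReal_exponent hS).trans_lt ((exponent_lt_iff hS he).1 hσ)

lemma summable_norm_logTerm (hc : InCone S κ) (hS : Tendsto (fun n => ‖S n‖) atTop atTop)
    (he : exponent S < ⊤) {x : ℝ} (hx : 0 < x) :
    Summable fun n => ‖logTerm (genus S) (S n) x‖ := by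
  have h1 : exponent S < (((genus S : ℝ) + 1 : ℝ) : EReal) :=
    (exponent_lt_iff hS he).2 (toReal_exponent_lt_genus_add_one S)
  refine Summable.of_nonneg_of_le (fun _ => norm_nonneg _)
    (fun n => norm_logTerm_le (hc.re_pos n) hx (by linarith) le_rfl) ?_
  exact ((summable_rpow_of_exponent_lt hS h1).div_const _).mul_right _

lemma exists_norm_logGamma_le (hc : InCone S κ) (hS : Tendsto (fun n => ‖S n‖) atTop atTop)
    (he : exponent S < ⊤) {σ : ℝ} (h1 : exponent S < σ) (h2 : σ ≤ genus S + 1) :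
    ∃ C : ℝ, ∀ x : ℝ, 0 < x → ‖logGamma S x‖ ≤ C * x ^ σ := by
  refine ⟨∑' n, ‖S n‖ ^ (-σ) / σ, fun x hx => ?_⟩
  rw [logGamma_eq_tsum_logTerm, norm_neg]
  refine tsum_of_norm_bounded (((summable_rpow_of_exponent_lt hS h1).div_const σ).hasSum.mul_right
    (x ^ σ)) fun n => ?_
  exact norm_logTerm_le (hc.re_pos n) hx (genus_lt_of_exponent_lt hS he h1) h2

lemma exists_norm_logGamma_le_genus (hc : InCone S κ)
    (hS : Tendsto (fun n => ‖S n‖) atTop atTop) (he : exponent S < ⊤) :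
    ∃ C : ℝ, ∀ x : ℝ, 0 < x → ‖logGamma S x‖ ≤ C * x ^ ((genus S : ℝ) + 1) :=
  exists_norm_logGamma_le hc hS he
    ((exponent_lt_iff hS he).2 (toReal_exponent_lt_genus_add_one S)) le_rfl

end

/-! ### The Mellin transform of `logGamma` -/

lemma isBigO_rpow_of_forall_le {f : ℝ → ℂ} {l : Filter ℝ} {C σ : ℝ}
    (hl : ∀ᶠ x in l, 0 < x) (h : ∀ x : ℝ, 0 < x → ‖f x‖ ≤ C * x ^ σ) :
    f =O[l] fun x => x ^ σ := by
  refine IsBigO.of_bound C ?_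
  filter_upwards [hl] with x hx
  rw [Real.norm_of_nonneg (by positivity)]
  exact h x hx

lemma mellinConvergent_neg_of_forall_le {f : ℝ → ℂ} (hf : ContinuousOn f (Set.Ioi 0))
    {σ₁ σ₂ C₁ C₂ : ℝ} {s : ℂ} (h1 : ∀ x : ℝ, 0 < x → ‖f x‖ ≤ C₁ * x ^ σ₁)
    (h2 : ∀ x : ℝ, 0 < x → ‖f x‖ ≤ C₂ * x ^ σ₂) (hs1 : σ₁ < s.re) (hs2 : s.re < σ₂) :
    MellinConvergent f (-s) := by
  refine mellinConvergent_of_isBigO_rpow (a := -σ₁) (b := -σ₂)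
    (hf.locallyIntegrableOn measurableSet_Ioi) ?_ (by simpa using hs1) ?_ (by simpa using hs2)
  · simpa using isBigO_rpow_of_forall_le (eventually_gt_atTop 0) h1
  · simpa using isBigO_rpow_of_forall_le (l := 𝓝[>] (0 : ℝ)) self_mem_nhdsWithin h2

lemma tendsto_zero_of_norm_le_rpow {f : ℝ → ℂ} {l : Filter ℝ} {C δ : ℝ}
    (hl : ∀ᶠ x in l, 0 < x) (h : ∀ x : ℝ, 0 < x → ‖f x‖ ≤ C * x ^ δ)
    (hδ : Tendsto (fun x : ℝ => x ^ δ) l (𝓝 0)) : Tendsto f l (𝓝 0) := by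
  refine squeeze_zero_norm' ?_ (by simpa using hδ.const_mul C)
  filter_upwards [hl] with x hx using h x hx

open MeasureTheory Set in
/-- One integration by parts turns the Mellin transform of a term into a Stieltjes integral,
which is evaluated by the reflection formula. -/
lemma mellin_logTerm {g : ℕ} {l s : ℂ} (hl : 0 < l.re) (h1 : g < s.re) (h2 : s.re < g + 1) :
    mellin (fun x : ℝ => logTerm g l x) (-s) =
      Real.pi / (s * Complex.sin (Real.pi * s)) * l ^ (-s) := by
  have hg0 : (0 : ℝ) ≤ g := g.cast_nonneg
  have hs0 : s ≠ 0 := by rintro rfl; simp at h1; linarith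
  have hl0 : l ≠ 0 := by rintro rfl; simp at hl
  obtain ⟨σ₁, hσ1, hσ1'⟩ := exists_between h1
  obtain ⟨σ₂, hσ2, hσ2'⟩ := exists_between h2
  have hne : ∀ y : ℝ, 0 < y → l + (y : ℂ) ≠ 0 := fun y hy h => by
    have := congrArg Complex.re h
    simp at this; linarith
  have hf1 := fun (x : ℝ) (hx : 0 < x) =>
    norm_logTerm_le (g := g) hl hx hσ1 (hσ1'.trans h2).le
  have hf2 := fun (x : ℝ) (hx : 0 < x) =>
    norm_logTerm_le (g := g) hl hx (h1.trans hσ2) hσ2'.le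
  set u : ℝ → ℂ := fun x => logTerm g l x with hu
  set u' : ℝ → ℂ := fun x => (-(x : ℂ) / l) ^ g / (l + x) with hu'
  set v : ℝ → ℂ := fun x => (x : ℂ) ^ (-s) / (-s) with hv
  set v' : ℝ → ℂ := fun x => (x : ℂ) ^ (-s - 1) with hv'
  have hdu : ∀ x ∈ Ioi (0 : ℝ), HasDerivAt u (u' x) x := fun x hx =>
    hasDerivAt_logTerm_ofReal g hl (le_of_lt hx)
  have hdv : ∀ x ∈ Ioi (0 : ℝ), HasDerivAt v (v' x) x := fun x hx => by
    have := hasDerivAt_ofReal_cpow_const' (x := x) (ne_of_gt hx) (r := -s - 1)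
      (by intro h; apply hs0; linear_combination -h)
    simp only [sub_add_cancel] at this
    exact this
  have hconv : MellinConvergent u (-s) := mellinConvergent_neg_of_forall_le
    ((continuousOn_logTerm_ofReal g hl).mono Ioi_subset_Ici_self) hf1 hf2 hσ1' hσ2
  have hconv' : MellinConvergent u' (-(s - 1)) := by
    refine mellinConvergent_neg_of_forall_le (σ₁ := σ₁ - 1) (σ₂ := σ₂ - 1) ?_
      (fun x hx => norm_deriv_logTerm_le hl hx hσ1.le (hσ1'.trans h2).le)
      (fun x hx => norm_deriv_logTerm_le hl hx (h1.trans hσ2).le hσ2'.le)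
      (by simpa using hσ1') (by simpa using hσ2)
    exact ContinuousOn.div (by fun_prop) (by fun_prop) fun y hy => hne y hy
  have i1 : IntegrableOn (u * v') (Ioi 0) := by
    refine (show IntegrableOn (fun x : ℝ => (x : ℂ) ^ (-s - 1) • u x) (Ioi 0) volume from hconv).congr
      (Eventually.of_forall fun x => ?_)
    simp [hv', mul_comm]
  have i2 : IntegrableOn (u' * v) (Ioi 0) := by
    refine Integrable.congr ((show IntegrableOn (fun x : ℝ => (x : ℂ) ^ (-(s - 1) - 1) • u' x)
      (Ioi 0) volume from hconv').div_const (-s)) (Eventually.of_forall fun x => ?_)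
    have : -(s - 1) - 1 = -s := by ring
    simp only [this, hv, smul_eq_mul, Pi.mul_apply]
    ring
  have huv : ∀ (σ : ℝ), g < σ → σ ≤ g + 1 → ∀ x : ℝ, 0 < x →
      ‖(u * v) x‖ ≤ ‖l‖ ^ (-σ) / σ / ‖s‖ * x ^ (σ - s.re) := by
    intro σ hσ hσ' x hx
    simp only [Pi.mul_apply, hv, hu]
    rw [norm_mul, norm_div, norm_neg, Complex.norm_cpow_eq_rpow_re_of_pos hx]
    calc ‖logTerm g l x‖ * (x ^ (-s).re / ‖s‖)
        ≤ ‖l‖ ^ (-σ) / σ * x ^ σ * (x ^ (-s).re / ‖s‖) := by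
          gcongr
          exact norm_logTerm_le hl hx hσ hσ'
      _ = _ := by
          rw [sub_eq_add_neg σ, Real.rpow_add hx, Complex.neg_re]
          ring
  have l0 : Tendsto (u * v) (𝓝[>] 0) (𝓝 0) := by
    refine tendsto_zero_of_norm_le_rpow self_mem_nhdsWithin (huv σ₂ (h1.trans hσ2) hσ2'.le) ?_
    have := (Real.continuousAt_rpow_const 0 (σ₂ - s.re) (Or.inr (by linarith))).tendsto
    rw [Real.zero_rpow (by linarith)] at this
    exact this.mono_left nhdsWithin_le_nhds
  have l1 : Tendsto (u * v) atTop (𝓝 0) := by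
    refine tendsto_zero_of_norm_le_rpow (eventually_gt_atTop 0)
      (huv σ₁ hσ1 (hσ1'.trans h2).le) ?_
    have := tendsto_rpow_neg_atTop (y := s.re - σ₁) (by linarith)
    simpa using this
  have hparts := integral_Ioi_mul_deriv_eq_deriv_mul hdu hdv i1 i2 l0 l1
  have e1 : mellin u (-s) = ∫ x : ℝ in Ioi 0, u x * v' x := by
    rw [mellin]
    refine integral_congr_ae (Eventually.of_forall fun x => ?_)
    simp [hv', mul_comm]
  have e2 : ∫ x : ℝ in Ioi 0, u' x * v x =
      ((-1 / l) ^ g / (-s)) * ∫ x : ℝ in Ioi 0, (x : ℂ) ^ (((g : ℂ) + 1 - s) - 1) / (x + l) := by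
    rw [← integral_const_mul]
    refine setIntegral_congr_fun measurableSet_Ioi fun x hx => ?_
    have hx0 : (x : ℂ) ≠ 0 := by exact_mod_cast (ne_of_gt hx)
    have : (g : ℂ) + 1 - s - 1 = g + -s := by ring
    simp only [hu', hv]
    rw [this, Complex.cpow_add _ _ hx0, Complex.cpow_natCast, div_pow, div_pow, neg_pow (x : ℂ)]
    rw [add_comm l]
    ring
  rw [e1, hparts, e2, integral_cpow_div_add (by simp; linarith) (by simp; linarith) hl,
    Complex.Gamma_mul_Gamma_one_sub]
  have hsin : Complex.sin (Real.pi * ((g : ℂ) + 1 - s)) =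
      (-1) ^ g * Complex.sin (Real.pi * s) := by
    have : (Real.pi : ℂ) * ((g : ℂ) + 1 - s) = (Real.pi - Real.pi * s) + g * Real.pi := by ring
    rw [this, Complex.sin_antiperiodic.add_nat_mul_eq, Complex.sin_pi_sub]
  have hpow : l ^ ((g : ℂ) + 1 - s - 1) = l ^ g * l ^ (-s) := by
    have : (g : ℂ) + 1 - s - 1 = g + -s := by ring
    rw [this, Complex.cpow_add _ _ hl0, Complex.cpow_natCast]
  rw [hsin, hpow, div_pow]
  have hlg : l ^ g ≠ 0 := pow_ne_zero _ hl0
  have h11 : ((-1 : ℂ) ^ g) ≠ 0 := pow_ne_zero _ (by norm_num)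
  field_simp
  ring

section
variable {S : ℕ → ℂ} {κ : ℝ}

lemma continuousOn_logGamma_ofReal (hc : InCone S κ)
    (hS : Tendsto (fun n => ‖S n‖) atTop atTop) (he : exponent S < ⊤) :
    ContinuousOn (fun x : ℝ => logGamma S x) (Set.Ioi 0) := by
  have h1 : exponent S < (((genus S : ℝ) + 1 : ℝ) : EReal) :=
    (exponent_lt_iff hS he).2 (toReal_exponent_lt_genus_add_one S)
  have hg : (0 : ℝ) < (genus S : ℝ) + 1 := by positivity
  refine continuousOn_of_forall_continuousAt fun x hx => ?_
  have hx : 0 < x := hx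
  have : ContinuousOn (fun x : ℝ => logGamma S x) (Set.Ioo 0 (x + 1)) := by
    simp only [logGamma_eq_tsum_logTerm]
    refine (continuousOn_tsum (fun n => (continuousOn_logTerm_ofReal _ (hc.re_pos n)).mono
      fun y hy => hy.1.le) (((summable_rpow_of_exponent_lt hS h1).div_const ((genus S : ℝ) + 1)).mul_right
        ((x + 1) ^ ((genus S : ℝ) + 1))) fun n y hy => ?_).neg
    refine (norm_logTerm_le (hc.re_pos n) hy.1 (by linarith) le_rfl).trans ?_
    have := hy.1
    gcongr
    exact hy.2.le
  exact this.continuousAt (Ioo_mem_nhds hx (by linarith))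

open MeasureTheory Set in
/-- In the strip `exponent < Re s < genus + 1` the Dirichlet series is, up to an elementary factor,
the Mellin transform of `logGamma` on the positive half-line. -/
lemma mellin_logGamma (hc : InCone S κ) (hS : Tendsto (fun n => ‖S n‖) atTop atTop)
    (he : exponent S < ⊤) {s : ℂ} (h1 : exponent S < s.re) (h2 : s.re < genus S + 1) :
    mellin (fun x : ℝ => logGamma S x) (-s) =
      -(Real.pi / (s * Complex.sin (Real.pi * s)) * ∑' n, S n ^ (-s)) := by
  obtain ⟨σ₁, hσ1, hσ1'⟩ := exists_between ((exponent_lt_iff hS he).1 h1)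
  obtain ⟨σ₂, hσ2, hσ2'⟩ := exists_between h2
  have hg1 : (genus S : ℝ) < σ₁ := genus_lt_of_exponent_lt hS he ((exponent_lt_iff hS he).2 hσ1)
  have hg0 : (0 : ℝ) ≤ genus S := Nat.cast_nonneg _
  have hσ1p : 0 < σ₁ := by linarith
  have hσ2p : 0 < σ₂ := by linarith
  have hsum1 := (summable_rpow_of_exponent_lt hS ((exponent_lt_iff hS he).2 hσ1)).div_const σ₁
  have hsum2 := (summable_rpow_of_exponent_lt hS ((exponent_lt_iff hS he).2
    (hσ1.trans (hσ1'.trans hσ2)))).div_const σ₂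
  set F : ℕ → ℝ → ℂ := fun n x => (x : ℂ) ^ (-s - 1) • logTerm (genus S) (S n) x with hF
  have hb1 := fun n (x : ℝ) (hx : 0 < x) =>
    norm_logTerm_le (g := genus S) (hc.re_pos n) hx hg1 (hσ1'.trans h2).le
  have hb2 := fun n (x : ℝ) (hx : 0 < x) =>
    norm_logTerm_le (g := genus S) (hc.re_pos n) hx (hg1.trans (hσ1'.trans hσ2)) hσ2'.le
  have hFint : ∀ n, IntegrableOn (F n) (Ioi 0) := fun n =>
    mellinConvergent_neg_of_forall_le
      ((continuousOn_logTerm_ofReal _ (hc.re_pos n)).mono Ioi_subset_Ici_self)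
      (hb1 n) (hb2 n) hσ1' hσ2
  -- all terms are dominated by multiples of one function
  set B : ℝ → ℂ := fun x => ((min (x ^ σ₁) (x ^ σ₂) : ℝ) : ℂ) with hB
  have hBn : ∀ x : ℝ, 0 < x → ‖B x‖ = min (x ^ σ₁) (x ^ σ₂) := fun x hx => by
    rw [hB]
    simp only
    rw [Complex.norm_real, Real.norm_of_nonneg (by positivity)]
  have hBconv : MellinConvergent B (-s) := by
    refine mellinConvergent_neg_of_forall_le (C₁ := 1) (C₂ := 1) (σ₁ := σ₁) (σ₂ := σ₂) ?_
      (fun x hx => ?_) (fun x hx => ?_) hσ1' hσ2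
    · refine Complex.continuous_ofReal.comp_continuousOn (ContinuousOn.inf ?_ ?_)
      · exact fun x hx => (Real.continuousAt_rpow_const x σ₁ (Or.inl (ne_of_gt hx))).continuousWithinAt
      · exact fun x hx => (Real.continuousAt_rpow_const x σ₂ (Or.inl (ne_of_gt hx))).continuousWithinAt
    · rw [hBn x hx, one_mul]; exact min_le_left _ _
    · rw [hBn x hx, one_mul]; exact min_le_right _ _
  have hdom : ∀ n, ∀ x ∈ Ioi (0 : ℝ), ‖F n x‖ ≤
      (‖S n‖ ^ (-σ₁) / σ₁ + ‖S n‖ ^ (-σ₂) / σ₂) * ‖(x : ℂ) ^ (-s - 1) • B x‖ := by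
    intro n x hx
    have hx : 0 < x := hx
    have hlt : ‖logTerm (genus S) (S n) x‖ ≤
        (‖S n‖ ^ (-σ₁) / σ₁ + ‖S n‖ ^ (-σ₂) / σ₂) * min (x ^ σ₁) (x ^ σ₂) := by
      have p1 : 0 ≤ ‖S n‖ ^ (-σ₁) / σ₁ := by positivity
      have p2 : 0 ≤ ‖S n‖ ^ (-σ₂) / σ₂ := by positivity
      rcases min_choice (x ^ σ₁) (x ^ σ₂) with h | h <;> rw [h]
      · refine (hb1 n x hx).trans ?_
        gcongr
        linarith
      · refine (hb2 n x hx).trans ?_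
        gcongr
        linarith
    rw [hF]
    simp only
    rw [norm_smul, norm_smul, hBn x hx]
    calc _ ≤ ‖(x : ℂ) ^ (-s - 1)‖ *
          ((‖S n‖ ^ (-σ₁) / σ₁ + ‖S n‖ ^ (-σ₂) / σ₂) * min (x ^ σ₁) (x ^ σ₂)) := by gcongr
      _ = _ := by ring
  have hFsum : Summable fun n => ∫ x in Ioi 0, ‖F n x‖ := by
    refine Summable.of_nonneg_of_le (fun n => integral_nonneg fun x => norm_nonneg _) (fun n => ?_)
      ((hsum1.add hsum2).mul_right (∫ x : ℝ in Ioi 0, ‖(x : ℂ) ^ (-s - 1) • B x‖))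
    rw [← integral_const_mul]
    exact setIntegral_mono_on (hFint n).norm (hBconv.norm.const_mul _) measurableSet_Ioi (hdom n)
  have key := hasSum_integral_of_summable_integral_norm hFint hFsum
  have e1 : mellin (fun x : ℝ => logGamma S x) (-s) = -∫ x in Ioi 0, ∑' n, F n x := by
    rw [mellin, ← integral_neg]
    refine setIntegral_congr_fun measurableSet_Ioi fun x hx => ?_
    simp only [hF, logGamma_eq_tsum_logTerm]
    rw [Summable.tsum_const_smul _ (summable_norm_logTerm hc hS he hx).of_norm, smul_neg]
  rw [e1, ← key.tsum_eq, ← tsum_mul_left]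
  congr 1
  refine tsum_congr fun n => ?_
  exact mellin_logTerm (hc.re_pos n) (genus_lt_of_exponent_lt hS he h1) h2

end

/-! ### The expansion on the positive half-line -/

/-- The term of index `j` of a regular expansion of `log Γ`, in the variable `q = -lam`. -/
noncomputable def expansionTerm (α : ℕ → ℝ) (a : ℕ → ℕ →₀ ℂ) (j : ℕ) (q : ℂ) : ℂ :=
  a j 0 * q ^ (α j : ℂ) + a j 1 * q ^ (α j : ℂ) * Complex.log q

/-- The remainder of the expansion of `logGamma` after the term of index `M`. -/
noncomputable def remainder (S : ℕ → ℂ) (α : ℕ → ℝ) (a : ℕ → ℕ →₀ ℂ) (M : ℕ) (q : ℂ) : ℂ :=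
  logGamma S q - ∑ j ∈ Finset.range (M + 1), expansionTerm α a j q

/-- All remainders up to index `N` are small in the complement of the reflected cone. The comparison
function is the modulus of the complex power `q ^ α M`, whose exponent is real. -/
def HasConeExpansion (S : ℕ → ℂ) (κ : ℝ) (N : ℕ∞) (α : ℕ → ℝ) (a : ℕ → ℕ →₀ ℂ) : Prop :=
  ∀ M : ℕ, (M : ℕ∞) ≤ N → remainder S α a M
    =o[Bornology.cobounded ℂ ⊓ 𝓟 (coneCompl κ)] fun q => ‖q‖ ^ α M

lemma IsRegular.sum_eq_expansionTerm {S : ℕ → ℂ} {N : ℕ∞} {α : ℕ → ℝ} {a : ℕ → ℕ →₀ ℂ}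
    (h : IsRegular S N α a) {j : ℕ} (hj : (j : ℕ∞) ≤ N) (q : ℂ) :
    ((a j).sum fun k x => x * q ^ (α j : ℂ) * Complex.log q ^ k) = expansionTerm α a j q := by
  rw [Finsupp.sum_of_support_subset (a j) (s := {0, 1}) ?_ _ (by simp)]
  · simp [expansionTerm]
  · intro k hk
    by_contra hk'
    simp only [Finset.mem_insert, Finset.mem_singleton, not_or] at hk'
    exact (Finsupp.mem_support_iff.1 hk) (h.coeff_eq_zero j k hj (by omega))

/-- The cone condition and the expansion in the complement of the cone are all that is used of a
regular sequence. -/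
lemma IsRegular.exists_cone {S : ℕ → ℂ} {N : ℕ∞} {α : ℕ → ℝ} {a : ℕ → ℕ →₀ ℂ}
    (h : IsRegular S N α a) : ∃ κ, InCone S κ ∧ HasConeExpansion S κ N α a := by
  obtain ⟨c, θ, hc, hθ, hθ', hmem, hexp⟩ := h.expansion
  refine ⟨Real.cos (θ / 2), ⟨Real.cos_pos_of_mem_Ioo ⟨by linarith, by linarith⟩,
    Real.cos_le_one _, h.ne_zero,
    fun n => le_re_of_mem_sector hc hθ hθ' (interior_subset (hmem n))⟩, fun M hM => ?_⟩
  have ht : Tendsto (fun q : ℂ => -q)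
      (Bornology.cobounded ℂ ⊓ 𝓟 (coneCompl (Real.cos (θ / 2))))
      (Bornology.cobounded ℂ ⊓ 𝓟 (asymptoticDomain θ c)) := by
    refine tendsto_inf.2 ⟨tendsto_neg_cobounded.mono_left inf_le_left, tendsto_principal.2 ?_⟩
    filter_upwards [mem_inf_of_right (mem_principal_self _)] with q hq
    exact neg_mem_asymptoticDomain hc hθ hθ' hq
  have h1 := (hexp.isLittleO M hM).comp_tendsto ht
  refine (h1.congr' (Eventually.of_forall fun q => ?_) EventuallyEq.rfl).norm_right.congr'
    EventuallyEq.rfl ?_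
  · simp only [Function.comp, neg_neg, remainder]
    congr 1
    refine Finset.sum_congr rfl fun j hj => ?_
    refine h.sum_eq_expansionTerm (le_trans ?_ hM) q
    exact_mod_cast Nat.lt_succ_iff.1 (Finset.mem_range.1 hj)
  · filter_upwards [eventually_inf_principal.2 (Eventually.of_forall fun q hq => hq)] with q hq
    have hq0 : q ≠ 0 :=
      Complex.slitPlane_ne_zero (coneCompl_subset_slitPlane (Real.cos_le_one _) hq)
    simp only [Function.comp, neg_neg]
    rw [Complex.norm_cpow_real]

lemma tendsto_ofReal_cobounded_inf_coneCompl {κ : ℝ} (hκ : 0 < κ) :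
    Tendsto (fun x : ℝ => (x : ℂ)) atTop
      (Bornology.cobounded ℂ ⊓ 𝓟 (coneCompl κ)) := by
  refine tendsto_inf.2 ⟨?_, tendsto_principal.2 ?_⟩
  · rw [← tendsto_norm_atTop_iff_cobounded]
    simpa using! tendsto_abs_atTop_atTop
  · filter_upwards [eventually_gt_atTop 0] with x hx using ofReal_mem_coneCompl hκ hx

section
variable {S : ℕ → ℂ} {κ : ℝ} {N : ℕ∞} {α : ℕ → ℝ} {a : ℕ → ℕ →₀ ℂ}

lemma HasConeExpansion.isLittleO_ofReal (h : HasConeExpansion S κ N α a) (hκ : 0 < κ) {M : ℕ}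
    (hM : (M : ℕ∞) ≤ N) :
    (fun x : ℝ => remainder S α a M x) =o[atTop] fun x : ℝ => x ^ α M := by
  refine ((h M hM).comp_tendsto (tendsto_ofReal_cobounded_inf_coneCompl hκ)).congr'
    EventuallyEq.rfl ?_
  filter_upwards [eventually_gt_atTop 0] with x hx
  simp [abs_of_pos hx]

lemma expansionTerm_ofReal (j : ℕ) {x : ℝ} (hx : 0 < x) :
    expansionTerm α a j x = ((x ^ α j : ℝ) : ℂ) * (a j 0 + a j 1 * (Real.log x : ℂ)) := by
  rw [expansionTerm, Complex.ofReal_cpow hx.le, Complex.ofReal_log hx.le]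
  ring

lemma rpow_isLittleO_rpow_atTop {σ τ : ℝ} (h : σ < τ) :
    (fun x : ℝ => x ^ σ) =o[atTop] fun x : ℝ => x ^ τ := by
  refine (isLittleO_iff_tendsto' ?_).2 ?_
  · filter_upwards [eventually_gt_atTop 0] with x hx h0
    exact absurd h0 (Real.rpow_pos_of_pos hx τ).ne'
  · refine (tendsto_rpow_neg_atTop (sub_pos.2 h)).congr' ?_
    filter_upwards [eventually_gt_atTop 0] with x hx
    rw [← Real.rpow_sub hx, neg_sub]

lemma eq_zero_of_tendsto_add_mul_log {b d : ℂ}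
    (h : Tendsto (fun x : ℝ => b + d * (Real.log x : ℂ)) atTop (𝓝 0)) : b = 0 ∧ d = 0 := by
  have hlog : Tendsto (fun x : ℝ => ((Real.log x : ℝ) : ℂ)⁻¹) atTop (𝓝 0) := by
    have := (Complex.continuous_ofReal.tendsto 0).comp
      (tendsto_inv_atTop_zero.comp Real.tendsto_log_atTop)
    simpa [Function.comp_def] using this
  have h1 : Tendsto (fun x : ℝ => b * ((Real.log x : ℝ) : ℂ)⁻¹ + d) atTop (𝓝 0) := by
    have := h.mul hlog
    rw [mul_zero] at this
    refine this.congr' ?_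
    filter_upwards [eventually_gt_atTop 1] with x hx
    have : ((Real.log x : ℝ) : ℂ) ≠ 0 := by exact_mod_cast (Real.log_pos hx).ne'
    field_simp
  have hd : d = 0 := by
    have h2 : Tendsto (fun x : ℝ => b * ((Real.log x : ℝ) : ℂ)⁻¹ + d) atTop (𝓝 d) := by
      simpa using (hlog.const_mul b).add_const d
    exact tendsto_nhds_unique h2 h1
  subst hd
  simp only [zero_mul, add_zero] at h
  exact ⟨tendsto_nhds_unique tendsto_const_nhds h, rfl⟩

/-- Since `logGamma` grows more slowly than `x ^ σ` for every `σ` above the exponent of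
convergence, no power above the exponent occurs in its expansion. -/
lemma HasConeExpansion.coeff_eq_zero (h : HasConeExpansion S κ N α a) (hc : InCone S κ)
    (hS : Tendsto (fun n => ‖S n‖) atTop atTop) (he : exponent S < ⊤)
    (hα : ∀ i j : ℕ, i < j → (j : ℕ∞) ≤ N → α j < α i) (j : ℕ) :
    (j : ℕ∞) ≤ N → exponent S < α j → a j 0 = 0 ∧ a j 1 = 0 := by
  induction j using Nat.strong_induction_on with
  | _ j ih =>
    intro hj hej
    have hprev : ∀ i ∈ Finset.range j, ∀ q, expansionTerm α a i q = 0 := by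
      intro i hi q
      have hij := Finset.mem_range.1 hi
      have hlt := hα i j hij hj
      obtain ⟨h0, h1⟩ := ih i hij (le_trans (by exact_mod_cast hij.le) hj)
        (hej.trans (by exact_mod_cast hlt))
      simp [expansionTerm, h0, h1]
    have hrem : ∀ q, remainder S α a j q = logGamma S q - expansionTerm α a j q := fun q => by
      rw [remainder, Finset.sum_range_succ,
        Finset.sum_eq_zero fun i hi => hprev i hi q, zero_add]
    obtain ⟨σ, hσ1, hσ2⟩ := exists_between (show (exponent S).toReal < min (α j) (genus S + 1) from
      lt_min ((exponent_lt_iff hS he).1 hej) (toReal_exponent_lt_genus_add_one S))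
    obtain ⟨C, hC⟩ := exists_norm_logGamma_le hc hS he ((exponent_lt_iff hS he).2 hσ1)
      (hσ2.le.trans (min_le_right _ _))
    have hL : (fun x : ℝ => logGamma S x) =o[atTop] fun x : ℝ => x ^ α j :=
      (isBigO_rpow_of_forall_le (eventually_gt_atTop 0) hC).trans_isLittleO
        (rpow_isLittleO_rpow_atTop (hσ2.trans_le (min_le_left _ _)))
    have hT : (fun x : ℝ => expansionTerm α a j x) =o[atTop] fun x : ℝ => x ^ α j := by
      refine (hL.sub (h.isLittleO_ofReal hc.pos hj)).congr_left fun x => ?_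
      rw [hrem]; ring
    have hT2 : Tendsto (fun x : ℝ => a j 0 + a j 1 * (Real.log x : ℂ)) atTop (𝓝 0) := by
      rw [tendsto_zero_iff_norm_tendsto_zero]
      refine hT.norm_left.tendsto_div_nhds_zero.congr' ?_
      filter_upwards [eventually_gt_atTop 0] with x hx
      have : (0 : ℝ) < x ^ α j := by positivity
      rw [expansionTerm_ofReal j hx, norm_mul, Complex.norm_real, Real.norm_of_nonneg this.le]
      field_simp
    exact eq_zero_of_tendsto_add_mul_log hT2

lemma continuousOn_expansionTerm_ofReal (α : ℕ → ℝ) (a : ℕ → ℕ →₀ ℂ) (j : ℕ) :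
    ContinuousOn (fun x : ℝ => expansionTerm α a j x) (Set.Ioi 0) := by
  intro x hx
  have hx : (x : ℂ) ∈ Complex.slitPlane := by simpa using hx
  have h1 := Complex.continuousAt_ofReal_cpow_const x (α j : ℂ)
    (Or.inr (by rintro rfl; simp at hx))
  have h2 : ContinuousAt (fun x : ℝ => Complex.log (x : ℂ)) x :=
    (continuousAt_clog hx).comp Complex.continuous_ofReal.continuousAt
  unfold expansionTerm
  exact ((h1.const_mul _).add ((h1.const_mul _).mul h2)).continuousWithinAt

lemma continuousOn_remainder_ofReal (hc : InCone S κ)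
    (hS : Tendsto (fun n => ‖S n‖) atTop atTop) (he : exponent S < ⊤) (M : ℕ) :
    ContinuousOn (fun x : ℝ => remainder S α a M x) (Set.Ioi 0) :=
  (continuousOn_logGamma_ofReal hc hS he).sub
    (continuousOn_finsetSum _ fun j _ => continuousOn_expansionTerm_ofReal α a j)

/-! ### The continuation formula for the zeta function -/

open Set in
/-- The Mellin transform at `-s` of `logGamma` on `(0, 1]`. -/
noncomputable def headMellin (S : ℕ → ℂ) (s : ℂ) : ℂ :=
  mellin (indicator (Ioc 0 1) fun x : ℝ => logGamma S x) (-s)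

open Set in
/-- The Mellin transform at `-s` of the remainder on `(1, ∞)`. -/
noncomputable def tailMellin (S : ℕ → ℂ) (α : ℕ → ℝ) (a : ℕ → ℕ →₀ ℂ) (M : ℕ) (s : ℂ) : ℂ :=
  mellin (indicator (Ioi 1) fun x : ℝ => remainder S α a M x) (-s)

/-- The right-hand side of the formula that continues the zeta function to `α M < Re s < genus + 1`:
the Mellin integral of `logGamma` is split at `1`, and beyond `1` the terms of the expansion are
integrated explicitly. -/
noncomputable def zetaFormula (S : ℕ → ℂ) (α : ℕ → ℝ) (a : ℕ → ℕ →₀ ℂ) (M : ℕ) (s : ℂ) : ℂ :=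
  -(s * Complex.sin (Real.pi * s) / Real.pi) * (headMellin S s +
    ∑ j ∈ Finset.range (M + 1), (a j 0 / (s - α j) + a j 1 / (s - α j) ^ 2) +
      tailMellin S α a M s)

open Set in
lemma locallyIntegrableOn_indicator_of_continuousOn {f : ℝ → ℂ} {t : Set ℝ}
    (hf : ContinuousOn f (Ioi 0)) (ht : MeasurableSet t) :
    MeasureTheory.LocallyIntegrableOn (indicator t f) (Ioi 0) := by
  intro x hx
  obtain ⟨u, hu, hi⟩ := hf.locallyIntegrableOn measurableSet_Ioi (μ := MeasureTheory.volume) x hx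
  exact ⟨u, hu, hi.indicator ht⟩

open Set in
lemma indicator_Ioc_isBigO_atTop (f : ℝ → ℂ) (b : ℝ) :
    indicator (Ioc 0 1) f =O[atTop] fun x : ℝ => x ^ b := by
  refine (isBigO_zero _ _).congr' ?_ EventuallyEq.rfl
  filter_upwards [eventually_gt_atTop 1] with x hx
  rw [indicator_of_notMem]
  exact fun h => absurd h.2 (not_le.2 hx)

open Set in
lemma indicator_Ioi_isBigO_nhds (f : ℝ → ℂ) (b : ℝ) :
    indicator (Ioi 1) f =O[𝓝[>] 0] fun x : ℝ => x ^ b := by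
  refine (isBigO_zero _ _).congr' ?_ EventuallyEq.rfl
  filter_upwards [mem_nhdsWithin_of_mem_nhds (Iio_mem_nhds (zero_lt_one (α := ℝ)))] with x hx
  rw [indicator_of_notMem]
  exact fun h => lt_asymm (show (1 : ℝ) < x from h) hx

open Set in
lemma headMellin_convergent_and_differentiableAt (hc : InCone S κ)
    (hS : Tendsto (fun n => ‖S n‖) atTop atTop) (he : exponent S < ⊤) {s : ℂ}
    (hs : s.re < genus S + 1) :
    MellinConvergent (indicator (Ioc 0 1) fun x : ℝ => logGamma S x) (-s) ∧
      DifferentiableAt ℂ (headMellin S) s := by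
  obtain ⟨C, hC⟩ := exists_norm_logGamma_le_genus hc hS he
  have hloc := locallyIntegrableOn_indicator_of_continuousOn
    (continuousOn_logGamma_ofReal hc hS he) (t := Ioc 0 1) measurableSet_Ioc
  have htop := indicator_Ioc_isBigO_atTop (fun x : ℝ => logGamma S x) (-(-s.re + 1))
  have hbot : indicator (Ioc 0 1) (fun x : ℝ => logGamma S x) =O[𝓝[>] 0]
      fun x : ℝ => x ^ (-(-((genus S : ℝ) + 1))) := by
    rw [neg_neg]
    refine isBigO_rpow_of_forall_le (C := C) self_mem_nhdsWithin fun x hx => ?_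
    exact (norm_indicator_le_norm_self _ x).trans (hC x hx)
  refine ⟨mellinConvergent_of_isBigO_rpow hloc htop (by simp) hbot (by simp; linarith), ?_⟩
  have := (mellin_differentiableAt_of_isBigO_rpow hloc htop (s := -s) (by simp) hbot
    (by simp; linarith))
  exact this.comp s differentiableAt_id.neg

open Set in
lemma tailMellin_convergent_and_hasDerivAt (h : HasConeExpansion S κ N α a) (hc : InCone S κ)
    (hS : Tendsto (fun n => ‖S n‖) atTop atTop) (he : exponent S < ⊤) {M : ℕ}
    (hM : (M : ℕ∞) ≤ N) {s : ℂ} (hs : α M < s.re) :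
    MellinConvergent (indicator (Ioi 1) fun x : ℝ => remainder S α a M x) (-s) ∧
      HasDerivAt (tailMellin S α a M) (-mellin (fun x : ℝ =>
        Real.log x • indicator (Ioi 1) (fun x : ℝ => remainder S α a M x) x) (-s)) s := by
  have hloc := locallyIntegrableOn_indicator_of_continuousOn
    (continuousOn_remainder_ofReal (α := α) (a := a) hc hS he M) (t := Ioi 1) measurableSet_Ioi
  have hbot := indicator_Ioi_isBigO_nhds (fun x : ℝ => remainder S α a M x) (-(-s.re - 1))
  have htop : indicator (Ioi 1) (fun x : ℝ => remainder S α a M x) =O[atTop]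
      fun x : ℝ => x ^ (-(-(α M))) := by
    rw [neg_neg]
    refine (h.isLittleO_ofReal hc.pos hM).isBigO.congr' ?_ EventuallyEq.rfl
    filter_upwards [eventually_gt_atTop 1] with x hx
    rw [indicator_of_mem (show x ∈ Ioi (1 : ℝ) from hx)]
  refine ⟨mellinConvergent_of_isBigO_rpow hloc htop (by simpa using hs) hbot (by simp), ?_⟩
  have := (mellin_hasDerivAt_of_isBigO_rpow hloc htop (s := -s) (by simpa using hs) hbot
    (by simp)).2
  have h2 := this.comp s (hasDerivAt_neg s)
  simpa [tailMellin, Function.comp_def] using! h2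

open Set MeasureTheory in
lemma hasMellin_indicator_Ioi_one {w : ℂ} (hw : w.re < 0) :
    HasMellin (indicator (Ioi 1) fun _ : ℝ => (1 : ℂ)) w (-1 / w) := by
  have hw0 : w ≠ 0 := by rintro rfl; simp at hw
  have e : ∀ x : ℝ, (x : ℂ) ^ (w - 1) • indicator (Ioi 1) (fun _ : ℝ => (1 : ℂ)) x =
      indicator (Ioi 1) (fun x : ℝ => (x : ℂ) ^ (w - 1)) x := fun x => by
    by_cases hx : x ∈ Ioi (1 : ℝ) <;> simp [hx]
  have hsub : Ioi (0 : ℝ) ∩ Ioi 1 = Ioi 1 := by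
    rw [Ioi_inter_Ioi]; simp
  have hw' : (w - 1).re < -1 := by
    rw [Complex.sub_re, Complex.one_re]; linarith
  constructor
  · rw [MellinConvergent]
    simp_rw [e]
    rw [IntegrableOn, integrable_indicator_iff measurableSet_Ioi, IntegrableOn,
      Measure.restrict_restrict measurableSet_Ioi, inter_comm, hsub]
    exact integrableOn_Ioi_cpow_of_lt hw' one_pos
  · rw [mellin]
    simp_rw [e]
    rw [setIntegral_indicator measurableSet_Ioi, hsub,
      integral_Ioi_cpow_of_lt hw' one_pos]
    simp

open Set MeasureTheory in
lemma hasMellin_indicator_Ioi_log {w : ℂ} (hw : w.re < 0) :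
    HasMellin (fun x : ℝ => Real.log x • indicator (Ioi 1) (fun _ : ℝ => (1 : ℂ)) x) w
      (1 / w ^ 2) := by
  have hw0 : w ≠ 0 := by rintro rfl; simp at hw
  have hloc := locallyIntegrableOn_indicator_of_continuousOn
    (continuousOn_const (c := (1 : ℂ))) (t := Ioi 1) measurableSet_Ioi
  have hbot := indicator_Ioi_isBigO_nhds (fun _ : ℝ => (1 : ℂ)) (-(w.re - 1))
  have htop : indicator (Ioi 1) (fun _ : ℝ => (1 : ℂ)) =O[atTop]
      fun x : ℝ => x ^ (-(0 : ℝ)) := by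
    refine IsBigO.of_bound 1 (Eventually.of_forall fun x => ?_)
    simpa using norm_indicator_le_norm_self (fun _ : ℝ => (1 : ℂ)) x
  have key := mellin_hasDerivAt_of_isBigO_rpow hloc htop hw hbot (by linarith)
  refine ⟨key.1, ?_⟩
  have h2 : HasDerivAt (fun w : ℂ => -1 / w) (1 / w ^ 2) w := by
    have := (hasDerivAt_inv hw0).neg
    refine (this.congr_of_eventuallyEq (Eventually.of_forall fun z => ?_)).congr_deriv ?_
    · simp [div_eq_mul_inv]
    · simp
  have h3 : mellin (indicator (Ioi 1) fun _ : ℝ => (1 : ℂ)) =ᶠ[𝓝 w] fun w => -1 / w := by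
    filter_upwards [(isOpen_lt Complex.continuous_re continuous_const).mem_nhds
      (show w.re < 0 from hw)] with z hz
    exact (hasMellin_indicator_Ioi_one hz).2
  exact key.2.unique (h2.congr_of_eventuallyEq h3)

open Set MeasureTheory in
lemma hasMellin_indicator_expansionTerm {j : ℕ} {s : ℂ}
    (hs : α j < s.re ∨ (a j 0 = 0 ∧ a j 1 = 0)) :
    HasMellin (indicator (Ioi 1) fun x : ℝ => expansionTerm α a j x) (-s)
      (a j 0 / (s - α j) + a j 1 / (s - α j) ^ 2) := by
  rcases hs with hs | ⟨h0, h1⟩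
  · have hw : (-s + (α j : ℂ)).re < 0 := by simpa using hs
    have hne : s - (α j : ℂ) ≠ 0 := by
      intro h
      have := congrArg Complex.re h
      simp at this; linarith
    have m1 := hasMellin_indicator_Ioi_one hw
    have m2 := hasMellin_indicator_Ioi_log hw
    have c1 := (MellinConvergent.cpow_smul.2 m1.1)
    have c2 := (MellinConvergent.cpow_smul.2 m2.1)
    have t := hasMellin_add (c1.const_smul (a j 0)) (c2.const_smul (a j 1))
    have e : (fun x : ℝ => a j 0 • ((x : ℂ) ^ (α j : ℂ) • indicator (Ioi 1) (fun _ => (1 : ℂ)) x) +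
        a j 1 • ((x : ℂ) ^ (α j : ℂ) •
          (Real.log x • indicator (Ioi 1) (fun _ : ℝ => (1 : ℂ)) x))) =
        indicator (Ioi 1) fun x : ℝ => expansionTerm α a j x := by
      funext x
      by_cases hx : x ∈ Ioi (1 : ℝ)
      · have hx0 : (0 : ℝ) ≤ x := zero_le_one.trans (le_of_lt hx)
        simp only [indicator_of_mem hx, expansionTerm, smul_eq_mul, ← Complex.ofReal_log hx0,
          Complex.real_smul]
        ring
      · simp [hx]
    rw [e] at t
    refine ⟨t.1, t.2.trans ?_⟩
    rw [mellin_const_smul, mellin_const_smul, mellin_cpow_smul, mellin_cpow_smul, m1.2, m2.2]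
    have : -s + (α j : ℂ) = -(s - α j) := by ring
    rw [this, neg_div_neg_eq, neg_sq, smul_eq_mul, smul_eq_mul]
    ring
  · have e : (indicator (Ioi 1) fun x : ℝ => expansionTerm α a j x) = fun _ => 0 := by
      funext x
      simp [expansionTerm, h0, h1]
    rw [e, h0, h1]
    constructor
    · simp [MellinConvergent]
    · simp [mellin]

open Set MeasureTheory in
/-- In the strip of absolute convergence the continuation formula gives the Dirichlet series. -/
lemma zetaFormula_eq_tsum (h : HasConeExpansion S κ N α a) (hc : InCone S κ)
    (hS : Tendsto (fun n => ‖S n‖) atTop atTop) (he : exponent S < ⊤)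
    (hα : ∀ i j : ℕ, i < j → (j : ℕ∞) ≤ N → α j < α i) {M : ℕ} (hM : (M : ℕ∞) ≤ N) {s : ℂ}
    (hs0 : α M < s.re) (hs1 : exponent S < s.re) (hs2 : s.re < genus S + 1) :
    zetaFormula S α a M s = ∑' n, S n ^ (-s) := by
  have hhead := (headMellin_convergent_and_differentiableAt hc hS he hs2).1
  have htail := (tailMellin_convergent_and_hasDerivAt h hc hS he hM hs0).1
  have hterm : ∀ j ∈ Finset.range (M + 1),
      HasMellin (indicator (Ioi 1) fun x : ℝ => expansionTerm α a j x) (-s)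
        (a j 0 / (s - α j) + a j 1 / (s - α j) ^ 2) := by
    intro j hj
    have hjN : (j : ℕ∞) ≤ N :=
      le_trans (by exact_mod_cast Nat.lt_succ_iff.1 (Finset.mem_range.1 hj)) hM
    refine hasMellin_indicator_expansionTerm ?_
    by_cases hej : exponent S < α j
    · exact Or.inr (h.coeff_eq_zero hc hS he hα j hjN hej)
    · left
      have := (not_lt.1 hej).trans_lt hs1
      exact_mod_cast this
  have hL := mellin_logGamma hc hS he hs1 hs2
  have hsplit : mellin (fun x : ℝ => logGamma S x) (-s) = headMellin S s +
      ∑ j ∈ Finset.range (M + 1), (a j 0 / (s - α j) + a j 1 / (s - α j) ^ 2) +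
      tailMellin S α a M s := by
    have e1 : ∑ j ∈ Finset.range (M + 1), (a j 0 / (s - α j) + a j 1 / (s - α j) ^ 2) =
        ∫ x : ℝ in Ioi 0, ∑ j ∈ Finset.range (M + 1), (x : ℂ) ^ (-s - 1) •
          indicator (Ioi 1) (fun x : ℝ => expansionTerm α a j x) x := by
      rw [integral_finsetSum _ fun j hj => (hterm j hj).1]
      exact Finset.sum_congr rfl fun j hj => (hterm j hj).2.symm
    rw [e1, headMellin, tailMellin, mellin, mellin, mellin, ← integral_add hhead
      (integrable_finsetSum _ fun j hj => (hterm j hj).1), ← integral_add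
      (f := fun x : ℝ => (x : ℂ) ^ (-s - 1) • indicator (Ioc 0 1) (fun x : ℝ => logGamma S x) x +
        ∑ j ∈ Finset.range (M + 1), (x : ℂ) ^ (-s - 1) •
          indicator (Ioi 1) (fun x : ℝ => expansionTerm α a j x) x)
      (hhead.add (integrable_finsetSum _ fun j hj => (hterm j hj).1)) htail]
    refine setIntegral_congr_fun measurableSet_Ioi fun x hx => ?_
    have hx : 0 < x := hx
    simp only [← Finset.smul_sum, ← smul_add]
    congr 1
    by_cases hx1 : x ≤ 1
    · have h1 : x ∈ Ioc (0 : ℝ) 1 := ⟨hx, hx1⟩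
      have h2 : x ∉ Ioi (1 : ℝ) := not_lt.2 hx1
      simp [indicator_of_mem h1, indicator_of_notMem h2]
    · have h1 : x ∉ Ioc (0 : ℝ) 1 := fun h => hx1 h.2
      have h2 : x ∈ Ioi (1 : ℝ) := not_le.1 hx1
      simp [indicator_of_notMem h1, indicator_of_mem h2, remainder]
  rw [zetaFormula, ← hsplit, hL]
  have hs0 : s ≠ 0 := by
    rintro rfl
    exact absurd hs1 (not_lt.2 (by simpa using exponent_nonneg hS))
  have hsin : Complex.sin (Real.pi * s) ≠ 0 := by
    rw [Complex.sin_ne_zero_iff]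
    intro k hk
    have hpi : (Real.pi : ℂ) ≠ 0 := by exact_mod_cast Real.pi_ne_zero
    have hk' : s = k := by
      apply mul_left_cancel₀ hpi
      rw [hk]; ring
    rw [hk'] at hs2
    have hg := genus_lt_of_exponent_lt hS he hs1
    rw [hk'] at hg
    simp only [Complex.intCast_re] at hs2 hg
    have h1 : (genus S : ℤ) < k := by exact_mod_cast hg
    have h2 : k < (genus S : ℤ) + 1 := by exact_mod_cast hs2
    omega
  have hpi : (Real.pi : ℂ) ≠ 0 := by exact_mod_cast Real.pi_ne_zero
  rw [mul_comm (Real.pi : ℂ) s] at hsin ⊢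
  field_simp

end

/-! ### The tail integral near the exponent of the last term -/

open Set MeasureTheory in
/-- A Mellin integral over `(1, ∞)` with an integrand that decays like `x ^ (-δ - 1)`, up to a
faster decaying part, is at most `A / δ` up to a bounded part. -/
lemma norm_mellin_le_of_forall_le {f : ℝ → ℂ} {s : ℂ} {A B δ : ℝ} (hδ : 0 < δ)
    (h0 : ∀ x : ℝ, x ≤ 1 → f x = 0)
    (h1 : ∀ x : ℝ, 1 < x → ‖(x : ℂ) ^ (-s - 1) * f x‖ ≤ A * x ^ (-δ - 1) + B * x ^ (-δ - 2)) :
    ‖mellin f (-s)‖ ≤ A / δ + B / (δ + 1) := by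
  have i1 : IntegrableOn (fun x : ℝ => x ^ (-δ - 1)) (Ioi 1) :=
    integrableOn_Ioi_rpow_of_lt (by linarith) one_pos
  have i2 : IntegrableOn (fun x : ℝ => x ^ (-δ - 2)) (Ioi 1) :=
    integrableOn_Ioi_rpow_of_lt (by linarith) one_pos
  have e : mellin f (-s) = ∫ x : ℝ in Ioi 1, (x : ℂ) ^ (-s - 1) * f x := by
    rw [mellin]
    refine (setIntegral_eq_of_subset_of_forall_sdiff_eq_zero measurableSet_Ioi
      (Ioi_subset_Ioi zero_le_one) fun x hx => ?_)
    rw [h0 x (not_lt.1 hx.2), smul_zero]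
  rw [e]
  refine (norm_integral_le_of_norm_le ((i1.const_mul A).add (i2.const_mul B)) ?_).trans
    (le_of_eq ?_)
  · filter_upwards [ae_restrict_mem measurableSet_Ioi] with x hx using h1 x hx
  · simp only [Pi.add_apply]
    rw [integral_add (i1.const_mul A) (i2.const_mul B), integral_const_mul, integral_const_mul,
      integral_Ioi_rpow_of_lt (by linarith) one_pos, integral_Ioi_rpow_of_lt (by linarith) one_pos]
    have e1 : -δ - 1 + 1 = -δ := by ring
    have e2 : -δ - 2 + 1 = -(δ + 1) := by ring
    rw [Real.one_rpow, Real.one_rpow, e1, e2, neg_div_neg_eq, neg_div_neg_eq]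
    ring

section
variable {S : ℕ → ℂ} {κ : ℝ} {N : ℕ∞} {α : ℕ → ℝ} {a : ℕ → ℕ →₀ ℂ}

/-- On `[1, ∞)` the remainder is at most `ε x ^ α M`, up to a part that is smaller by a power of `x`
and absorbs the compact range where the asymptotic estimate is not yet valid. -/
lemma HasConeExpansion.exists_norm_remainder_le (h : HasConeExpansion S κ N α a)
    (hc : InCone S κ) (hS : Tendsto (fun n => ‖S n‖) atTop atTop) (he : exponent S < ⊤) {M : ℕ}
    (hM : (M : ℕ∞) ≤ N) {ε : ℝ} (hε : 0 < ε) :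
    ∃ C : ℝ, 0 ≤ C ∧ ∀ x : ℝ, 1 ≤ x →
      ‖remainder S α a M x‖ ≤ ε * x ^ α M + C * x ^ (α M - 1) := by
  obtain ⟨X, hX⟩ := eventually_atTop.1 ((h.isLittleO_ofReal hc.pos hM).bound hε)
  have hcont : ContinuousOn (fun x : ℝ => remainder S α a M x / ((x ^ (α M - 1) : ℝ) : ℂ))
      (Set.Icc 1 X) := by
    have hpos : ∀ x ∈ Set.Icc 1 X, (0 : ℝ) < x := fun x hx => one_pos.trans_le hx.1
    refine ContinuousOn.div ((continuousOn_remainder_ofReal hc hS he M).mono hpos) ?_ ?_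
    · refine Complex.continuous_ofReal.comp_continuousOn fun x hx => ?_
      exact (Real.continuousAt_rpow_const x _ (Or.inl (hpos x hx).ne')).continuousWithinAt
    · intro x hx
      exact_mod_cast (Real.rpow_pos_of_pos (hpos x hx) _).ne'
  obtain ⟨C, hC⟩ := isCompact_Icc.exists_bound_of_continuousOn hcont
  refine ⟨max C 0, le_max_right _ _, fun x hx => ?_⟩
  have hx0 : 0 < x := one_pos.trans_le hx
  have p1 : 0 < x ^ α M := Real.rpow_pos_of_pos hx0 _
  have p2 : 0 < x ^ (α M - 1) := Real.rpow_pos_of_pos hx0 _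
  have p3 : 0 ≤ max C 0 := le_max_right _ _
  rcases le_total x X with h1 | h1
  · have h2 := hC x ⟨hx, h1⟩
    rw [norm_div, Complex.norm_real, Real.norm_of_nonneg p2.le, div_le_iff₀ p2] at h2
    calc _ ≤ C * x ^ (α M - 1) := h2
      _ ≤ max C 0 * x ^ (α M - 1) := by gcongr; exact le_max_left _ _
      _ ≤ _ := by have := mul_pos hε p1; linarith
  · have h2 := hX x h1
    rw [Real.norm_of_nonneg p1.le] at h2
    have := mul_nonneg p3 p2.le
    linarith

/-- The tail integral converges only for `Re s > α M`. As the remainder is `o(x ^ α M)`, the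
integral is `o(1 / z)` at `α M + z`: it cannot contribute to a simple pole, even if there is no
continuation across the line `Re s = α M`. -/
lemma tailMellin_tendsto (h : HasConeExpansion S κ N α a)
    (hc : InCone S κ) (hS : Tendsto (fun n => ‖S n‖) atTop atTop) (he : exponent S < ⊤) {M : ℕ}
    (hM : (M : ℕ∞) ≤ N) :
    Tendsto (fun z : ℝ => (z : ℂ) * tailMellin S α a M (α M + z)) (𝓝[>] 0) (𝓝 0) := by
  rw [Metric.tendsto_nhds]
  intro ε hε
  obtain ⟨C, hC0, hC⟩ := h.exists_norm_remainder_le hc hS he hM (half_pos hε)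
  have hlim : Tendsto (fun z : ℝ => ε / 2 + C * z) (𝓝[>] 0) (𝓝 (ε / 2 + C * 0)) :=
    ((continuous_const.add (continuous_const.mul continuous_id)).tendsto 0).mono_left
      nhdsWithin_le_nhds
  filter_upwards [hlim.eventually (gt_mem_nhds (show ε / 2 + C * 0 < ε by linarith)),
    self_mem_nhdsWithin] with z hz hz0
  have hz0 : 0 < z := hz0
  have key : ‖tailMellin S α a M (α M + z)‖ ≤ (ε / 2) / z + C / (z + 1) := by
    refine norm_mellin_le_of_forall_le hz0 (fun x hx => Set.indicator_of_notMem (not_lt.2 hx) _)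
      fun x hx => ?_
    have hx0 : 0 < x := one_pos.trans hx
    rw [Set.indicator_of_mem (show x ∈ Set.Ioi (1 : ℝ) from hx), norm_mul,
      Complex.norm_cpow_eq_rpow_re_of_pos hx0]
    calc _ ≤ x ^ (-((α M : ℂ) + z) - 1).re * ((ε / 2) * x ^ α M + C * x ^ (α M - 1)) := by
          gcongr; exact hC x hx.le
      _ = _ := by
          rw [mul_add, mul_left_comm, mul_left_comm _ C, ← Real.rpow_add hx0, ← Real.rpow_add hx0]
          simp
          ring_nf
  rw [dist_zero_right, norm_mul, Complex.norm_real, Real.norm_of_nonneg hz0.le]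
  calc _ ≤ z * ((ε / 2) / z + C / (z + 1)) := by gcongr
    _ = ε / 2 + C / (z + 1) * z := by field_simp
    _ ≤ ε / 2 + C * z := by
        gcongr
        exact div_le_self hC0 (by linarith)
    _ < ε := hz

/-- The derivative of the tail integral is `o(1 / z ^ 2)` at `α M + z`. -/
lemma deriv_tailMellin_tendsto (h : HasConeExpansion S κ N α a)
    (hc : InCone S κ) (hS : Tendsto (fun n => ‖S n‖) atTop atTop) (he : exponent S < ⊤) {M : ℕ}
    (hM : (M : ℕ∞) ≤ N) :
    Tendsto (fun z : ℝ => (z : ℂ) ^ 2 * deriv (tailMellin S α a M) (α M + z)) (𝓝[>] 0)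
      (𝓝 0) := by
  rw [Metric.tendsto_nhds]
  intro ε hε
  obtain ⟨C, hC0, hC⟩ := h.exists_norm_remainder_le hc hS he hM (show 0 < ε / 8 by linarith)
  have hlim : Tendsto (fun z : ℝ => ε / 2 + 2 * C * z) (𝓝[>] 0) (𝓝 (ε / 2 + 2 * C * 0)) :=
    ((continuous_const.add (continuous_const.mul continuous_id)).tendsto 0).mono_left
      nhdsWithin_le_nhds
  filter_upwards [hlim.eventually (gt_mem_nhds (show ε / 2 + 2 * C * 0 < ε by linarith)),
    self_mem_nhdsWithin] with z hz hz0
  have hz0 : 0 < z := hz0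
  have hd := (tailMellin_convergent_and_hasDerivAt h hc hS he hM
    (s := (α M : ℂ) + z) (by simpa using hz0)).2.deriv
  -- absorb the logarithm into the power `x ^ (z / 2)`
  have key : ‖mellin (fun x : ℝ => Real.log x •
      Set.indicator (Set.Ioi 1) (fun x : ℝ => remainder S α a M x) x) (-((α M : ℂ) + z))‖ ≤
      (2 / z * (ε / 8)) / (z / 2) + (2 / z * C) / (z / 2 + 1) := by
    refine norm_mellin_le_of_forall_le (half_pos hz0) (fun x hx => ?_) fun x hx => ?_
    · rw [Set.indicator_of_notMem (show x ∉ Set.Ioi (1 : ℝ) from not_lt.2 hx), smul_zero]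
    have hx0 : 0 < x := one_pos.trans hx
    have hlog : Real.log x ≤ 2 / z * x ^ (z / 2) := by
      have := Real.log_le_rpow_div hx0.le (half_pos hz0)
      calc _ ≤ _ := this
        _ = _ := by field_simp
    rw [Set.indicator_of_mem (show x ∈ Set.Ioi (1 : ℝ) from hx), norm_mul,
      Complex.norm_cpow_eq_rpow_re_of_pos hx0, norm_smul, Real.norm_of_nonneg (Real.log_pos hx).le]
    calc _ ≤ x ^ (-((α M : ℂ) + z) - 1).re *
          ((2 / z * x ^ (z / 2)) * ((ε / 8) * x ^ α M + C * x ^ (α M - 1))) := by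
          gcongr; exact hC x hx.le
      _ = 2 / z * (ε / 8) * (x ^ (-((α M : ℂ) + z) - 1).re * x ^ (z / 2) * x ^ α M) +
          2 / z * C * (x ^ (-((α M : ℂ) + z) - 1).re * x ^ (z / 2) * x ^ (α M - 1)) := by ring
      _ = _ := by
          rw [← Real.rpow_add hx0, ← Real.rpow_add hx0, ← Real.rpow_add hx0]
          simp
          ring_nf
  rw [hd, dist_zero_right, norm_mul, norm_neg, norm_pow, Complex.norm_real,
    Real.norm_of_nonneg hz0.le]
  calc _ ≤ z ^ 2 * ((2 / z * (ε / 8)) / (z / 2) + (2 / z * C) / (z / 2 + 1)) := by gcongr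
    _ = ε / 2 + 2 * (C / (z / 2 + 1)) * z := by field_simp; ring
    _ ≤ ε / 2 + 2 * C * z := by
        gcongr
        exact div_le_self hC0 (by linarith)
    _ < ε := hz

/-! ### Existence and uniqueness of the continuation -/

lemma analyticAt_headMellin (hc : InCone S κ) (hS : Tendsto (fun n => ‖S n‖) atTop atTop)
    (he : exponent S < ⊤) {s : ℂ} (hs : s.re < genus S + 1) : AnalyticAt ℂ (headMellin S) s := by
  have hU : IsOpen {w : ℂ | w.re < genus S + 1} := isOpen_lt Complex.continuous_re continuous_const
  have hd : DifferentiableOn ℂ (headMellin S) {w : ℂ | w.re < genus S + 1} := fun w hw =>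
    (headMellin_convergent_and_differentiableAt hc hS he hw).2.differentiableWithinAt
  exact hd.analyticAt (hU.mem_nhds hs)

lemma analyticAt_tailMellin (h : HasConeExpansion S κ N α a) (hc : InCone S κ)
    (hS : Tendsto (fun n => ‖S n‖) atTop atTop) (he : exponent S < ⊤) {M : ℕ}
    (hM : (M : ℕ∞) ≤ N) {s : ℂ} (hs : α M < s.re) : AnalyticAt ℂ (tailMellin S α a M) s := by
  have hU : IsOpen {w : ℂ | α M < w.re} := isOpen_lt continuous_const Complex.continuous_re
  have hd : DifferentiableOn ℂ (tailMellin S α a M) {w : ℂ | α M < w.re} := fun w hw =>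
    (tailMellin_convergent_and_hasDerivAt h hc hS he hM
      hw).2.differentiableAt.differentiableWithinAt
  exact hd.analyticAt (hU.mem_nhds hs)

lemma analyticAt_sin_factor (s : ℂ) :
    AnalyticAt ℂ (fun s : ℂ => -(s * Complex.sin (Real.pi * s) / Real.pi)) s := by
  have : Differentiable ℂ (fun s : ℂ => -(s * Complex.sin (Real.pi * s) / Real.pi)) := by
    fun_prop
  exact this.analyticAt s

lemma meromorphicAt_zetaFormula (h : HasConeExpansion S κ N α a) (hc : InCone S κ)
    (hS : Tendsto (fun n => ‖S n‖) atTop atTop) (he : exponent S < ⊤) {M : ℕ}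
    (hM : (M : ℕ∞) ≤ N) {s : ℂ} (hs : α M < s.re) (hs2 : s.re < genus S + 1) :
    MeromorphicAt (zetaFormula S α a M) s := by
  unfold zetaFormula
  refine (analyticAt_sin_factor s).meromorphicAt.mul (((analyticAt_headMellin hc hS he
    hs2).meromorphicAt.add (MeromorphicAt.fun_sum fun j => ?_)).add
      (analyticAt_tailMellin h hc hS he hM hs).meromorphicAt)
  fun_prop

lemma analyticAt_zetaFormula (h : HasConeExpansion S κ N α a) (hc : InCone S κ)
    (hS : Tendsto (fun n => ‖S n‖) atTop atTop) (he : exponent S < ⊤) {M : ℕ}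
    (hM : (M : ℕ∞) ≤ N) {s : ℂ} (hs : α M < s.re) (hs2 : s.re < genus S + 1)
    (hne : ∀ j ≤ M, s ≠ α j) : AnalyticAt ℂ (zetaFormula S α a M) s := by
  unfold zetaFormula
  refine (analyticAt_sin_factor s).mul (((analyticAt_headMellin hc hS he hs2).add
    (Finset.analyticAt_fun_sum _ fun j hj => ?_)).add (analyticAt_tailMellin h hc hS he hM hs))
  have : s - α j ≠ 0 := sub_ne_zero.2 (hne j (Nat.lt_succ_iff.1 (Finset.mem_range.1 hj)))
  have h2 : (s - α j) ^ 2 ≠ 0 := pow_ne_zero _ this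
  fun_prop (disch := assumption)

/-- The Dirichlet series is holomorphic to the right of the exponent of convergence. -/
lemma analyticAt_tsum_cpow (h0 : ∀ n, S n ≠ 0) (hS : Tendsto (fun n => ‖S n‖) atTop atTop)
    {s : ℂ} (hs : exponent S < s.re) :
    AnalyticAt ℂ (fun s : ℂ => ∑' n, S n ^ (-s)) s := by
  obtain ⟨σ, h1, h2⟩ := EReal.lt_iff_exists_real_btwn.1 hs
  have h2' : σ < s.re := by exact_mod_cast h2
  have h3 : exponent S < ((s.re + 1 : ℝ) : EReal) :=
    hs.trans (by exact_mod_cast (lt_add_one s.re))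
  set U : Set ℂ := {w | σ < w.re} ∩ {w | w.re < s.re + 1} ∩ {w | ‖w‖ < ‖s‖ + 1} with hU
  have hUo : IsOpen U := ((isOpen_lt continuous_const Complex.continuous_re).inter
    (isOpen_lt Complex.continuous_re continuous_const)).inter
      (isOpen_lt continuous_norm continuous_const)
  have hd : DifferentiableOn ℂ (fun s : ℂ => ∑' n, S n ^ (-s)) U := by
    refine Complex.differentiableOn_tsum_of_summable_norm
      (((summable_rpow_of_exponent_lt hS h1).add (summable_rpow_of_exponent_lt hS h3)).mul_right
        (Real.exp (Real.pi * (‖s‖ + 1)))) (fun n => ?_) hUo fun n w hw => ?_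
    · exact fun w _ => (DifferentiableAt.const_cpow (by fun_prop)
        (Or.inl (h0 n))).differentiableWithinAt
    · have hn : 0 < ‖S n‖ := norm_pos_iff.2 (h0 n)
      rw [Complex.norm_cpow_of_ne_zero (h0 n), div_eq_mul_inv, ← Real.exp_neg]
      have hw1 : σ < w.re := hw.1.1
      have hw2 : w.re < s.re + 1 := hw.1.2
      have hw3 : ‖w‖ < ‖s‖ + 1 := hw.2
      have p1 : 0 < ‖S n‖ ^ (-σ) := Real.rpow_pos_of_pos hn _
      have p2 : 0 < ‖S n‖ ^ (-(s.re + 1)) := Real.rpow_pos_of_pos hn _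
      have hle : ‖S n‖ ^ (-w).re ≤ ‖S n‖ ^ (-σ) + ‖S n‖ ^ (-(s.re + 1)) := by
        rcases le_total 1 ‖S n‖ with hge | hge
        · have := Real.rpow_le_rpow_of_exponent_le hge (show (-w).re ≤ -σ by simp; linarith)
          linarith
        · have := Real.rpow_le_rpow_of_exponent_ge hn hge
            (show -(s.re + 1) ≤ (-w).re by simp; linarith)
          linarith
      have hexp : -((S n).arg * (-w).im) ≤ Real.pi * (‖s‖ + 1) := by
        refine (neg_le_abs _).trans ?_
        rw [abs_mul]
        have a1 := Complex.abs_arg_le_pi (S n)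
        have a2 : |(-w).im| ≤ ‖s‖ + 1 := by
          refine (Complex.abs_im_le_norm _).trans ?_
          rw [norm_neg]; exact hw3.le
        gcongr
      gcongr
  exact hd.analyticAt (hUo.mem_nhds ⟨⟨h2', by simp⟩, by simp⟩)

/-- The identity theorem for meromorphic functions. -/
lemma eventuallyEq_nhdsNE_of_isPreconnected {f g : ℂ → ℂ} {U V : Set ℂ}
    (hf : MeromorphicOn f U) (hg : MeromorphicOn g U) (hU : IsPreconnected U) (hV : IsOpen V)
    {z₀ : ℂ} (hz₀ : z₀ ∈ V) (hz₀U : z₀ ∈ U) (hfg : ∀ z ∈ V, f z = g z) {z : ℂ} (hz : z ∈ U) :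
    f =ᶠ[𝓝[≠] z] g := by
  have hm : MeromorphicOn (f - g) U := hf.sub hg
  have htop : meromorphicOrderAt (f - g) z₀ = ⊤ := by
    rw [meromorphicOrderAt_eq_top_iff]
    refine eventually_nhdsWithin_of_eventually_nhds ?_
    filter_upwards [hV.mem_nhds hz₀] with w hw
    simp [hfg w hw]
  have htop' : meromorphicOrderAt (f - g) z = ⊤ := by
    by_contra hne
    exact hm.meromorphicOrderAt_ne_top_of_isPreconnected hU hz hz₀U hne htop
  rw [meromorphicOrderAt_eq_top_iff] at htop'
  filter_upwards [htop'] with w hw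
  exact sub_eq_zero.1 hw

/-- The identity theorem for meromorphic functions, at a point where both are in normal form. -/
lemma eventuallyEq_nhds_of_isPreconnected {f g : ℂ → ℂ} {U V : Set ℂ}
    (hf : MeromorphicOn f U) (hg : MeromorphicOn g U) (hU : IsPreconnected U) (hV : IsOpen V)
    {z₀ : ℂ} (hz₀ : z₀ ∈ V) (hz₀U : z₀ ∈ U) (hfg : ∀ z ∈ V, f z = g z) {z : ℂ} (hz : z ∈ U)
    (hf' : MeromorphicNFAt f z) (hg' : MeromorphicNFAt g z) : f =ᶠ[𝓝 z] g :=
  (hf'.eventuallyEq_nhdsNE_iff_eventuallyEq_nhds hg').1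
    (eventuallyEq_nhdsNE_of_isPreconnected hf hg hU hV hz₀ hz₀U hfg hz)

lemma IsZetaContinuation.mono {Ω Ω' : Set ℂ} {Z : ℂ → ℂ} (h : IsZetaContinuation S Ω Z)
    (hΩ : Ω' ⊆ Ω) : IsZetaContinuation S Ω' Z :=
  ⟨fun _ hz => h.meromorphic (hΩ hz), fun s hs => h.eq_series s (hΩ hs)⟩

/-- Two continuations to the half-plane `r < Re s` agree. -/
lemma IsZetaContinuation.eq_of_halfPlane (hS : Tendsto (fun n => ‖S n‖) atTop atTop)
    (he : exponent S < ⊤) {r : ℝ} {Z Z' : ℂ → ℂ} (h : IsZetaContinuation S {s | r < s.re} Z)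
    (h' : IsZetaContinuation S {s | r < s.re} Z') {s : ℂ} (hs : r < s.re) : Z s = Z' s := by
  set m := max r (exponent S).toReal
  refine (eventuallyEq_nhds_of_isPreconnected (V := {s | m < s.re}) (z₀ := ((m + 1 : ℝ) : ℂ))
    (fun z hz => (h.meromorphic hz).meromorphicAt) (fun z hz => (h'.meromorphic hz).meromorphicAt)
    (convex_halfSpace_re_gt r).isPreconnected
    (isOpen_lt continuous_const Complex.continuous_re) ?_ ?_ (fun w hz => ?_) hs
    (h.meromorphic hs) (h'.meromorphic hs)).eq_of_nhds
  · simp only [Set.mem_ofPred_eq, Complex.ofReal_re]; linarith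
  · have : r ≤ m := le_max_left _ _
    simp only [Set.mem_ofPred_eq, Complex.ofReal_re]; linarith
  · have hz : m < w.re := hz
    have h1 : r < w.re := (le_max_left _ _).trans_lt hz
    have h2 : exponent S < w.re := (exponent_lt_iff hS he).2 ((le_max_right _ _).trans_lt hz)
    rw [h.eq_series w h1 h2, h'.eq_series w h1 h2]

/-- Continuation across finitely many terms of the expansion. -/
lemma exists_isZetaContinuation_halfPlane (h : HasConeExpansion S κ N α a) (hc : InCone S κ)
    (hS : Tendsto (fun n => ‖S n‖) atTop atTop) (he : exponent S < ⊤)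
    (hα : ∀ i j : ℕ, i < j → (j : ℕ∞) ≤ N → α j < α i) {M : ℕ} (hM : (M : ℕ∞) ≤ N) :
    ∃ Z, IsZetaContinuation S {s | α M < s.re} Z := by
  classical
  set D : ℂ → ℂ := fun s => ∑' n, S n ^ (-s) with hD
  set F : ℂ → ℂ := fun s => if (exponent S).toReal < s.re then D s else zetaFormula S α a M s
    with hF
  have hFan : ∀ s : ℂ, (exponent S).toReal < s.re → F =ᶠ[𝓝 s] D ∧ AnalyticAt ℂ F s := by
    intro s hs
    have h1 : F =ᶠ[𝓝 s] D := by
      filter_upwards [(isOpen_lt continuous_const Complex.continuous_re).mem_nhds hs] with w hw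
      exact if_pos hw
    exact ⟨h1, (analyticAt_tsum_cpow hc.ne_zero hS ((exponent_lt_iff hS he).2 hs)).congr h1.symm⟩
  have hmer : MeromorphicOn F {s | α M < s.re} := by
    intro s hs
    have hs : α M < s.re := hs
    by_cases hse : (exponent S).toReal < s.re
    · exact (hFan s hse).2.meromorphicAt
    · have hsg : s.re < genus S + 1 := (not_lt.1 hse).trans_lt (toReal_exponent_lt_genus_add_one S)
      refine (meromorphicAt_zetaFormula h hc hS he hM hs hsg).congr
        (eventually_nhdsWithin_of_eventually_nhds ?_)
      filter_upwards [(isOpen_lt continuous_const Complex.continuous_re).mem_nhds hs,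
        (isOpen_lt Complex.continuous_re continuous_const).mem_nhds hsg] with w hw1 hw2
      by_cases hw : (exponent S).toReal < w.re
      · simp only [hF, if_pos hw]
        exact zetaFormula_eq_tsum h hc hS he hα hM hw1 ((exponent_lt_iff hS he).2 hw) hw2
      · simp only [hF, if_neg hw]
  refine ⟨toMeromorphicNFOn F {s | α M < s.re}, meromorphicNFOn_toMeromorphicNFOn _ _,
    fun s hs hse => ?_⟩
  have hse' := (exponent_lt_iff hS he).1 hse
  rw [toMeromorphicNFOn_eq_toMeromorphicNFAt hmer hs,
    toMeromorphicNFAt_eq_self.2 (hFan s hse').2.meromorphicNFAt]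
  exact if_pos hse'

lemma exists_index_of_order_lt (hbot : N = ⊤ → Tendsto α atTop atBot) {x : ℝ}
    (hx : order N α < x) : ∃ M : ℕ, (M : ℕ∞) ≤ N ∧ α M < x := by
  by_cases hN : N = ⊤
  · obtain ⟨M, hM⟩ := ((hbot hN).eventually_lt_atBot x).exists
    exact ⟨M, by simp [hN], hM⟩
  · refine ⟨N.toNat, (ENat.natCast_toNat hN).le, ?_⟩
    rw [order, if_neg hN] at hx
    exact_mod_cast hx

lemma order_le (hα : ∀ i j : ℕ, i < j → (j : ℕ∞) ≤ N → α j < α i) {j : ℕ}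
    (hj : (j : ℕ∞) ≤ N) : order N α ≤ α j := by
  by_cases hN : N = ⊤
  · simp [order, hN]
  · rw [order, if_neg hN]
    have h1 : (N.toNat : ℕ∞) = N := ENat.natCast_toNat hN
    have h2 : j ≤ N.toNat := by rw [← h1] at hj; exact_mod_cast hj
    rcases h2.lt_or_eq with h3 | h3
    · exact_mod_cast (hα j _ h3 h1.le).le
    · rw [← h3]

/-- The continuations to the half-planes `α M < Re s` fit together. -/
lemma exists_isZetaContinuation (h : HasConeExpansion S κ N α a) (hc : InCone S κ)
    (hS : Tendsto (fun n => ‖S n‖) atTop atTop) (he : exponent S < ⊤)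
    (hα : ∀ i j : ℕ, i < j → (j : ℕ∞) ≤ N → α j < α i)
    (hbot : N = ⊤ → Tendsto α atTop atBot) :
    ∃ Z, IsZetaContinuation S {s : ℂ | order N α < (s.re : EReal)} Z := by
  classical
  have hex : ∀ M : ℕ, ∃ Z, (M : ℕ∞) ≤ N → IsZetaContinuation S {s | α M < s.re} Z := by
    intro M
    by_cases hM : (M : ℕ∞) ≤ N
    · obtain ⟨Z, hZ⟩ := exists_isZetaContinuation_halfPlane h hc hS he hα hM
      exact ⟨Z, fun _ => hZ⟩
    · exact ⟨0, fun h => absurd h hM⟩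
  choose Z hZ using hex
  have hidx : ∀ s : ℂ, ∃ M : ℕ, order N α < (s.re : EReal) → (M : ℕ∞) ≤ N ∧ α M < s.re := by
    intro s
    by_cases hs : order N α < (s.re : EReal)
    · obtain ⟨M, hM⟩ := exists_index_of_order_lt hbot hs
      exact ⟨M, fun _ => hM⟩
    · exact ⟨0, fun h => absurd h hs⟩
  choose m hm using hidx
  have hglue : ∀ s : ℂ, order N α < (s.re : EReal) → ∀ M : ℕ, (M : ℕ∞) ≤ N → α M < s.re →
      Z (m s) s = Z M s := by
    intro s hs M hM hMs
    obtain ⟨h1, h2⟩ := hm s hs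
    have hlt : max (α (m s)) (α M) < s.re := max_lt h2 hMs
    refine IsZetaContinuation.eq_of_halfPlane hS he ((hZ _ h1).mono ?_) ((hZ M hM).mono ?_) hlt
    · exact fun w hw => show α (m s) < w.re from (le_max_left _ _).trans_lt hw
    · exact fun w hw => show α M < w.re from (le_max_right _ _).trans_lt hw
  refine ⟨fun s => Z (m s) s, fun s hs => ?_, fun s hs hse => ?_⟩
  · obtain ⟨h1, h2⟩ := hm s hs
    have heq : (fun s => Z (m s) s) =ᶠ[𝓝 s] Z (m s) := by
      filter_upwards [(isOpen_lt continuous_const Complex.continuous_re).mem_nhds h2] with w hw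
      have hw : α (m s) < w.re := hw
      exact hglue w ((order_le hα h1).trans_lt (by exact_mod_cast hw)) _ h1 hw
    exact (meromorphicNFAt_congr heq).2 ((hZ _ h1).meromorphic h2)
  · obtain ⟨h1, h2⟩ := hm s hs
    exact (hZ _ h1).eq_series s h2 hse

end

/-! ### The zeta function at a nonnegative integer exponent -/

/-- `sin (π u) = π u w(u)` with an even entire function `w`, so that `w = 1 + O(u ^ 2)`. -/
lemma exists_sin_pi_mul_factor : ∃ w : ℂ → ℂ, Differentiable ℂ w ∧ w 0 = 1 ∧ deriv w 0 = 0 ∧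
    ∀ u : ℂ, Complex.sin (Real.pi * u) = Real.pi * u * w u := by
  have hpi : (Real.pi : ℂ) ≠ 0 := by exact_mod_cast Real.pi_ne_zero
  set f : ℂ → ℂ := fun u => Complex.sin (Real.pi * u) / Real.pi with hf
  have hfd : Differentiable ℂ f := by fun_prop
  have hf0 : f 0 = 0 := by simp [hf]
  have hd : HasDerivAt f 1 0 := by
    have h1 : HasDerivAt (fun u : ℂ => (Real.pi : ℂ) * u) Real.pi 0 := by
      simpa using (hasDerivAt_id (0 : ℂ)).const_mul (Real.pi : ℂ)
    have h2 := (h1.csin).div_const (Real.pi : ℂ)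
    simpa [hpi] using h2
  have hmul : ∀ u : ℂ, Complex.sin (Real.pi * u) = Real.pi * u * dslope f 0 u := by
    intro u
    have := sub_smul_dslope f 0 u
    rw [hf0, sub_zero, sub_zero, smul_eq_mul] at this
    rw [mul_assoc, this]
    simp only [hf]
    field_simp
  have hwd : Differentiable ℂ (dslope f 0) := by
    rw [← differentiableOn_univ, Complex.differentiableOn_dslope univ_mem]
    exact hfd.differentiableOn
  have heven : ∀ u, dslope f 0 (-u) = dslope f 0 u := by
    intro u
    rcases eq_or_ne u 0 with rfl | hu
    · simp
    · have h1 := hmul u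
      have h2 := hmul (-u)
      rw [mul_neg, Complex.sin_neg, h1] at h2
      have : (Real.pi : ℂ) * u ≠ 0 := mul_ne_zero hpi hu
      apply mul_left_cancel₀ this
      linear_combination h2
  refine ⟨dslope f 0, hwd, by rw [dslope_same, hd.deriv], ?_, hmul⟩
  have h1 : deriv (fun u => dslope f 0 (-u)) 0 = -deriv (dslope f 0) 0 := by
    rw [deriv_comp_neg, neg_zero]
  rw [funext heven] at h1
  linear_combination h1 / 2

lemma tendsto_ofReal_nhdsGT_zero :
    Tendsto (fun z : ℝ => (z : ℂ)) (𝓝[>] 0) (𝓝[≠] 0) := by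
  refine tendsto_nhdsWithin_iff.2 ⟨?_, ?_⟩
  · exact_mod_cast (Complex.continuous_ofReal.tendsto 0).mono_left nhdsWithin_le_nhds
  · filter_upwards [self_mem_nhdsWithin] with z hz
    simpa using ne_of_gt (show (0 : ℝ) < z from hz)

section
variable {S : ℕ → ℂ} {κ : ℝ} {N : ℕ∞} {α : ℕ → ℝ} {a : ℕ → ℕ →₀ ℂ}

/-- The part of the continuation formula that is regular at `α j`. -/
noncomputable def regularPart (S : ℕ → ℂ) (α : ℕ → ℝ) (a : ℕ → ℕ →₀ ℂ) (j : ℕ) (s : ℂ) : ℂ :=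
  headMellin S s + ∑ i ∈ Finset.range j, (a i 0 / (s - α i) + a i 1 / (s - α i) ^ 2)

lemma zetaFormula_eq (j : ℕ) (s : ℂ) : zetaFormula S α a j s =
    -(s * Complex.sin (Real.pi * s) / Real.pi) * (regularPart S α a j s +
      (a j 0 / (s - α j) + a j 1 / (s - α j) ^ 2) + tailMellin S α a j s) := by
  rw [zetaFormula, Finset.sum_range_succ, regularPart]
  ring

lemma analyticAt_regularPart (hc : InCone S κ) (hS : Tendsto (fun n => ‖S n‖) atTop atTop)
    (he : exponent S < ⊤) (hα : ∀ i j : ℕ, i < j → (j : ℕ∞) ≤ N → α j < α i) {j k : ℕ}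
    (hj : (j : ℕ∞) ≤ N) (hjk : α j = k) (hk : k ≤ genus S) :
    AnalyticAt ℂ (regularPart S α a j) k := by
  unfold regularPart
  have hkg : ((k : ℂ)).re < genus S + 1 := by
    have : (k : ℝ) ≤ genus S := by exact_mod_cast hk
    simp only [Complex.natCast_re]; linarith
  refine (analyticAt_headMellin hc hS he hkg).add (Finset.analyticAt_fun_sum _ fun i hi => ?_)
  have hlt := hα i j (Finset.mem_range.1 hi) hj
  have hne : (k : ℂ) - α i ≠ 0 := by
    rw [sub_ne_zero]
    intro h
    have : (k : ℝ) = α i := by exact_mod_cast h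
    linarith
  have h2 : ((k : ℂ) - α i) ^ 2 ≠ 0 := pow_ne_zero _ hne
  fun_prop (disch := assumption)

/-- The behaviour of the continuation formula to the right of an integer `k = α j`: a pole with
coefficient `(-1) ^ (k + 1) k a_{j,1}` and a finite part. -/
lemma zetaFormula_tendsto_right (h : HasConeExpansion S κ N α a) (hc : InCone S κ)
    (hS : Tendsto (fun n => ‖S n‖) atTop atTop) (he : exponent S < ⊤)
    (hα : ∀ i j : ℕ, i < j → (j : ℕ∞) ≤ N → α j < α i) {j k : ℕ}
    (hj : (j : ℕ∞) ≤ N) (hjk : α j = k) (hk : k ≤ genus S) :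
    Tendsto (fun z : ℝ => zetaFormula S α a j (k + z) - (-1) ^ (k + 1) * k * a j 1 / z) (𝓝[>] 0)
      (𝓝 ((-1) ^ (k + 1) * (k * a j 0 + a j 1))) := by
  obtain ⟨w, hwd, hw0, hw1, hw⟩ := exists_sin_pi_mul_factor
  have hz := tendsto_ofReal_nhdsGT_zero
  have hz' : Tendsto (fun z : ℝ => (z : ℂ)) (𝓝[>] 0) (𝓝 0) := hz.mono_right nhdsWithin_le_nhds
  have hwz : Tendsto (fun z : ℝ => w z) (𝓝[>] 0) (𝓝 1) := by
    rw [← hw0]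
    exact hwd.continuous.continuousAt.tendsto.comp hz'
  have hslope : Tendsto (fun z : ℝ => (w z - 1) / z) (𝓝[>] 0) (𝓝 0) := by
    have := (hwd 0).hasDerivAt.tendsto_slope
    rw [hw1] at this
    refine (this.comp hz).congr fun z => ?_
    rw [Function.comp, slope_def_field, hw0, sub_zero]
  have hkz : Tendsto (fun z : ℝ => (k : ℂ) + z) (𝓝[>] 0) (𝓝 k) := by
    simpa using hz'.const_add (k : ℂ)
  have hT : Tendsto (fun z : ℝ => regularPart S α a j (k + z)) (𝓝[>] 0)
      (𝓝 (regularPart S α a j k)) :=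
    (analyticAt_regularPart hc hS he hα hj hjk hk).continuousAt.tendsto.comp hkz
  have hR := tailMellin_tendsto h hc hS he hj
  rw [hjk] at hR
  have hmain := (((hkz.mul hwz).mul (((hz'.mul hT).add_const (a j 0)).add hR)).add
    (((hslope.const_mul (k : ℂ)).add hwz).const_mul (a j 1))).const_mul ((-1 : ℂ) ^ (k + 1))
  refine (hmain.congr' ?_).trans (le_of_eq ?_)
  · filter_upwards [self_mem_nhdsWithin] with z hz0
    have hz0 : (z : ℂ) ≠ 0 := by exact_mod_cast ne_of_gt (show (0 : ℝ) < z from hz0)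
    have hsin : Complex.sin (Real.pi * ((k : ℂ) + z)) = (-1) ^ k * (Real.pi * z * w z) := by
      have : (Real.pi : ℂ) * ((k : ℂ) + z) = Real.pi * z + k * Real.pi := by ring
      rw [this, Complex.sin_antiperiodic.add_nat_mul_eq, hw]
    have hpi : (Real.pi : ℂ) ≠ 0 := by exact_mod_cast Real.pi_ne_zero
    have hsub : (k : ℂ) + z - (k : ℝ) = z := by push_cast; ring
    rw [zetaFormula_eq, hsin, hjk, hsub]
    simp only [Complex.ofReal_natCast]
    field_simp
    ring
  · congr 1; ring

/-- At the exponent `0` the double zero of `s sin (π s)` makes the formula continuously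
differentiable from the right. -/
lemma deriv_zetaFormula_tendsto_right (h : HasConeExpansion S κ N α a) (hc : InCone S κ)
    (hS : Tendsto (fun n => ‖S n‖) atTop atTop) (he : exponent S < ⊤)
    (hα : ∀ i j : ℕ, i < j → (j : ℕ∞) ≤ N → α j < α i) {j : ℕ}
    (hj : (j : ℕ∞) ≤ N) (hj0 : α j = 0) :
    Tendsto (fun z : ℝ => deriv (zetaFormula S α a j) z) (𝓝[>] 0) (𝓝 (-a j 0)) := by
  obtain ⟨w, hwd, hw0, hw1, hw⟩ := exists_sin_pi_mul_factor
  have hz' : Tendsto (fun z : ℝ => (z : ℂ)) (𝓝[>] 0) (𝓝 0) :=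
    tendsto_ofReal_nhdsGT_zero.mono_right nhdsWithin_le_nhds
  have hTan : AnalyticAt ℂ (regularPart S α a j) 0 := by
    exact_mod_cast analyticAt_regularPart (k := 0) hc hS he hα hj (by simp [hj0]) (Nat.zero_le _)
  set T := regularPart S α a j
  set R := tailMellin S α a j
  have hwz : Tendsto (fun z : ℝ => w z) (𝓝[>] 0) (𝓝 1) := by
    rw [← hw0]; exact hwd.continuous.continuousAt.tendsto.comp hz'
  have hwz' : Tendsto (fun z : ℝ => deriv w z) (𝓝[>] 0) (𝓝 0) := by
    rw [← hw1]
    exact (hwd.analyticAt 0).deriv.continuousAt.tendsto.comp hz'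
  have hT : Tendsto (fun z : ℝ => T z) (𝓝[>] 0) (𝓝 (T 0)) := hTan.continuousAt.tendsto.comp hz'
  have hT' : Tendsto (fun z : ℝ => deriv T z) (𝓝[>] 0) (𝓝 (deriv T 0)) :=
    hTan.deriv.continuousAt.tendsto.comp hz'
  have hR := tailMellin_tendsto h hc hS he hj
  have hR' := deriv_tailMellin_tendsto h hc hS he hj
  simp only [hj0, Complex.ofReal_zero, zero_add] at hR hR'
  have hmain := ((hwz'.mul ((((hz'.pow 2).mul hT).add (hz'.mul_const (a j 0))).add_const
    (a j 1) |>.add (hz'.mul hR))).add (hwz.mul ((((hz'.mul hT).const_mul 2).add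
      ((hz'.pow 2).mul hT')).add_const (a j 0) |>.add (hR.const_mul 2) |>.add hR'))).neg
  have hder : ∀ᶠ z : ℝ in 𝓝[>] 0, deriv (zetaFormula S α a j) z =
      -(deriv w z * ((z : ℂ) ^ 2 * T z + z * a j 0 + a j 1 + z * (z * R z)) +
        w z * (2 * (z * T z) + (z : ℂ) ^ 2 * deriv T z + a j 0 + 2 * (z * R z) +
          (z : ℂ) ^ 2 * deriv R z)) := by
    filter_upwards [self_mem_nhdsWithin, hz'.eventually hTan.eventually_analyticAt]
      with z hz0 hTz
    have hz0 : 0 < z := hz0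
    have hRz : HasDerivAt R (deriv R z) z := by
      refine (analyticAt_tailMellin h hc hS he hj ?_).differentiableAt.hasDerivAt
      simpa [hj0] using hz0
    have hTz' := hTz.differentiableAt.hasDerivAt
    have hid := hasDerivAt_id (z : ℂ)
    have hprod := ((hwd z).hasDerivAt.mul ((((hid.fun_pow 2).mul hTz').add
      (hid.mul_const (a j 0))).add_const (a j 1) |>.add ((hid.fun_pow 2).mul hRz))).neg
    have heq : zetaFormula S α a j =ᶠ[𝓝 (z : ℂ)] fun s : ℂ =>
        -(w s * (s ^ 2 * T s + s * a j 0 + a j 1 + s ^ 2 * R s)) := by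
      have hne : (z : ℂ) ≠ 0 := by exact_mod_cast hz0.ne'
      filter_upwards [isOpen_ne.mem_nhds hne] with s hs
      have hpi : (Real.pi : ℂ) ≠ 0 := by exact_mod_cast Real.pi_ne_zero
      have hs : s ≠ 0 := hs
      rw [zetaFormula_eq, hw, hj0]
      simp only [Complex.ofReal_zero, sub_zero]
      field_simp
      ring
    have hprod' : HasDerivAt (fun s : ℂ =>
        -(w s * (s ^ 2 * T s + s * a j 0 + a j 1 + s ^ 2 * R s))) _ z := hprod
    rw [heq.deriv_eq, hprod'.deriv]
    simp only [id, Pi.add_apply, Pi.mul_apply]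
    ring
  refine (hmain.congr' ?_).trans (le_of_eq ?_)
  · filter_upwards [hder] with z hz
    rw [hz]
  · congr 1; ring

/-- A continuation agrees with the formula to the right of an exponent `k ≤ genus`. -/
lemma IsZetaContinuation.eventuallyEq_zetaFormula (h : HasConeExpansion S κ N α a)
    (hc : InCone S κ) (hS : Tendsto (fun n => ‖S n‖) atTop atTop) (he : exponent S < ⊤)
    (hα : ∀ i j : ℕ, i < j → (j : ℕ∞) ≤ N → α j < α i) {j k : ℕ}
    (hj : (j : ℕ∞) ≤ N) (hjk : α j = k) (hk : k ≤ genus S) {Z : ℂ → ℂ}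
    (hZ : IsZetaContinuation S {s | α j < s.re} Z) :
    ∀ᶠ z : ℝ in 𝓝[>] 0, Z =ᶠ[𝓝 ((k : ℂ) + z)] zetaFormula S α a j := by
  have hkg : (k : ℝ) ≤ genus S := by exact_mod_cast hk
  have hpole : ∀ᶠ z : ℝ in 𝓝[>] 0, ∀ i ∈ Finset.range j, (k : ℝ) + z < α i := by
    rw [Finset.eventually_all]
    intro i hi
    have hlt := hα i j (Finset.mem_range.1 hi) hj
    have ht : Tendsto (fun z : ℝ => (k : ℝ) + z) (𝓝[>] 0) (𝓝 ((k : ℝ) + 0)) :=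
      ((continuous_const.add continuous_id).tendsto 0).mono_left nhdsWithin_le_nhds
    exact ht.eventually (gt_mem_nhds (by rw [← hjk, add_zero]; exact hlt))
  have hsmall : ∀ᶠ z : ℝ in 𝓝[>] 0, z < 1 :=
    eventually_nhdsWithin_of_eventually_nhds (gt_mem_nhds one_pos)
  -- a point of the strip where both sides are the Dirichlet series
  obtain ⟨m, hm1, hm2⟩ := exists_between (show max (α j) (exponent S).toReal < genus S + 1 from
    max_lt (by rw [hjk]; linarith) (toReal_exponent_lt_genus_add_one S))
  have hconv : Convex ℝ {s : ℂ | α j < s.re ∧ s.re < genus S + 1} :=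
    (convex_halfSpace_re_gt (α j)).inter (convex_halfSpace_re_lt _)
  filter_upwards [self_mem_nhdsWithin, hpole, hsmall] with z hz0 hz1 hz2
  have hz0 : 0 < z := hz0
  have hs1 : α j < ((k : ℂ) + z).re := by simp [hjk, hz0]
  have hs2 : ((k : ℂ) + z).re < genus S + 1 := by simp; linarith
  refine eventuallyEq_nhds_of_isPreconnected (U := {s : ℂ | α j < s.re ∧ s.re < genus S + 1})
    (V := {s : ℂ | max (α j) (exponent S).toReal < s.re} ∩ {s : ℂ | s.re < genus S + 1})
    (z₀ := (m : ℂ)) (fun s hs => (hZ.meromorphic hs.1).meromorphicAt)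
    (fun s hs => meromorphicAt_zetaFormula h hc hS he hj hs.1 hs.2) hconv.isPreconnected
    ((isOpen_lt continuous_const Complex.continuous_re).inter
      (isOpen_lt Complex.continuous_re continuous_const)) ⟨by simpa using hm1, by simpa using hm2⟩
    ⟨by simpa using (le_max_left _ _).trans_lt hm1, by simpa using hm2⟩ (fun s hs => ?_)
    ⟨hs1, hs2⟩ (hZ.meromorphic hs1) (analyticAt_zetaFormula h hc hS he hj hs1 hs2
      fun i hi hsi => ?_).meromorphicNFAt
  · have h1 : max (α j) (exponent S).toReal < s.re := hs.1
    have h2 : α j < s.re := (le_max_left _ _).trans_lt h1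
    have h3 : exponent S < s.re := (exponent_lt_iff hS he).2 ((le_max_right _ _).trans_lt h1)
    rw [hZ.eq_series s h2 h3, zetaFormula_eq_tsum h hc hS he hα hj h2 h3 hs.2]
  · have hre : (k : ℝ) + z = α i := by exact_mod_cast hsi
    rcases hi.lt_or_eq with hlt | rfl
    · exact (hz1 i (Finset.mem_range.2 hlt)).ne hre
    · rw [hjk] at hre; linarith

end

/-! ### Limits from the right and meromorphic functions -/

lemma rightOf_le_nhdsNE (x : ℝ) : rightOf x ≤ 𝓝[≠] (x : ℂ) := by
  refine tendsto_nhdsWithin_iff.2 ⟨?_, ?_⟩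
  · exact (Complex.continuous_ofReal.tendsto x).mono_left nhdsWithin_le_nhds
  · filter_upwards [self_mem_nhdsWithin] with t ht
    simpa using ne_of_gt (show x < t from ht)

instance rightOf_neBot (x : ℝ) : (rightOf x).NeBot := by
  unfold rightOf; infer_instance

lemma tendsto_rightOf_of_comp_add {f : ℂ → ℂ} {x : ℝ} {l : Filter ℂ}
    (h : Tendsto (fun z : ℝ => f (x + z)) (𝓝[>] 0) l) : Tendsto f (rightOf x) l := by
  rw [rightOf, tendsto_map'_iff]
  have ht : Tendsto (fun t : ℝ => t - x) (𝓝[>] x) (𝓝[>] 0) := by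
    refine tendsto_nhdsWithin_iff.2 ⟨?_, ?_⟩
    · have : Tendsto (fun t : ℝ => t - x) (𝓝 x) (𝓝 (x - x)) := (continuous_sub_right x).tendsto x
      rw [sub_self] at this
      exact this.mono_left nhdsWithin_le_nhds
    · filter_upwards [self_mem_nhdsWithin] with t ht
      exact sub_pos.2 (show x < t from ht)
  refine (h.comp ht).congr fun t => ?_
  simp

/-- A meromorphic function with a limit from the right has that limit as a punctured limit. -/
lemma tendsto_nhdsNE_of_tendsto_rightOf {f : ℂ → ℂ} {x : ℝ} {v : ℂ} (hf : MeromorphicAt f x)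
    (h : Tendsto f (rightOf x) (𝓝 v)) : Tendsto f (𝓝[≠] (x : ℂ)) (𝓝 v) := by
  have hnn : 0 ≤ meromorphicOrderAt f x := by
    by_contra hneg
    have h1 := ((tendsto_cobounded_iff_meromorphicOrderAt_neg hf).2 (not_le.1 hneg)).mono_left
      (rightOf_le_nhdsNE x)
    exact h.not_tendsto (Metric.disjoint_nhds_cobounded v) h1
  obtain ⟨v', hv'⟩ := (tendsto_nhds_iff_meromorphicOrderAt_nonneg hf).2 hnn
  rwa [tendsto_nhds_unique h (hv'.mono_left (rightOf_le_nhdsNE x))]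

/-! ### Higher derivatives of `logGamma` and of the expansion -/

lemma iteratedDeriv_eq_of_hasDerivAt {U : Set ℂ} (hU : IsOpen U) {f : ℕ → ℂ → ℂ}
    (h : ∀ n, ∀ z ∈ U, HasDerivAt (f n) (f (n + 1) z) z) (n : ℕ) :
    ∀ z ∈ U, iteratedDeriv n (f 0) z = f n z := by
  induction n with
  | zero => intro z _; simp
  | succ n ih =>
    intro z hz
    rw [iteratedDeriv_succ]
    have : iteratedDeriv n (f 0) =ᶠ[𝓝 z] f n := by
      filter_upwards [hU.mem_nhds hz] with w hw using ih w hw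
    rw [this.deriv_eq, (h n z hz).deriv]

lemma differentiableOn_iteratedDeriv {U : Set ℂ} (hU : IsOpen U) {f : ℂ → ℂ}
    (hf : DifferentiableOn ℂ f U) (n : ℕ) : DifferentiableOn ℂ (iteratedDeriv n f) U := by
  induction n with
  | zero => simpa using hf
  | succ n ih => rw [iteratedDeriv_succ]; exact ih.deriv hU

lemma tendstoLocallyUniformlyOn_iteratedDeriv {U : Set ℂ} (hU : IsOpen U) {F : ℕ → ℂ → ℂ}
    {f : ℂ → ℂ} (h : TendstoLocallyUniformlyOn F f atTop U)
    (hF : ∀ n, DifferentiableOn ℂ (F n) U) (m : ℕ) :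
    TendstoLocallyUniformlyOn (fun n => iteratedDeriv m (F n)) (iteratedDeriv m f) atTop U := by
  induction m with
  | zero => simpa using h
  | succ m ih =>
    have := ih.deriv (Eventually.of_forall fun n => differentiableOn_iteratedDeriv hU (hF n) m) hU
    rw [iteratedDeriv_succ]
    refine this.congr fun n z _ => ?_
    rw [Function.comp, iteratedDeriv_succ]

/-- The coefficients `(A, B)` in the `n`-th derivative `(A log z + B) z ^ (β - n)` of
`(A₀ log z + B₀) z ^ β`. -/
noncomputable def powLogCoeff (β A B : ℂ) : ℕ → ℂ × ℂ
  | 0 => (A, B)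
  | n + 1 => ((β - n) * (powLogCoeff β A B n).1,
      (β - n) * (powLogCoeff β A B n).2 + (powLogCoeff β A B n).1)

lemma hasDerivAt_powLog (β A B : ℂ) (n : ℕ) {z : ℂ} (hz : z ∈ Complex.slitPlane) :
    HasDerivAt (fun z : ℂ => ((powLogCoeff β A B n).1 * Complex.log z +
        (powLogCoeff β A B n).2) * z ^ (β - n))
      (((powLogCoeff β A B (n + 1)).1 * Complex.log z +
        (powLogCoeff β A B (n + 1)).2) * z ^ (β - (n + 1 : ℕ))) z := by
  have hz0 : z ≠ 0 := Complex.slitPlane_ne_zero hz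
  have h1 := (((Complex.hasDerivAt_log hz).const_mul (powLogCoeff β A B n).1).add_const
    (powLogCoeff β A B n).2).mul ((hasDerivAt_id z).cpow_const (c := β - n) hz)
  refine h1.congr_deriv ?_
  have e1 : β - (n + 1 : ℕ) = β - n - 1 := by push_cast; ring
  have e2 : z ^ (β - n) = z ^ (β - n - 1) * z := by
    rw [Complex.cpow_sub (β - n) 1 hz0, Complex.cpow_one]
    field_simp
  simp only [powLogCoeff, id]
  rw [e1, e2]
  field_simp
  ring

lemma powLogCoeff_fst_eq_zero_of_le {β A B : ℂ} {n m : ℕ} (hnm : n ≤ m)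
    (h : (powLogCoeff β A B n).1 = 0) : (powLogCoeff β A B m).1 = 0 := by
  induction m, hnm using Nat.le_induction with
  | base => exact h
  | succ m _ ih => simp [powLogCoeff, ih]

/-- Once the logarithm has disappeared, the coefficient follows the recursion of the Gamma
function. -/
lemma powLogCoeff_snd_eq_of_le {β A B d : ℂ} {n m : ℕ} (hnm : n ≤ m)
    (hne : ∀ i, n ≤ i → (i : ℂ) - β ≠ 0) (h1 : (powLogCoeff β A B n).1 = 0)
    (h2 : (powLogCoeff β A B n).2 = (-1) ^ n * d * Complex.Gamma (n - β)) :
    (powLogCoeff β A B m).2 = (-1) ^ m * d * Complex.Gamma (m - β) := by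
  induction m, hnm using Nat.le_induction with
  | base => exact h2
  | succ m hm ih =>
    have e : ((m + 1 : ℕ) : ℂ) - β = (m - β) + 1 := by push_cast; ring
    simp only [powLogCoeff]
    rw [powLogCoeff_fst_eq_zero_of_le hm h1, ih, e, Complex.Gamma_add_one _ (hne m hm)]
    ring

lemma powLogCoeff_nat_fst (k : ℕ) (A B : ℂ) (n : ℕ) (hn : n ≤ k) :
    (powLogCoeff k A B n).1 * (k - n).factorial = k.factorial * A := by
  induction n with
  | zero => simp [powLogCoeff, mul_comm]
  | succ n ih =>
    have h1 : k - n = (k - (n + 1)) + 1 := by omega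
    have h2 : ((k - n : ℕ) : ℂ) = (k : ℂ) - n := by push_cast [Nat.cast_sub (by omega : n ≤ k)]; ring
    rw [← ih (by omega), h1, Nat.factorial_succ, ← h1]
    simp only [powLogCoeff]
    push_cast
    rw [← h2]
    ring

/-- For an integer exponent `k` the derivatives of order above `k` contain no logarithm, and the
power that remains comes from the logarithmic term alone. -/
lemma powLogCoeff_nat (k : ℕ) (A B : ℂ) {m : ℕ} (hm : k < m) :
    (powLogCoeff k A B m).1 = 0 ∧ (powLogCoeff k A B m).2 =
      (-1) ^ m * ((-1) ^ (k + 1) * k.factorial * A) * Complex.Gamma (m - k) := by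
  have h0 := powLogCoeff_nat_fst k A B k le_rfl
  simp only [Nat.sub_self, Nat.factorial_zero, Nat.cast_one, mul_one] at h0
  have h1 : (powLogCoeff k A B (k + 1)).1 = 0 := by simp [powLogCoeff]
  refine ⟨powLogCoeff_fst_eq_zero_of_le hm h1, powLogCoeff_snd_eq_of_le hm (fun i hi h => ?_) h1 ?_⟩
  · rw [sub_eq_zero] at h
    have : i = k := by exact_mod_cast h
    omega
  · have e : ((k + 1 : ℕ) : ℂ) - k = 1 := by push_cast; ring
    simp only [powLogCoeff]
    rw [e, Complex.Gamma_one, h0, ← mul_assoc, ← mul_assoc, ← mul_pow]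
    simp

section
variable {S : ℕ → ℂ} {κ : ℝ} {N : ℕ∞} {α : ℕ → ℝ} {a : ℕ → ℕ →₀ ℂ}

lemma one_add_div_mem_slitPlane_of_coneCompl (hc : InCone S κ) (n : ℕ) {q : ℂ}
    (hq : q ∈ coneCompl κ) : 1 + q / S n ∈ Complex.slitPlane := by
  rw [Complex.mem_slitPlane_iff]
  by_contra! h
  set w := 1 + q / S n with hw
  have hwr : w = (w.re : ℂ) := by apply Complex.ext <;> simp [h.2]
  have hq' : q = -(((1 - w.re : ℝ) : ℂ) * S n) := by
    have h1 : q / S n = w - 1 := by rw [hw]; ring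
    rw [div_eq_iff (hc.ne_zero n)] at h1
    rw [h1, hwr]; push_cast; simp only [Complex.ofReal_re]; ring
  have hpos : 0 ≤ 1 - w.re := by linarith [h.1]
  have h2 : -q.re < κ * ‖q‖ := hq
  rw [hq', norm_neg, norm_mul, Complex.norm_real, Real.norm_of_nonneg hpos, Complex.neg_re,
    Complex.re_ofReal_mul, neg_neg] at h2
  have := mul_le_mul_of_nonneg_left (hc.le_re n) hpos
  linarith

open Polynomial in
/-- The polynomial `q ↦ expPoly g (q / l)`. -/
noncomputable def expPolynomial (g : ℕ) (l : ℂ) : ℂ[X] :=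
  ∑ j ∈ Finset.Icc 1 g, C ((-1 : ℂ) ^ j / (j : ℂ) * l⁻¹ ^ j) * X ^ j

lemma eval_expPolynomial (g : ℕ) (l q : ℂ) : (expPolynomial g l).eval q = expPoly g (q / l) := by
  rw [expPolynomial, expPoly, Polynomial.eval_finsetSum]
  refine Finset.sum_congr rfl fun j _ => ?_
  simp only [Polynomial.eval_mul, Polynomial.eval_C, Polynomial.eval_pow, Polynomial.eval_X,
    div_eq_mul_inv, mul_pow]
  ring

lemma natDegree_expPolynomial_le (g : ℕ) (l : ℂ) : (expPolynomial g l).natDegree ≤ g :=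
  Polynomial.natDegree_sum_le_of_forall_le _ _ fun j hj =>
    (Polynomial.natDegree_C_mul_X_pow_le _ j).trans (Finset.mem_Icc.1 hj).2

/-- The `m`-th derivative of `logTerm g l`. -/
noncomputable def logTermDeriv (g : ℕ) (l : ℂ) : ℕ → ℂ → ℂ
  | 0, q => logTerm g l q
  | m + 1, q => (-1) ^ m * m.factorial / (l + q) ^ (m + 1) +
      (Polynomial.derivative^[m + 1] (expPolynomial g l)).eval q

lemma hasDerivAt_logTermDeriv (g m : ℕ) {l q : ℂ} (hl : l ≠ 0)
    (hq : 1 + q / l ∈ Complex.slitPlane) :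
    HasDerivAt (logTermDeriv g l m) (logTermDeriv g l (m + 1) q) q := by
  have hne : l + q ≠ 0 := by
    have := Complex.slitPlane_ne_zero hq
    intro h
    apply this
    field_simp
    rw [h, mul_zero]
  cases m with
  | zero =>
    have h1 := hasDerivAt_logTerm 0 hl hq
    have h2 := (expPolynomial g l).hasDerivAt q
    have e : logTermDeriv g l 0 = fun q => logTerm 0 l q + (expPolynomial g l).eval q := by
      funext q
      simp only [logTermDeriv, logTerm, eval_expPolynomial]
      simp [expPoly]
    rw [e]
    refine (h1.add h2).congr_deriv ?_
    simp [logTermDeriv]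
  | succ m =>
    have h1 : HasDerivAt (fun q : ℂ => (-1 : ℂ) ^ m * m.factorial / (l + q) ^ (m + 1))
        ((-1) ^ (m + 1) * (m + 1).factorial / (l + q) ^ (m + 1 + 1)) q := by
      have hd := (((hasDerivAt_id q).const_add l).fun_pow (m + 1))
      have h3 := (hd.fun_inv (pow_ne_zero _ hne)).const_mul ((-1 : ℂ) ^ m * m.factorial)
      simp only [← div_eq_mul_inv] at h3
      refine h3.congr_deriv ?_
      rw [Nat.factorial_succ]
      push_cast
      simp only [id]
      field_simp
      ring
    have h2 := (Polynomial.derivative^[m + 1] (expPolynomial g l)).hasDerivAt q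
    rw [← Function.iterate_succ_apply' Polynomial.derivative] at h2
    exact h1.add h2

lemma logTermDeriv_of_lt {g m : ℕ} (hgm : g < m) (l q : ℂ) :
    logTermDeriv g l m q = -((-1) ^ m * (m - 1).factorial / (l + q) ^ m) := by
  obtain ⟨m, rfl⟩ : ∃ n, m = n + 1 := ⟨m - 1, by omega⟩
  simp only [logTermDeriv]
  rw [Polynomial.iterate_derivative_eq_zero
    ((natDegree_expPolynomial_le g l).trans_lt hgm)]
  simp [pow_succ, neg_div]

lemma summable_pow_genus_succ (hS : Tendsto (fun n => ‖S n‖) atTop atTop)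
    (he : exponent S < ⊤) {m : ℕ} (hm : genus S < m) : Summable fun n => (‖S n‖ ^ m)⁻¹ := by
  have h1 : (exponent S).toReal < m := by
    refine (toReal_exponent_lt_genus_add_one S).trans_le ?_
    exact_mod_cast hm
  have := summable_rpow_of_exponent_lt hS ((exponent_lt_iff hS he).2 h1)
  refine this.congr fun n => ?_
  rw [Real.rpow_neg (norm_nonneg _), Real.rpow_natCast]

lemma tendstoLocallyUniformlyOn_sum_logTerm (hc : InCone S κ)
    (hS : Tendsto (fun n => ‖S n‖) atTop atTop) (he : exponent S < ⊤) :
    TendstoLocallyUniformlyOn (fun n q => ∑ i ∈ Finset.range n, logTerm (genus S) (S i) q)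
      (fun q => ∑' i, logTerm (genus S) (S i) q) atTop (coneCompl κ) := by
  set g := genus S
  intro u hu q₀ _
  refine ⟨Metric.ball 0 (‖q₀‖ + 1), mem_nhdsWithin_of_mem_nhds
    (Metric.isOpen_ball.mem_nhds (by simp)), ?_⟩
  refine tendstoUniformlyOn_tsum_nat_eventually
    (u := fun n => 2 * (‖q₀‖ + 1) ^ (g + 1) * (‖S n‖ ^ (g + 1))⁻¹)
    ((summable_pow_genus_succ hS he (Nat.lt_succ_self g)).mul_left _) ?_ u hu
  filter_upwards [hS.eventually_ge_atTop (2 * (‖q₀‖ + 1))] with n hn q hq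
  have hq : ‖q‖ < ‖q₀‖ + 1 := by simpa using hq
  have hn0 := hc.norm_pos n
  have hw : ‖q / S n‖ ≤ 1 / 2 := by
    rw [norm_div, div_le_iff₀ hn0]; linarith
  have h4 := Complex.norm_log_sub_logTaylor_le g (z := q / S n) (by linarith)
  rw [logTaylor_eq, sub_neg_eq_add] at h4
  have h5 : (1 - ‖q / S n‖)⁻¹ ≤ 2 := by
    rw [inv_le_comm₀ (by linarith) (by norm_num)]
    linarith
  have hg : (1 : ℝ) ≤ (g : ℝ) + 1 := by
    have : (0 : ℝ) ≤ (g : ℝ) := Nat.cast_nonneg _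
    linarith
  calc ‖logTerm g (S n) q‖ ≤ ‖q / S n‖ ^ (g + 1) * (1 - ‖q / S n‖)⁻¹ / ((g : ℝ) + 1) := h4
    _ ≤ ‖q / S n‖ ^ (g + 1) * (1 - ‖q / S n‖)⁻¹ :=
        div_le_self (mul_nonneg (by positivity) (inv_nonneg.2 (by linarith))) hg
    _ ≤ ‖q / S n‖ ^ (g + 1) * 2 := by gcongr
    _ = 2 * ‖q‖ ^ (g + 1) * (‖S n‖ ^ (g + 1))⁻¹ := by rw [norm_div, div_pow]; ring
    _ ≤ _ := by gcongr

lemma differentiableOn_sum_logTerm (hc : InCone S κ) (n : ℕ) :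
    DifferentiableOn ℂ (fun q => ∑ i ∈ Finset.range n, logTerm (genus S) (S i) q)
      (coneCompl κ) := fun _ hq =>
  (DifferentiableAt.fun_sum fun i _ => (hasDerivAt_logTerm _ (hc.ne_zero i)
    (one_add_div_mem_slitPlane_of_coneCompl hc i hq)).differentiableAt).differentiableWithinAt

lemma differentiableOn_logGamma (hc : InCone S κ) (hS : Tendsto (fun n => ‖S n‖) atTop atTop)
    (he : exponent S < ⊤) : DifferentiableOn ℂ (logGamma S) (coneCompl κ) :=
  ((tendstoLocallyUniformlyOn_sum_logTerm hc hS he).differentiableOn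
    (Eventually.of_forall fun n => differentiableOn_sum_logTerm hc n) (isOpen_coneCompl κ)).neg

lemma norm_add_ge (hc : InCone S κ) (n : ℕ) {p : ℂ} (hp : 0 < p.re) :
    κ * ‖S n‖ ≤ ‖S n + p‖ := by
  refine (hc.le_re n).trans (le_trans ?_ (Complex.re_le_norm _))
  simp; linarith

lemma summable_inv_add_pow (hc : InCone S κ) (hS : Tendsto (fun n => ‖S n‖) atTop atTop)
    (he : exponent S < ⊤) {m : ℕ} (hm : genus S < m) {p : ℂ} (hp : 0 < p.re) :
    Summable fun n => 1 / (S n + p) ^ m := by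
  refine Summable.of_norm_bounded ((summable_pow_genus_succ hS he hm).mul_left ((κ ^ m)⁻¹))
    fun n => ?_
  rw [norm_div, norm_one, norm_pow, ← mul_inv, ← mul_pow, one_div]
  have := mul_pos hc.pos (hc.norm_pos n)
  gcongr
  exact norm_add_ge hc n hp

/-- Differentiating `logGamma` more often than the genus leaves a sum over the simple fractions. -/
lemma iteratedDeriv_logGamma (hc : InCone S κ) (hS : Tendsto (fun n => ‖S n‖) atTop atTop)
    (he : exponent S < ⊤) {m : ℕ} (hm : genus S < m) {p : ℂ} (hp : 0 < p.re) :
    iteratedDeriv m (logGamma S) p =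
      (-1) ^ m * ((m - 1).factorial * ∑' n, 1 / (S n + p) ^ m) := by
  have hpW := mem_coneCompl_of_re_pos hc.pos hp
  have hlim := (tendstoLocallyUniformlyOn_iteratedDeriv (isOpen_coneCompl κ)
    (tendstoLocallyUniformlyOn_sum_logTerm hc hS he) (differentiableOn_sum_logTerm hc) m).tendsto_at
      hpW
  have hfin : ∀ n, iteratedDeriv m (fun q => ∑ i ∈ Finset.range n, logTerm (genus S) (S i) q) p =
      ∑ i ∈ Finset.range n, -((-1) ^ m * (m - 1).factorial / (S i + p) ^ m) := by
    intro n
    have := iteratedDeriv_eq_of_hasDerivAt (isOpen_coneCompl κ)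
      (f := fun j q => ∑ i ∈ Finset.range n, logTermDeriv (genus S) (S i) j q)
      (fun j z hz => HasDerivAt.fun_sum fun i _ => hasDerivAt_logTermDeriv (genus S) j
        (hc.ne_zero i) (one_add_div_mem_slitPlane_of_coneCompl hc i hz)) m p hpW
    simp only [logTermDeriv_of_lt hm] at this
    exact this
  simp only [hfin] at hlim
  have hsum : HasSum (fun n => -((-1) ^ m * (m - 1).factorial / (S n + p) ^ m))
      (-((-1) ^ m * ((m - 1).factorial * ∑' n, 1 / (S n + p) ^ m))) := by
    have := ((summable_inv_add_pow hc hS he hm hp).hasSum.mul_left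
      ((-1 : ℂ) ^ m * (m - 1).factorial)).neg
    rw [← mul_assoc]
    simpa only [mul_one_div] using this
  have heq := tendsto_nhds_unique hlim hsum.tendsto_sum_nat
  have hneg : iteratedDeriv m (logGamma S) p =
      -iteratedDeriv m (fun q => ∑' i, logTerm (genus S) (S i) q) p := by
    have e : logGamma S = fun q => -(∑' i, logTerm (genus S) (S i) q) := rfl
    rw [e, iteratedDeriv_fun_neg]
  rw [hneg, heq, neg_neg]

lemma expansionTerm_eq_powLog (j : ℕ) (q : ℂ) : expansionTerm α a j q =
    ((powLogCoeff (α j) (a j 1) (a j 0) 0).1 * Complex.log q +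
      (powLogCoeff (α j) (a j 1) (a j 0) 0).2) * q ^ ((α j : ℂ) - (0 : ℕ)) := by
  simp only [powLogCoeff, expansionTerm, Nat.cast_zero, sub_zero]
  ring

lemma iteratedDeriv_remainder (hc : InCone S κ) (hS : Tendsto (fun n => ‖S n‖) atTop atTop)
    (he : exponent S < ⊤) (M m : ℕ) {p : ℂ} (hp : p ∈ coneCompl κ) :
    iteratedDeriv m (remainder S α a M) p = iteratedDeriv m (logGamma S) p -
      ∑ j ∈ Finset.range (M + 1), ((powLogCoeff (α j) (a j 1) (a j 0) m).1 * Complex.log p +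
        (powLogCoeff (α j) (a j 1) (a j 0) m).2) * p ^ ((α j : ℂ) - m) := by
  have := iteratedDeriv_eq_of_hasDerivAt (isOpen_coneCompl κ)
    (f := fun n q => iteratedDeriv n (logGamma S) q - ∑ j ∈ Finset.range (M + 1),
      ((powLogCoeff (α j) (a j 1) (a j 0) n).1 * Complex.log q +
        (powLogCoeff (α j) (a j 1) (a j 0) n).2) * q ^ ((α j : ℂ) - n)) (fun n z hz => ?_) m p hp
  · rw [← this]
    congr 1
    funext q
    simp only [remainder, expansionTerm_eq_powLog, iteratedDeriv_zero]
  · refine HasDerivAt.sub ?_ (HasDerivAt.fun_sum fun j _ =>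
      hasDerivAt_powLog _ _ _ n (coneCompl_subset_slitPlane hc.le_one hz))
    rw [iteratedDeriv_succ]
    exact ((differentiableOn_iteratedDeriv (isOpen_coneCompl κ)
      (differentiableOn_logGamma hc hS he) n).differentiableAt
        ((isOpen_coneCompl κ).mem_nhds hz)).hasDerivAt

lemma differentiableOn_remainder (hc : InCone S κ) (hS : Tendsto (fun n => ‖S n‖) atTop atTop)
    (he : exponent S < ⊤) (M : ℕ) :
    DifferentiableOn ℂ (remainder S α a M) (coneCompl κ) := by
  refine (differentiableOn_logGamma hc hS he).sub (DifferentiableOn.fun_sum fun j _ z hz => ?_)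
  have hs := coneCompl_subset_slitPlane hc.le_one hz
  have h1 : DifferentiableAt ℂ (fun z : ℂ => z ^ (α j : ℂ)) z :=
    differentiableAt_id.cpow_const hs
  have h2 := Complex.differentiableAt_log hs
  unfold expansionTerm
  exact ((h1.const_mul _).add ((h1.const_mul _).mul h2)).differentiableWithinAt

/-- Around a point of the right half-plane the complement of the reflected cone contains a disc
of proportional radius. -/
lemma closedBall_subset_coneCompl (hκ : 0 < κ) (hκ1 : κ ≤ 1) {p : ℂ} (hp : 0 < p.re) :
    Metric.closedBall p (κ / 3 * ‖p‖) ⊆ coneCompl κ := by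
  intro q hq
  have hq : ‖q - p‖ ≤ κ / 3 * ‖p‖ := by simpa [dist_eq_norm] using hq
  have hp0 : 0 < ‖p‖ := norm_pos_iff.2 (by rintro rfl; simp at hp)
  have h1 : -(q - p).re ≤ κ / 3 * ‖p‖ :=
    ((neg_le_abs _).trans (Complex.abs_re_le_norm _)).trans hq
  have h2 : ‖p‖ - ‖q - p‖ ≤ ‖q‖ := by
    have := norm_sub_norm_le p (p - q)
    rw [sub_sub_cancel, norm_sub_rev] at this
    exact this
  rw [Complex.sub_re] at h1
  show -q.re < κ * ‖q‖
  have h3 : κ * (‖p‖ - κ / 3 * ‖p‖) ≤ κ * ‖q‖ := by gcongr; linarith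
  have h4 : κ * κ * ‖p‖ ≤ κ * ‖p‖ := by
    have := mul_le_mul_of_nonneg_left hκ1 hκ.le
    rw [mul_one] at this
    gcongr
  have h5 : 0 < κ * ‖p‖ := by positivity
  nlinarith

/-- Cauchy's estimates on those discs: the expansion of `logGamma` may be differentiated. -/
lemma HasConeExpansion.norm_iteratedDeriv_remainder_le (h : HasConeExpansion S κ N α a)
    (hc : InCone S κ) (hS : Tendsto (fun n => ‖S n‖) atTop atTop) (he : exponent S < ⊤) {M : ℕ}
    (hM : (M : ℕ∞) ≤ N) (m : ℕ) {ε : ℝ} (hε : 0 < ε) :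
    ∃ R : ℝ, 0 < R ∧ ∀ p : ℂ, 0 < p.re → R ≤ ‖p‖ →
      ‖iteratedDeriv m (remainder S α a M) p‖ ≤ ε * ‖p‖ ^ (α M - m) := by
  -- the constant of Cauchy's estimate for the radius `κ / 3 * ‖p‖`; on the circle `‖q‖` and `‖p‖`
  -- differ by a factor of at most `2`, which costs `2 ^ |α M|`
  set K : ℝ := m.factorial * 2 ^ |α M| / (κ / 3) ^ m with hK
  have hκ := hc.pos
  have hK0 : 0 < K := by positivity
  have hb := (h M hM).bound (show 0 < ε / K by positivity)
  rw [eventually_inf_principal, ← comap_norm_atTop, eventually_comap] at hb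
  obtain ⟨R, hR⟩ := eventually_atTop.1 hb
  refine ⟨max (2 * R) 1, by positivity, fun p hp hpR => ?_⟩
  have hp0 : 0 < ‖p‖ := lt_of_lt_of_le one_pos ((le_max_right _ _).trans hpR)
  have hsub := closedBall_subset_coneCompl hκ hc.le_one hp
  have hδ : 0 < κ / 3 * ‖p‖ := by positivity
  have hdiff : DiffContOnCl ℂ (remainder S α a M) (Metric.ball p (κ / 3 * ‖p‖)) :=
    ((differentiableOn_remainder hc hS he M).mono
      (Metric.closure_ball_subset_closedBall.trans hsub)).diffContOnCl
  have hsph : ∀ q ∈ Metric.sphere p (κ / 3 * ‖p‖),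
      ‖remainder S α a M q‖ ≤ ε / K * (2 ^ |α M| * ‖p‖ ^ α M) := by
    intro q hq
    have hqW := hsub (Metric.sphere_subset_closedBall hq)
    have hq : ‖q - p‖ = κ / 3 * ‖p‖ := by simpa [dist_eq_norm] using hq
    have hκ1 := hc.le_one
    have hsmall : κ / 3 * ‖p‖ ≤ 1 / 2 * ‖p‖ := by gcongr; linarith
    have hlow : 1 / 2 * ‖p‖ ≤ ‖q‖ := by
      have := norm_sub_norm_le p (p - q)
      rw [sub_sub_cancel, norm_sub_rev] at this
      linarith
    have hup : ‖q‖ ≤ 2 * ‖p‖ := by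
      have := norm_add_le (q - p) p
      rw [sub_add_cancel] at this
      linarith
    have hq0 : 0 < ‖q‖ := by linarith
    have hqR : R ≤ ‖q‖ := by
      have := (le_max_left _ _).trans hpR
      linarith
    have h1 := hR ‖q‖ hqR q rfl hqW
    rw [Real.norm_of_nonneg (by positivity)] at h1
    refine h1.trans ?_
    have h2 : ‖q‖ ^ α M ≤ 2 ^ |α M| * ‖p‖ ^ α M := by
      have e : ‖q‖ = (‖q‖ / ‖p‖) * ‖p‖ := by field_simp
      rw [e, Real.mul_rpow (by positivity) hp0.le]
      gcongr
      have hr1 : ‖q‖ / ‖p‖ ≤ 2 := by rwa [div_le_iff₀ hp0]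
      have hr2 : 2⁻¹ ≤ ‖q‖ / ‖p‖ := by rw [le_div_iff₀ hp0]; linarith
      rcases le_total 0 (α M) with h0 | h0
      · rw [abs_of_nonneg h0]
        gcongr
      · rw [abs_of_nonpos h0, Real.rpow_neg (by norm_num : (0 : ℝ) ≤ 2),
          ← Real.inv_rpow (by norm_num : (0 : ℝ) ≤ 2)]
        exact Real.rpow_le_rpow_of_nonpos (by norm_num) hr2 h0
    gcongr
  have := Complex.norm_iteratedDeriv_le_of_forall_mem_sphere_norm_le m hδ hdiff hsph
  refine this.trans (le_of_eq ?_)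
  rw [Real.rpow_sub hp0, Real.rpow_natCast, mul_pow, hK]
  have : (2 : ℝ) ^ |α M| ≠ 0 := by positivity
  field_simp

end

/-! ### Inversion of the Laplace transform -/

open MeasureTheory Set FourierTransform in
/-- A bound `B / |p| ^ 2` for the Laplace transform on the line `Re p = σ` bounds the function:
by Fourier inversion on this line, since `∫ |p| ^ (-2) = π / σ`. -/
lemma norm_le_of_norm_laplace_le {f : ℝ → ℂ} (hf : ContinuousOn f (Ioi 0)) {σ B : ℝ} (hσ : 0 < σ)
    (hint : IntegrableOn (fun t : ℝ => f t * Complex.exp (-((σ : ℂ) * t))) (Ioi 0))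
    (hB : ∀ p : ℂ, p.re = σ →
      ‖∫ t : ℝ in Ioi 0, f t * Complex.exp (-(p * t))‖ ≤ B * (‖p‖ ^ 2)⁻¹) {t : ℝ} (ht : 0 < t) :
    ‖f t‖ ≤ B / (2 * σ) * Real.exp (σ * t) := by
  set φ : ℝ → ℂ := indicator (Ioi 0) fun t : ℝ => f t * Complex.exp (-((σ : ℂ) * t)) with hφ
  have hφint : Integrable φ := (integrable_indicator_iff measurableSet_Ioi).2 hint
  have hfour : ∀ ξ : ℝ, 𝓕 φ ξ =
      ∫ t : ℝ in Ioi 0, f t * Complex.exp (-(((σ : ℂ) + 2 * Real.pi * ξ * Complex.I) * t)) := by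
    intro ξ
    rw [Real.fourier_real_eq_integral_exp_smul]
    have : ∀ v : ℝ, Complex.exp (↑(-2 * Real.pi * v * ξ) * Complex.I) • φ v =
        indicator (Ioi 0) (fun t : ℝ => f t *
          Complex.exp (-(((σ : ℂ) + 2 * Real.pi * ξ * Complex.I) * t))) v := by
      intro v
      by_cases hv : v ∈ Ioi (0 : ℝ)
      · rw [hφ, indicator_of_mem hv, indicator_of_mem hv, smul_eq_mul, mul_left_comm,
          ← Complex.exp_add]
        congr 2
        push_cast
        ring
      · rw [hφ, indicator_of_notMem hv, indicator_of_notMem hv, smul_zero]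
    simp_rw [this]
    rw [integral_indicator measurableSet_Ioi]
  have hnormsq : ∀ ξ : ℝ, ‖(σ : ℂ) + 2 * Real.pi * ξ * Complex.I‖ ^ 2 =
      σ ^ 2 * (1 + (2 * Real.pi / σ * ξ) ^ 2) := by
    intro ξ
    have e : (σ : ℂ) + 2 * Real.pi * ξ * Complex.I =
        (σ : ℂ) + ((2 * Real.pi * ξ : ℝ) : ℂ) * Complex.I := by push_cast; ring
    rw [e, Complex.sq_norm, Complex.normSq_add_mul_I]
    field_simp
  have hbound : ∀ ξ : ℝ, ‖𝓕 φ ξ‖ ≤ B / σ ^ 2 * (1 + (2 * Real.pi / σ * ξ) ^ 2)⁻¹ := by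
    intro ξ
    rw [hfour]
    refine (hB _ (by simp)).trans (le_of_eq ?_)
    rw [hnormsq, mul_inv]
    ring
  have hc0 : 2 * Real.pi / σ ≠ 0 := by positivity
  have hdom : Integrable fun ξ : ℝ => B / σ ^ 2 * (1 + (2 * Real.pi / σ * ξ) ^ 2)⁻¹ :=
    (integrable_inv_one_add_sq.comp_mul_left' hc0).const_mul _
  have hcont : Continuous (𝓕 φ) :=
    VectorFourier.fourierIntegral_continuous Real.continuous_fourierChar continuous_inner hφint
  have hFint : Integrable (𝓕 φ) :=
    hdom.mono' hcont.aestronglyMeasurable (ae_of_all _ hbound)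
  have hcat : ContinuousAt φ t := by
    have h1 : ContinuousAt (fun t : ℝ => f t * Complex.exp (-((σ : ℂ) * t))) t :=
      (hf.continuousAt (Ioi_mem_nhds ht)).mul (by fun_prop)
    refine h1.congr ?_
    filter_upwards [Ioi_mem_nhds ht] with x hx
    rw [hφ, indicator_of_mem hx]
  have hinv := hφint.fourierInv_fourier_eq hFint hcat
  have hle : ‖φ t‖ ≤ ∫ ξ : ℝ, ‖𝓕 φ ξ‖ := by
    rw [← hinv, Real.fourierInv_eq']
    refine (norm_integral_le_integral_norm _).trans (le_of_eq ?_)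
    refine integral_congr_ae (ae_of_all _ fun ξ => ?_)
    simp only [norm_smul, Complex.norm_exp_ofReal_mul_I, one_mul]
  have hval : ∫ ξ : ℝ, B / σ ^ 2 * (1 + (2 * Real.pi / σ * ξ) ^ 2)⁻¹ = B / (2 * σ) := by
    rw [integral_const_mul,
      Measure.integral_comp_mul_left (fun x : ℝ => (1 + x ^ 2)⁻¹) (2 * Real.pi / σ),
      integral_univ_inv_one_add_sq, abs_of_pos (by positivity)]
    simp only [smul_eq_mul]
    field_simp
  have hle2 : ‖φ t‖ ≤ B / (2 * σ) := by
    rw [← hval]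
    exact hle.trans (integral_mono hFint.norm hdom hbound)
  have hφt : ‖φ t‖ = ‖f t‖ * Real.exp (-(σ * t)) := by
    rw [hφ, indicator_of_mem (show t ∈ Ioi (0 : ℝ) from ht), norm_mul, Complex.norm_exp]
    simp
  rw [hφt, Real.exp_neg] at hle2
  have hexp := Real.exp_pos (σ * t)
  rwa [← div_eq_mul_inv, div_le_iff₀ hexp] at hle2

/-! ### The heat expansion -/

/-- The heat sum `∑ exp (-t lam_n)`. -/
noncomputable def heatSum (S : ℕ → ℂ) (t : ℝ) : ℂ := ∑' n, Complex.exp (-(t : ℂ) * S n)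

open Classical in
/-- The heat coefficient belonging to the term of index `j` of the expansion of `log Γ`. The test
`α j = ⌊α j⌋₊` says that `α j` is a nonnegative integer, where `Gamma (-α j)` has a pole; only the
logarithmic term contributes in that case. -/
noncomputable def heatCoeff (α : ℕ → ℝ) (a : ℕ → ℕ →₀ ℂ) (j : ℕ) : ℂ :=
  if α j = (⌊α j⌋₊ : ℝ) then (-1) ^ (⌊α j⌋₊ + 1) * (⌊α j⌋₊).factorial * a j 1
  else a j 0 / Complex.Gamma (-(α j : ℂ))

lemma heatCoeff_of_eq_nat {α : ℕ → ℝ} {a : ℕ → ℕ →₀ ℂ} {j k : ℕ} (h : α j = k) :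
    heatCoeff α a j = (-1) ^ (k + 1) * k.factorial * a j 1 := by
  have : ⌊α j⌋₊ = k := by rw [h, Nat.floor_natCast]
  rw [heatCoeff, this, if_pos h]

lemma heatCoeff_of_ne_nat {α : ℕ → ℝ} {a : ℕ → ℕ →₀ ℂ} {j : ℕ} (h : ∀ k : ℕ, α j ≠ k) :
    heatCoeff α a j = a j 0 / Complex.Gamma (-(α j : ℂ)) := if_neg (h _)

lemma Gamma_neg_ofReal_ne_zero {x : ℝ} (h : ∀ k : ℕ, x ≠ k) : Complex.Gamma (-(x : ℂ)) ≠ 0 := by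
  refine Complex.Gamma_ne_zero fun m hm => h m ?_
  rw [neg_inj] at hm
  exact_mod_cast hm

/-- The `m`-th derivative of a term of the expansion of `log Γ` is, up to sign, the Laplace
transform of `t ^ (m - 1)` times the corresponding term `heatCoeff α a j * t ^ (-α j)`. -/
lemma powLogCoeff_eq_heatCoeff {α : ℕ → ℝ} {a : ℕ → ℕ →₀ ℂ} {j m : ℕ}
    (hlog : a j 1 ≠ 0 → ∃ k : ℕ, α j = k) (hm : α j < m) :
    (powLogCoeff (α j) (a j 1) (a j 0) m).1 = 0 ∧ (powLogCoeff (α j) (a j 1) (a j 0) m).2 =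
      (-1) ^ m * heatCoeff α a j * Complex.Gamma (m - α j) := by
  by_cases h : ∃ k : ℕ, α j = k
  · obtain ⟨k, hk⟩ := h
    have hkm : k < m := by rw [hk] at hm; exact_mod_cast hm
    rw [heatCoeff_of_eq_nat hk, hk]
    exact_mod_cast powLogCoeff_nat k (a j 1) (a j 0) hkm
  · have h1 : a j 1 = 0 := by
      by_contra h1; exact h (hlog h1)
    push Not at h
    have hG := Gamma_neg_ofReal_ne_zero h
    have h0 : (powLogCoeff (α j) (a j 1) (a j 0) 0).1 = 0 := h1
    refine ⟨powLogCoeff_fst_eq_zero_of_le (Nat.zero_le m) h0,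
      powLogCoeff_snd_eq_of_le (Nat.zero_le m) (fun i _ hi => h i ?_) h0 ?_⟩
    · have hi' : ((i : ℝ) : ℂ) - (α j : ℂ) = 0 := by exact_mod_cast hi
      rw [sub_eq_zero] at hi'
      exact_mod_cast hi'.symm
    · rw [heatCoeff_of_ne_nat h]
      simp only [powLogCoeff, pow_zero, one_mul, Nat.cast_zero, zero_sub]
      field_simp

section
variable {S : ℕ → ℂ} {κ : ℝ} {N : ℕ∞} {α : ℕ → ℝ} {a : ℕ → ℕ →₀ ℂ}

lemma norm_exp_neg_mul_le (hc : InCone S κ) (n m : ℕ) {t : ℝ} (ht : 0 < t) :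
    ‖Complex.exp (-(t : ℂ) * S n)‖ ≤ m.factorial / (κ * t) ^ m * (‖S n‖ ^ m)⁻¹ := by
  have hn := hc.norm_pos n
  have hκ := hc.pos
  rw [Complex.norm_exp]
  have h1 : (-(t : ℂ) * S n).re ≤ -(κ * t * ‖S n‖) := by
    have := mul_le_mul_of_nonneg_left (hc.le_re n) ht.le
    simp
    linarith
  have hx : 0 < κ * t * ‖S n‖ := by positivity
  have h2 := Real.pow_div_factorial_le_exp (κ * t * ‖S n‖) hx.le m
  calc Real.exp (-(t : ℂ) * S n).re ≤ Real.exp (-(κ * t * ‖S n‖)) := Real.exp_le_exp.2 h1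
    _ = (Real.exp (κ * t * ‖S n‖))⁻¹ := Real.exp_neg _
    _ ≤ ((κ * t * ‖S n‖) ^ m / m.factorial)⁻¹ := by gcongr
    _ = _ := by rw [inv_div, mul_pow (κ * t)]; field_simp

lemma exists_norm_heatSum_le (hc : InCone S κ) (hS : Tendsto (fun n => ‖S n‖) atTop atTop)
    (he : exponent S < ⊤) :
    ∃ C : ℝ, ∀ t : ℝ, 0 < t → ‖heatSum S t‖ ≤ C * t ^ (-((genus S : ℝ) + 1)) := by
  have hsum := summable_pow_genus_succ hS he (Nat.lt_succ_self (genus S))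
  refine ⟨(genus S + 1).factorial / κ ^ (genus S + 1) * ∑' n, (‖S n‖ ^ (genus S + 1))⁻¹,
    fun t ht => ?_⟩
  refine (tsum_of_norm_bounded (hsum.hasSum.mul_left _)
    fun n => norm_exp_neg_mul_le hc n (genus S + 1) ht).trans (le_of_eq ?_)
  have : t ^ (-((genus S : ℝ) + 1)) = (t ^ (genus S + 1))⁻¹ := by
    rw [Real.rpow_neg ht.le, ← Real.rpow_natCast]
    push_cast
    rfl
  rw [this, mul_pow]
  field_simp

lemma continuousOn_heatSum (hc : InCone S κ) (hS : Tendsto (fun n => ‖S n‖) atTop atTop)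
    (he : exponent S < ⊤) : ContinuousOn (heatSum S) (Set.Ioi 0) := by
  refine continuousOn_of_forall_continuousAt fun t ht => ?_
  have ht : 0 < t := ht
  have hκ := hc.pos
  have : ContinuousOn (heatSum S) (Set.Ioi (t / 2)) := by
    refine continuousOn_tsum (fun n => by fun_prop)
      ((summable_pow_genus_succ hS he (Nat.lt_succ_self (genus S))).mul_left
        ((genus S + 1).factorial / (κ * (t / 2)) ^ (genus S + 1))) fun n x hx => ?_
    have hx : t / 2 < x := hx
    refine (norm_exp_neg_mul_le hc n (genus S + 1) (by linarith)).trans ?_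
    gcongr
  exact this.continuousAt (Ioi_mem_nhds (by linarith))

open MeasureTheory Set in
lemma integrableOn_heatSum (hc : InCone S κ) (hS : Tendsto (fun n => ‖S n‖) atTop atTop)
    (he : exponent S < ⊤) {m : ℕ} (hm : genus S + 1 < m) {p : ℂ} (hp : 0 < p.re) :
    IntegrableOn (fun t : ℝ => (t : ℂ) ^ ((m : ℂ) - 1) * heatSum S t * Complex.exp (-(p * t)))
      (Ioi 0) := by
  obtain ⟨C, hC⟩ := exists_norm_heatSum_le hc hS he
  have hm' : (genus S : ℝ) + 1 < m := by exact_mod_cast hm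
  have hmeas : AEStronglyMeasurable
      (fun t : ℝ => (t : ℂ) ^ ((m : ℂ) - 1) * heatSum S t * Complex.exp (-(p * t)))
      (volume.restrict (Ioi 0)) := by
    refine ((aestronglyMeasurable_cpow_mul_cexp m p).mul
      ((continuousOn_heatSum hc hS he).aestronglyMeasurable measurableSet_Ioi)).congr
        (ae_of_all _ fun t => ?_)
    simp only [Pi.mul_apply]
    ring
  refine Integrable.mono' ((integrableOn_rpow_mul_exp_neg_mul
    (a := (m : ℝ) - ((genus S : ℝ) + 1)) (by linarith) hp).const_mul C) hmeas ?_
  filter_upwards [ae_restrict_mem measurableSet_Ioi] with t ht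
  have ht : 0 < t := ht
  rw [mul_right_comm, norm_mul, norm_cpow_mul_cexp ht, Complex.natCast_re]
  have e : t ^ ((m : ℝ) - ((genus S : ℝ) + 1) - 1) =
      t ^ ((m : ℝ) - 1) * t ^ (-((genus S : ℝ) + 1)) := by
    rw [← Real.rpow_add ht]
    ring_nf
  rw [e]
  calc _ ≤ t ^ ((m : ℝ) - 1) * Real.exp (-(p.re * t)) * (C * t ^ (-((genus S : ℝ) + 1))) := by
        gcongr; exact hC t ht
    _ = _ := by ring

open MeasureTheory Set in
/-- The same sum over simple fractions as in `iteratedDeriv_logGamma`, obtained by integrating the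
heat sum term by term. -/
lemma laplace_heatSum (hc : InCone S κ) (hS : Tendsto (fun n => ‖S n‖) atTop atTop)
    (he : exponent S < ⊤) {m : ℕ} (hm : genus S < m) {p : ℂ} (hp : 0 < p.re) :
    ∫ t : ℝ in Ioi 0, (t : ℂ) ^ ((m : ℂ) - 1) * heatSum S t * Complex.exp (-(p * t)) =
      (m - 1).factorial * ∑' n, 1 / (S n + p) ^ m := by
  have hm0 : 0 < m := by omega
  have hmr : (0 : ℝ) < m := by exact_mod_cast hm0
  have hre : ∀ n, 0 < (S n + p).re := fun n => by
    have := hc.re_pos n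
    simp; linarith
  set F : ℕ → ℝ → ℂ := fun n t => (t : ℂ) ^ ((m : ℂ) - 1) * Complex.exp (-((S n + p) * t))
  have hFint : ∀ n, IntegrableOn (F n) (Ioi 0) := fun n =>
    integrableOn_cpow_mul_cexp (by simpa using hmr) (hre n)
  have hFnorm : ∀ n, ∫ t in Ioi 0, ‖F n t‖ = (1 / (S n + p).re) ^ (m : ℝ) * Real.Gamma m := by
    intro n
    rw [← Real.integral_rpow_mul_exp_neg_mul_Ioi hmr (hre n)]
    refine setIntegral_congr_fun measurableSet_Ioi fun t ht => ?_
    simp only [F]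
    rw [norm_cpow_mul_cexp ht, Complex.natCast_re]
  have hFsum : Summable fun n => ∫ t in Ioi 0, ‖F n t‖ := by
    simp_rw [hFnorm]
    refine Summable.mul_right _ (Summable.of_nonneg_of_le
      (fun n => by have := hre n; positivity) (fun n => ?_)
        ((summable_pow_genus_succ hS he hm).mul_left ((κ ^ m)⁻¹)))
    have h1 : 0 < κ * ‖S n‖ := mul_pos hc.pos (hc.norm_pos n)
    have h2 : κ * ‖S n‖ ≤ (S n + p).re := by
      have := hc.le_re n
      simp; linarith
    rw [Real.rpow_natCast, one_div, ← mul_inv, ← mul_pow, inv_pow]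
    gcongr
  have key := hasSum_integral_of_summable_integral_norm hFint hFsum
  have hval : ∀ n, ∫ t in Ioi 0, F n t = (m - 1).factorial * (1 / (S n + p) ^ m) := by
    intro n
    rw [integral_cpow_mul_cexp (by simpa using hmr) (hre n), Complex.cpow_neg,
      Complex.cpow_natCast, one_div]
    congr 1
    have : (m : ℂ) = ((m - 1 : ℕ) : ℂ) + 1 := by
      rw [Nat.cast_sub (by omega)]; push_cast; ring
    rw [this, Complex.Gamma_nat_eq_factorial]
  have e : ∫ t : ℝ in Ioi 0, (t : ℂ) ^ ((m : ℂ) - 1) * heatSum S t * Complex.exp (-(p * t)) =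
      ∫ t in Ioi 0, ∑' n, F n t := by
    refine setIntegral_congr_fun measurableSet_Ioi fun t ht => ?_
    simp only [heatSum, F]
    rw [← tsum_mul_left, ← tsum_mul_right]
    refine tsum_congr fun n => ?_
    rw [mul_assoc, ← Complex.exp_add]
    congr 2
    ring
  rw [e, ← key.tsum_eq, ← tsum_mul_left]
  exact tsum_congr hval

/-- The remainder of the heat expansion after the term of index `M`. -/
noncomputable def heatRemainder (S : ℕ → ℂ) (α : ℕ → ℝ) (a : ℕ → ℕ →₀ ℂ) (M : ℕ) (t : ℝ) : ℂ :=
  heatSum S t - ∑ j ∈ Finset.range (M + 1), heatCoeff α a j * ((t ^ (-α j) : ℝ) : ℂ)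

lemma continuousOn_heatRemainder (hc : InCone S κ) (hS : Tendsto (fun n => ‖S n‖) atTop atTop)
    (he : exponent S < ⊤) (M : ℕ) : ContinuousOn (heatRemainder S α a M) (Set.Ioi 0) := by
  refine (continuousOn_heatSum hc hS he).sub (continuousOn_finsetSum _ fun j _ => ?_)
  refine continuousOn_const.mul (Complex.continuous_ofReal.comp_continuousOn fun t ht => ?_)
  exact (Real.continuousAt_rpow_const t _ (Or.inl (ne_of_gt ht))).continuousWithinAt

open MeasureTheory Set in
/-- The Laplace transform of `t ^ (m - 1)` times the remainder of the heat expansion is, up to sign,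
the `m`-th derivative of the remainder of the expansion of `logGamma`. -/
lemma laplace_heatRemainder (hc : InCone S κ) (hS : Tendsto (fun n => ‖S n‖) atTop atTop)
    (he : exponent S < ⊤) {M m : ℕ}
    (hlog : ∀ j ≤ M, a j 1 ≠ 0 → ∃ k : ℕ, α j = k) (hm : genus S + 1 < m)
    (hα : ∀ j ≤ M, α j < m) {p : ℂ} (hp : 0 < p.re) :
    IntegrableOn (fun t : ℝ => (t : ℂ) ^ ((m : ℂ) - 1) * heatRemainder S α a M t *
      Complex.exp (-(p * t))) (Ioi 0) ∧
    ∫ t : ℝ in Ioi 0, (t : ℂ) ^ ((m : ℂ) - 1) * heatRemainder S α a M t *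
      Complex.exp (-(p * t)) = (-1) ^ m * iteratedDeriv m (remainder S α a M) p := by
  set G : ℕ → ℝ → ℂ := fun j t =>
    heatCoeff α a j * ((t : ℂ) ^ (((m : ℂ) - α j) - 1) * Complex.exp (-(p * t)))
  have hle : ∀ j ∈ Finset.range (M + 1), j ≤ M := fun j hj =>
    Nat.lt_succ_iff.1 (Finset.mem_range.1 hj)
  have hre : ∀ j ∈ Finset.range (M + 1), 0 < ((m : ℂ) - α j).re := fun j hj => by
    simpa using hα j (hle j hj)
  have hG : ∀ j ∈ Finset.range (M + 1), IntegrableOn (G j) (Ioi 0) := fun j hj =>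
    (integrableOn_cpow_mul_cexp (hre j hj) hp).const_mul _
  have hGv : ∀ j ∈ Finset.range (M + 1), ∫ t in Ioi 0, G j t =
      heatCoeff α a j * (Complex.Gamma (m - α j) * p ^ ((α j : ℂ) - m)) := fun j hj => by
    simp only [G]
    rw [integral_const_mul, integral_cpow_mul_cexp (hre j hj) hp, neg_sub]
  have hfun : ∀ t ∈ Ioi (0 : ℝ), (t : ℂ) ^ ((m : ℂ) - 1) * heatRemainder S α a M t *
      Complex.exp (-(p * t)) = (t : ℂ) ^ ((m : ℂ) - 1) * heatSum S t * Complex.exp (-(p * t)) -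
        ∑ j ∈ Finset.range (M + 1), G j t := by
    intro t ht
    have ht : 0 < t := ht
    have ht0 : (t : ℂ) ≠ 0 := by exact_mod_cast ht.ne'
    rw [heatRemainder, mul_sub, sub_mul, Finset.mul_sum, Finset.sum_mul]
    congr 1
    refine Finset.sum_congr rfl fun j _ => ?_
    have e : (m : ℂ) - α j - 1 = (m - 1) + ((-α j : ℝ) : ℂ) := by push_cast; ring
    simp only [G]
    rw [e, Complex.cpow_add _ _ ht0, ← Complex.ofReal_cpow ht.le]
    ring
  have h1 := integrableOn_heatSum hc hS he hm hp
  have h2 : IntegrableOn (fun t => ∑ j ∈ Finset.range (M + 1), G j t) (Ioi 0) :=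
    integrable_finsetSum _ hG
  constructor
  · exact (h1.sub h2).congr_fun (fun t ht => (hfun t ht).symm) measurableSet_Ioi
  · rw [setIntegral_congr_fun measurableSet_Ioi hfun, integral_sub h1 h2,
      integral_finsetSum _ hG, Finset.sum_congr rfl hGv,
      laplace_heatSum hc hS he (by omega) hp,
      iteratedDeriv_remainder hc hS he M m (mem_coneCompl_of_re_pos hc.pos hp),
      iteratedDeriv_logGamma hc hS he (by omega) hp, mul_sub, ← mul_assoc ((-1 : ℂ) ^ m),
      ← mul_pow, neg_one_mul, neg_neg, one_pow, one_mul, Finset.mul_sum]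
    congr 1
    refine Finset.sum_congr rfl fun j hj => ?_
    obtain ⟨e1, e2⟩ := powLogCoeff_eq_heatCoeff (hlog j (hle j hj)) (hα j (hle j hj))
    rw [e1, e2, zero_mul, zero_add]
    have : ((-1 : ℂ) ^ m) * (-1) ^ m = 1 := by rw [← mul_pow]; simp
    linear_combination (-(heatCoeff α a j * Complex.Gamma (m - α j) * p ^ ((α j : ℂ) - m))) * this

/-- The bound for the `m`-th derivative of the remainder is a bound for a Laplace transform;
inverting it on the line `Re p = 1 / t` bounds the remainder of the heat expansion. -/
lemma HasConeExpansion.hasHeatExpansion (h : HasConeExpansion S κ N α a) (hc : InCone S κ)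
    (hS : Tendsto (fun n => ‖S n‖) atTop atTop) (he : exponent S < ⊤)
    (hlog : ∀ j : ℕ, (j : ℕ∞) ≤ N → a j 1 ≠ 0 → ∃ k : ℕ, α j = k) :
    HasHeatExpansion S N α (heatCoeff α a) := by
  intro M hM
  have e : (fun t : ℝ => heat S t - 1 - ∑ j ∈ Finset.range (M + 1),
      heatCoeff α a j * ((t ^ (-α j) : ℝ) : ℂ)) = heatRemainder S α a M := by
    funext t
    rw [heatRemainder, heat, heatSum, add_sub_cancel_left]
  rw [e]
  -- so many derivatives that the inverse Laplace integrals converge absolutely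
  obtain ⟨m, hm⟩ := exists_nat_gt (max ((genus S : ℝ) + 1)
    (∑ j ∈ Finset.range (M + 1), |α j| + 2))
  have hmg : genus S + 1 < m := by exact_mod_cast (le_max_left _ _).trans_lt hm
  have hmα : ∀ j ≤ M, α j + 2 < m := fun j hj => by
    have h1 := Finset.single_le_sum (f := fun j => |α j|) (fun i _ => abs_nonneg _)
      (Finset.mem_range.2 (Nat.lt_succ_of_le hj))
    have h2 := (le_max_right _ _).trans_lt hm
    have h3 := le_abs_self (α j)
    linarith
  rw [isLittleO_iff]
  intro ε hε
  -- the inversion on `Re p = 1 / t` loses the factor `exp 1 / 2`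
  have hE : 0 < Real.exp 1 := Real.exp_pos 1
  obtain ⟨R, hR0, hR⟩ := h.norm_iteratedDeriv_remainder_le hc hS he hM m
    (show 0 < 2 * ε / Real.exp 1 by positivity)
  have hsmall : ∀ᶠ t : ℝ in 𝓝[>] 0, t < 1 / R :=
    eventually_nhdsWithin_of_eventually_nhds (gt_mem_nhds (by positivity))
  filter_upwards [self_mem_nhdsWithin, hsmall] with t ht htR
  have ht : 0 < t := ht
  have hσ : 0 < t⁻¹ := by positivity
  have hRσ : R ≤ t⁻¹ := by
    rw [lt_div_iff₀ hR0] at htR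
    rw [← one_div, le_div_iff₀ ht, mul_comm]
    exact htR.le
  have hlap := fun p hp => laplace_heatRemainder (a := a) (α := α) (M := M) (m := m) (p := p)
    hc hS he (fun j hj => hlog j (le_trans (by exact_mod_cast hj) hM)) hmg
      (fun j hj => by have := hmα j hj; linarith) hp
  have hcont : ContinuousOn (fun t : ℝ => (t : ℂ) ^ ((m : ℂ) - 1) * heatRemainder S α a M t)
      (Set.Ioi 0) := by
    refine ContinuousOn.mul (fun x hx => ?_) (continuousOn_heatRemainder hc hS he M)
    exact (Complex.continuousAt_ofReal_cpow_const x _ (Or.inr (ne_of_gt hx))).continuousWithinAt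
  -- the line of integration is `Re p = 1 / t`
  have hmain := norm_le_of_norm_laplace_le (B := 2 * ε / Real.exp 1 * t⁻¹ ^ (α M - m + 2))
    hcont hσ (hlap _ (by simpa using ht)).1 (fun p hp => ?_) ht
  · rw [norm_mul, Complex.norm_cpow_eq_rpow_re_of_pos ht, inv_mul_cancel₀ ht.ne'] at hmain
    have hre : ((m : ℂ) - 1).re = (m : ℝ) - 1 := by simp
    have e1 : t⁻¹ ^ (α M - m + 2) = t ^ ((m : ℝ) - 1) * t ^ (-α M) * t⁻¹ := by
      rw [Real.inv_rpow ht.le, ← Real.rpow_neg ht.le, ← Real.rpow_neg_one t,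
        ← Real.rpow_add ht, ← Real.rpow_add ht]
      ring_nf
    rw [hre, e1] at hmain
    have hpos : 0 < t ^ ((m : ℝ) - 1) := Real.rpow_pos_of_pos ht _
    have hpos2 : 0 < t ^ (-α M) := Real.rpow_pos_of_pos ht _
    rw [Real.norm_of_nonneg hpos2.le]
    refine le_of_mul_le_mul_left (hmain.trans (le_of_eq ?_)) hpos
    field_simp
  · have hp0 : 0 < p.re := by rw [hp]; exact hσ
    have hpn : t⁻¹ ≤ ‖p‖ := by rw [← hp]; exact Complex.re_le_norm p
    have hpn0 : 0 < ‖p‖ := hσ.trans_le hpn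
    rw [(hlap p hp0).2, norm_mul, norm_pow, norm_neg, norm_one, one_pow, one_mul]
    refine (hR p hp0 (hRσ.trans hpn)).trans ?_
    rw [mul_assoc]
    gcongr
    have e2 : ‖p‖ ^ (α M - m) = ‖p‖ ^ (α M - m + 2) * (‖p‖ ^ 2)⁻¹ := by
      rw [← Real.rpow_natCast ‖p‖ 2, ← Real.rpow_neg hpn0.le, ← Real.rpow_add hpn0]
      push_cast
      ring_nf
    rw [e2]
    exact mul_le_mul_of_nonneg_right
      (Real.rpow_le_rpow_of_nonpos hσ hpn (by have := hmα M le_rfl; linarith)) (by positivity)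

/-- The coefficients of a heat expansion are unique. -/
lemma HasHeatExpansion.coeff_unique {c c' : ℕ → ℂ} (h : HasHeatExpansion S N α c)
    (h' : HasHeatExpansion S N α c') (j : ℕ) : (j : ℕ∞) ≤ N → c j = c' j := by
  induction j using Nat.strong_induction_on with
  | _ j ih =>
    intro hj
    have hsum : ∀ t : ℝ, ∑ i ∈ Finset.range j, c i * ((t ^ (-α i) : ℝ) : ℂ) =
        ∑ i ∈ Finset.range j, c' i * ((t ^ (-α i) : ℝ) : ℂ) := fun t =>
      Finset.sum_congr rfl fun i hi => by
        have hij := Finset.mem_range.1 hi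
        rw [ih i hij (le_trans (by exact_mod_cast hij.le) hj)]
    have hd : (fun t : ℝ => (c j - c' j) * ((t ^ (-α j) : ℝ) : ℂ))
        =o[𝓝[>] 0] fun t : ℝ => t ^ (-α j) := by
      refine ((h' j hj).sub (h j hj)).congr_left fun t => ?_
      rw [Finset.sum_range_succ, Finset.sum_range_succ, hsum]
      ring
    have hlim : Tendsto (fun _ : ℝ => ‖c j - c' j‖) (𝓝[>] 0) (𝓝 0) := by
      refine hd.norm_left.tendsto_div_nhds_zero.congr' ?_
      filter_upwards [self_mem_nhdsWithin] with t ht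
      have : 0 < t ^ (-α j) := Real.rpow_pos_of_pos ht _
      rw [norm_mul, Complex.norm_real, Real.norm_of_nonneg this.le]
      field_simp
    have := tendsto_nhds_unique hlim tendsto_const_nhds
    exact sub_eq_zero.1 (norm_eq_zero.1 this.symm)

end

variable {S : ℕ → ℂ} {κ : ℝ} {N : ℕ∞} {α : ℕ → ℝ} {a : ℕ → ℕ →₀ ℂ}

/-! ### Finite parts and special values of the zeta function -/

/-- Right-hand behaviour of a continuation of the zeta function at an exponent that is an
integer `0 ≤ k ≤ genus`: a simple polar term and a finite part. -/
lemma IsZetaContinuation.tendsto_rightOf (h : HasConeExpansion S κ N α a)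
    (hc : InCone S κ) (hS : Tendsto (fun n => ‖S n‖) atTop atTop) (he : exponent S < ⊤)
    (hα : ∀ i j : ℕ, i < j → (j : ℕ∞) ≤ N → α j < α i) {j k : ℕ}
    (hj : (j : ℕ∞) ≤ N) (hjk : α j = k) (hk : k ≤ genus S) {Z : ℂ → ℂ}
    (hZ : IsZetaContinuation S {s | α j < s.re} Z) :
    Tendsto (fun s => Z s - (-1) ^ (k + 1) * k * a j 1 / (s - k)) (rightOf k)
      (𝓝 ((-1) ^ (k + 1) * (k * a j 0 + a j 1))) := by
  refine tendsto_rightOf_of_comp_add ((zetaFormula_tendsto_right h hc hS he hα hj hjk hk).congr' ?_)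
  filter_upwards [hZ.eventuallyEq_zetaFormula h hc hS he hα hj hjk hk] with z hz
  simp only [Complex.ofReal_natCast]
  rw [hz.eq_of_nhds, add_sub_cancel_left]

/-- At an exponent `0`, the derivative of a continuation tends to `-a_{0,0}` from the right. -/
lemma IsZetaContinuation.tendsto_deriv_rightOf_zero (h : HasConeExpansion S κ N α a)
    (hc : InCone S κ) (hS : Tendsto (fun n => ‖S n‖) atTop atTop) (he : exponent S < ⊤)
    (hα : ∀ i j : ℕ, i < j → (j : ℕ∞) ≤ N → α j < α i) {j : ℕ}
    (hj : (j : ℕ∞) ≤ N) (hj0 : α j = 0) {Z : ℂ → ℂ}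
    (hZ : IsZetaContinuation S {s | α j < s.re} Z) :
    Tendsto (deriv Z) (rightOf 0) (𝓝 (-a j 0)) := by
  refine tendsto_rightOf_of_comp_add
    ((deriv_zetaFormula_tendsto_right h hc hS he hα hj hj0).congr' ?_)
  filter_upwards [hZ.eventuallyEq_zetaFormula h hc hS he hα hj (k := 0) (by simpa using hj0)
    (Nat.zero_le _)] with z hz
  simp only [Nat.cast_zero, Complex.ofReal_zero, zero_add] at hz ⊢
  exact hz.deriv_eq.symm

end SpectralSeq

theorem mainTheorem6 (S : ℕ → ℂ) (N : ℕ∞) (α : ℕ → ℝ) (a : ℕ → ℕ →₀ ℂ)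
    (hS : SpectralSeq.IsTotallyRegular S N α a) :
    -- the heat function has an expansion, and `ζ(s, S)` continues to `Re s > order`
    (∃ c : ℕ → ℂ, SpectralSeq.HasHeatExpansion S N α c) ∧
    (∃ Z : ℂ → ℂ, SpectralSeq.IsZetaContinuation S
      {s : ℂ | SpectralSeq.order N α < (s.re : EReal)} Z) ∧
    ∀ (c : ℕ → ℂ) (Ω : Set ℂ) (Z : ℂ → ℂ),
      SpectralSeq.HasHeatExpansion S N α c →
      {s : ℂ | SpectralSeq.order N α < (s.re : EReal)} ⊆ Ω →
      SpectralSeq.IsZetaContinuation S Ω Z →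
      ∀ j : ℕ, (j : ℕ∞) ≤ N →
        -- only exponents not larger than the exponent of convergence contribute
        (SpectralSeq.exponent S < (α j : EReal) → a j 0 = 0 ∧ a j 1 = 0) ∧
        -- `α_j` is not an integer, or is a negative integer
        ((∀ m : ℤ, α j = (m : ℝ) → m ≤ -1) →
          a j 0 = Complex.Gamma (-(α j : ℂ)) * c j ∧ a j 1 = 0) ∧
        -- `α_j = k` is an integer with `0 < k ≤ genus`
        (∀ k : ℕ, α j = (k : ℝ) → 0 < k → k ≤ SpectralSeq.genus S →
          a j 1 = (-1) ^ (k + 1) / (k.factorial : ℂ) * c j ∧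
          (∃ v : ℂ, SpectralSeq.IsFinitePart Z (SpectralSeq.rightOf (k : ℝ)) (k : ℂ) v ∧
            ((k : ℂ) ∈ Ω → SpectralSeq.IsFinitePart Z (nhdsWithin (k : ℂ) {(k : ℂ)}ᶜ) (k : ℂ) v) ∧
            a j 0 = (-1) ^ k / (k : ℂ) * (1 / (k.factorial : ℂ) * c j - v))) ∧
        -- `α_j = 0`
        (α j = 0 →
          a j 1 = -c j ∧
          Filter.Tendsto Z (SpectralSeq.rightOf 0) (nhds (-a j 1)) ∧
          Filter.Tendsto (deriv Z) (SpectralSeq.rightOf 0) (nhds (-a j 0)) ∧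
          ((0 : ℂ) ∈ Ω → AnalyticAt ℂ Z 0 ∧ a j 0 = -deriv Z 0 ∧ a j 1 = -Z 0)) := by
  obtain ⟨κ, hc, h⟩ := hS.toIsRegular.exists_cone
  have hinf := hS.tendsto_infty
  have he := hS.exponent_lt_top
  obtain ⟨_, _, -, -, -, -, hexp⟩ := hS.expansion
  have hα := hexp.strictAnti
  have hheat := h.hasHeatExpansion hc hinf he hS.log_terms
  refine ⟨⟨_, hheat⟩, SpectralSeq.exists_isZetaContinuation h hc hinf he hα hexp.tendsto_atBot, ?_⟩
  intro c Ω Z hcoeff hΩ hZ j hj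
  have hcj : c j = SpectralSeq.heatCoeff α a j := hcoeff.coeff_unique hheat j hj
  have hZj : SpectralSeq.IsZetaContinuation S {s | α j < s.re} Z :=
    hZ.mono fun s hs => hΩ ((SpectralSeq.order_le hα hj).trans_lt (by exact_mod_cast hs))
  refine ⟨h.coeff_eq_zero hc hinf he hα j hj, fun hint => ?_, fun k hjk hk0 hk => ?_, fun hj0 => ?_⟩
  · have hne : ∀ k : ℕ, α j ≠ k := fun k hk => by
      have := hint k (by exact_mod_cast hk)
      omega
    refine ⟨?_, ?_⟩
    · rw [hcj, SpectralSeq.heatCoeff_of_ne_nat hne,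
        mul_div_cancel₀ _ (SpectralSeq.Gamma_neg_ofReal_ne_zero hne)]
    · by_contra h1
      obtain ⟨k, hk⟩ := hS.log_terms j hj h1
      exact hne k hk
  · have hfac : (k.factorial : ℂ) ≠ 0 := by exact_mod_cast k.factorial_ne_zero
    have hk' : (k : ℂ) ≠ 0 := by exact_mod_cast hk0.ne'
    have hsq : ((-1 : ℂ) ^ k) * (-1) ^ k = 1 := by rw [← mul_pow]; simp
    have hlim := hZj.tendsto_rightOf h hc hinf he hα hj hjk hk
    rw [hcj, SpectralSeq.heatCoeff_of_eq_nat hjk]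
    refine ⟨?_, (-1) ^ (k + 1) * (k * a j 0 + a j 1),
      ⟨1, fun _ => (-1) ^ (k + 1) * k * a j 1, by simpa using hlim⟩, fun hkΩ =>
      ⟨1, fun _ => (-1) ^ (k + 1) * k * a j 1, ?_⟩, ?_⟩
    · field_simp
      linear_combination (-a j 1) * hsq
    · have hmer : MeromorphicAt
          (fun s => Z s - (-1) ^ (k + 1) * k * a j 1 / (s - k)) ((k : ℝ) : ℂ) := by
        have hZk := (hZ.meromorphic hkΩ).meromorphicAt
        simp only [Complex.ofReal_natCast]
        fun_prop
      simpa using SpectralSeq.tendsto_nhdsNE_of_tendsto_rightOf hmer hlim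
    · field_simp
      linear_combination (-k * a j 0) * hsq
  · have hjk : α j = (0 : ℕ) := by simpa using hj0
    have hlim : Tendsto Z (SpectralSeq.rightOf 0) (𝓝 (-a j 1)) := by
      simpa using hZj.tendsto_rightOf h hc hinf he hα hj hjk (Nat.zero_le _)
    have hlim' := hZj.tendsto_deriv_rightOf_zero h hc hinf he hα hj hj0
    refine ⟨by rw [hcj, SpectralSeq.heatCoeff_of_eq_nat hjk]; simp, hlim, hlim', fun h0 => ?_⟩
    have hnf := hZ.meromorphic h0
    have hle : SpectralSeq.rightOf 0 ≤ 𝓝 (0 : ℂ) := by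
      simpa using (SpectralSeq.rightOf_le_nhdsNE 0).trans nhdsWithin_le_nhds
    -- a bounded meromorphic function in normal form is analytic
    have han : AnalyticAt ℂ Z 0 := by
      refine hnf.meromorphicOrderAt_nonneg_iff_analyticAt.1
        ((tendsto_nhds_iff_meromorphicOrderAt_nonneg hnf.meromorphicAt).1 ⟨-a j 1, ?_⟩)
      have := SpectralSeq.tendsto_nhdsNE_of_tendsto_rightOf (x := 0) (f := Z)
        (by simpa using hnf.meromorphicAt) hlim
      simpa using this
    refine ⟨han, ?_, ?_⟩
    · rw [tendsto_nhds_unique (han.deriv.continuousAt.tendsto.mono_left hle) hlim', neg_neg]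
    · rw [tendsto_nhds_unique (han.continuousAt.tendsto.mono_left hle) hlim, neg_neg]
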